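/- **Setting.** Let $p_\theta$ ($\theta\in\mathbb R$) be probability densities, $p_\theta^n$ the law of $n$ i.i.d. observations. An estimator is a sequence $\vec T=\{T_n\}$ of real-valued measurable functions $T_n$ of $n$ observations. Put $$\beta(\vec T,\theta,\epsilon)=\liminf_{n\to\infty}-\tfrac1n\log p_\theta^n\{|T_n-\theta|\ge\epsilon\},\qquad I^s(p\|q)=-\log\int p^sq^{1-s}\quad(0<s<1),$$ and, for a function $g$ that is positive on $(0,\infty)$, $$\alpha_1(\theta)=\limsup_{\epsilon\to+0}\frac1{g(\epsilon)}\sup_{\vec T}\inf_{|\theta'-\theta|\le\epsilon}\beta(\vec T,\theta',\epsilon),\qquad \alpha_2(\vec T,\theta)=\liminf_{\epsilon\to+0}\frac1{g(\epsilon)}\inf_{|\theta'-\theta|\le\epsilon}\beta(\vec T,\theta',\epsilon),\qquad \alpha_2(\theta)=\sup_{\vec T}\alpha_2(\vec T,\theta),$$ $$I^s_{g,\theta}=\lim_{\epsilon\to+0}\frac{I^s(p_{\theta-\epsilon/2}\|p_{\theta+\epsilon/2})}{g(\epsilon)},\qquad x^\kappa=\lim_{\epsilon\to+0}\frac{g(x\epsilon)}{g(\epsilon)}\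 (x>0),\qquad \overline\alpha_1(\theta)=2^\kappa\sup_{0<s<1}I^s_{g,\theta}.$$ Let $w_\kappa(s)=\frac{(s^{1/(\kappa-1)}+(1-s)^{1/(\kappa-1)})^{\kappa-1}}{s(1-s)}$ and let $\overline\alpha_2(\theta)$ be $\sup_{0<s<1}w_\kappa(s)I^s_{g,\theta}$ if $\kappa<1$, $2I^{1/2}_{g,\theta}$ if $\kappa=1$, and $\inf_{0<s<1}w_\kappa(s)I^s_{g,\theta}$ if $\kappa>1$. All of these take values in $[-\infty,\infty]$, with $-\log0=\infty$. **Proposition (semi-regular case).** Let $f$ be a probability density on $\mathbb R$ of one of the following two kinds. (i) $f$ is positive and $C^1$ on a bounded interval $(a,b)$, zero outside it, with $f(x)\sim A_1(x-a)^{\kappa_1-1}$ as $x\to a+0$ and $f(x)\sim A_2(b-x)^{\kappa_2-1}$ as $x\to b-0$, where $A_1,A_2>0$ and $\kappa_1,\kappa_2>2$. (ii) $f$ is positive and $C^3$ on a half line $(a,\infty)$, zero outside it, with $f(x)\sim A_1(x-a)^{\kappa_1-1}$ as $x\to a+0$, where $A_1>0$ and $\kappa_1>2$, and $\lim_{x\to\infty}|(\log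 f)'(x)|$ exists and is finite. Consider the location shift family $p_\theta(x)=f(x-\theta)$, let $J_f=\int f'(x)^2f(x)^{-1}\,dx\in[0,\infty]$ (over the support of $f$) be the Fisher information, and let $g(x)=x^2$. Then $\kappa=2$; for each $\theta\in\mathbb R$ and $0<s<1$ the limit $I^s_{g,\theta}$ exists and equals $\frac{s(1-s)}2J_f$; and $$\overline\alpha_1(\theta)=\alpha_1(\theta)=\overline\alpha_2(\theta)=\alpha_2(\theta)=\tfrac12J_f .$$ If moreover $\log f$ is concave on the support of $f$, then a (measurable) maximum likelihood estimator exists, and every maximum likelihood estimator $\vec\theta_{ML}$ attains the bound: $\lim_{\epsilon\to+0}\epsilon^{-2}\inf_{|\theta'-\theta|\le\epsilon}\beta(\vec\theta_{ML},\theta',\epsilon)=\alpha_2(\vec\theta_{ML},\theta)=\frac12J_f$. -/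

import Mathlib

open MeasureTheory Filter Topology
open scoped ENNReal

noncomputable section

/-! ## Families of densities, estimators, exponential rates

A one-parameter family is given by densities `p θ : Ω → ℝ` (`θ : ℝ`) with respect to `μ`. -/

/-- The law of `n` i.i.d. observations from the density `p θ` with respect to `μ`. -/
def iidLaw {Ω : Type*} [MeasurableSpace Ω] (μ : Measure Ω) (p : ℝ → Ω → ℝ) (θ : ℝ) (n : ℕ) :
    Measure (Fin n → Ω) :=
  Measure.pi fun _ => μ.withDensity fun ω => ENNReal.ofReal (p θ ω)

/-- An estimator: a sequence of measurable real functions of the `n` observations. -/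
structure Estimator (Ω : Type*) [MeasurableSpace Ω] where
  toFun : (n : ℕ) → (Fin n → Ω) → ℝ
  measurable_toFun : ∀ n, Measurable (toFun n)

/-- First exponential rate: `β(T, θ, ε) = liminf_n -(1/n) log p_θⁿ {|T_n - θ| ≥ ε}`,
with `-log 0 = ∞`. -/
def expRate {Ω : Type*} [MeasurableSpace Ω] (μ : Measure Ω) (p : ℝ → Ω → ℝ)
    (T : Estimator Ω) (θ ε : ℝ) : EReal :=
  liminf (fun n : ℕ =>
    (-ENNReal.log (iidLaw μ p θ n {x | ε ≤ |T.toFun n x - θ|})) / ((n : ℝ) : EReal)) atTop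

/-- `inf_{θ - ε ≤ θ' ≤ θ + ε} β(T, θ', ε)`. -/
def localRate {Ω : Type*} [MeasurableSpace Ω] (μ : Measure Ω) (p : ℝ → Ω → ℝ)
    (T : Estimator Ω) (θ ε : ℝ) : EReal :=
  ⨅ θ' ∈ Set.Icc (θ - ε) (θ + ε), expRate μ p T θ' ε

/-- `α₁(θ)`. -/
def alphaOne {Ω : Type*} [MeasurableSpace Ω] (μ : Measure Ω) (p : ℝ → Ω → ℝ)
    (g : ℝ → ℝ) (θ : ℝ) : EReal :=
  limsup (fun ε : ℝ => (⨆ T : Estimator Ω, localRate μ p T θ ε) / ((g ε : ℝ) : EReal)) (𝓝[>] 0)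

/-- `α₂(T, θ)`. -/
def alphaTwoOf {Ω : Type*} [MeasurableSpace Ω] (μ : Measure Ω) (p : ℝ → Ω → ℝ)
    (g : ℝ → ℝ) (T : Estimator Ω) (θ : ℝ) : EReal :=
  liminf (fun ε : ℝ => localRate μ p T θ ε / ((g ε : ℝ) : EReal)) (𝓝[>] 0)

/-- `α₂(θ)`. -/
def alphaTwo {Ω : Type*} [MeasurableSpace Ω] (μ : Measure Ω) (p : ℝ → Ω → ℝ)
    (g : ℝ → ℝ) (θ : ℝ) : EReal :=
  ⨆ T : Estimator Ω, alphaTwoOf μ p g T θ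

/-! ## Relative Rényi entropies and the two upper bounds -/

/-- `Iˢ(p‖q) = -log ∫ pˢ q¹⁻ˢ dμ` for densities `p, q` (`+∞` if the integral vanishes). -/
def relRenyi {Ω : Type*} [MeasurableSpace Ω] (μ : Measure Ω) (s : ℝ) (p q : Ω → ℝ) : EReal :=
  -ENNReal.log (∫⁻ ω, ENNReal.ofReal (p ω ^ s * q ω ^ (1 - s)) ∂μ)

/-- `Iˢ(p_{θ-ε/2} ‖ p_{θ+ε/2}) / g(ε)`. -/
def renyiQuot {Ω : Type*} [MeasurableSpace Ω] (μ : Measure Ω) (p : ℝ → Ω → ℝ)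
    (g : ℝ → ℝ) (θ s ε : ℝ) : EReal :=
  relRenyi μ s (p (θ - ε / 2)) (p (θ + ε / 2)) / ((g ε : ℝ) : EReal)

/-- `Iˢ_{g,θ}`, the limit of `renyiQuot` as `ε → +0` (meaningful when the limit exists). -/
def renyiLim {Ω : Type*} [MeasurableSpace Ω] (μ : Measure Ω) (p : ℝ → Ω → ℝ)
    (g : ℝ → ℝ) (θ s : ℝ) : EReal :=
  limUnder (𝓝[>] (0 : ℝ)) (renyiQuot μ p g θ s)

/-- `κ` is the index of `g` at `+0`: `lim_{ε → +0} g(xε)/g(ε) = x^κ` for all `x > 0`. -/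
def IsIndex (g : ℝ → ℝ) (κ : ℝ) : Prop :=
  ∀ x : ℝ, 0 < x → Tendsto (fun ε : ℝ => g (x * ε) / g ε) (𝓝[>] 0) (𝓝 (x ^ κ))

/-- The upper bound `ᾱ₁(θ) = 2^κ sup_{0<s<1} Iˢ_{g,θ}`, for `g` of index `κ`. -/
def alphaOneBar {Ω : Type*} [MeasurableSpace Ω] (μ : Measure Ω) (p : ℝ → Ω → ℝ)
    (g : ℝ → ℝ) (κ θ : ℝ) : EReal :=
  (((2 : ℝ) ^ κ : ℝ) : EReal) * ⨆ s ∈ Set.Ioo (0 : ℝ) 1, renyiLim μ p g θ s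

/-- `(s^{1/(κ-1)} + (1-s)^{1/(κ-1)})^{κ-1} / (s(1-s))`. -/
def barWeight (κ s : ℝ) : ℝ :=
  (s ^ (1 / (κ - 1)) + (1 - s) ^ (1 / (κ - 1))) ^ (κ - 1) / (s * (1 - s))

/-- The upper bound `ᾱ₂(θ)`, for `g` of index `κ`. -/
def alphaTwoBar {Ω : Type*} [MeasurableSpace Ω] (μ : Measure Ω) (p : ℝ → Ω → ℝ)
    (g : ℝ → ℝ) (κ θ : ℝ) : EReal :=
  if κ < 1 then ⨆ s ∈ Set.Ioo (0 : ℝ) 1, ((barWeight κ s : ℝ) : EReal) * renyiLim μ p g θ s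
  else if κ = 1 then 2 * renyiLim μ p g θ (1 / 2)
  else ⨅ s ∈ Set.Ioo (0 : ℝ) 1, ((barWeight κ s : ℝ) : EReal) * renyiLim μ p g θ s

/-- `T` is a maximum likelihood estimator: `T_n(x)` maximizes `θ ↦ ∏ᵢ p_θ(xᵢ)`. -/
def IsMLE {Ω : Type*} [MeasurableSpace Ω] (p : ℝ → Ω → ℝ) (T : Estimator Ω) : Prop :=
  ∀ (n : ℕ) (x : Fin n → Ω) (θ : ℝ), ∏ i, p θ (x i) ≤ ∏ i, p (T.toFun n x) (x i)

/-! ## Location shift families -/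

/-- The location shift family `f_θ(x) = f(x - θ)`. -/
def shiftFamily (f : ℝ → ℝ) (θ x : ℝ) : ℝ := f (x - θ)

/-- `f` is a probability density, positive exactly on `S` and zero elsewhere. -/
structure IsDensityOn (f : ℝ → ℝ) (S : Set ℝ) : Prop where
  pos : ∀ x ∈ S, 0 < f x
  zero : ∀ x, x ∉ S → f x = 0
  integral_eq_one : ∫ x, f x = 1

/-- The semi-regular case on a bounded interval: a `C¹` density on `(a, b)` with
`f(x) ≅ A₁ (x-a)^{κ₁-1}` at `a`, `f(x) ≅ A₂ (b-x)^{κ₂-1}` at `b`, and `κ₁, κ₂ > 2`. -/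
structure IsSemiRegularInterval (f : ℝ → ℝ) (a b κ₁ κ₂ A₁ A₂ : ℝ) : Prop where
  lt : a < b
  density : IsDensityOn f (Set.Ioo a b)
  smooth : ContDiffOn ℝ 1 f (Set.Ioo a b)
  two_lt_left : 2 < κ₁
  two_lt_right : 2 < κ₂
  pos_left : 0 < A₁
  pos_right : 0 < A₂
  left : Asymptotics.IsEquivalent (𝓝[>] a) f (fun x => A₁ * (x - a) ^ (κ₁ - 1))
  right : Asymptotics.IsEquivalent (𝓝[<] b) f (fun x => A₂ * (b - x) ^ (κ₂ - 1))

/-- The semi-regular case on a half line: a `C³` density on `(a, ∞)` with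
`f(x) ≅ A₁ (x-a)^{κ₁-1}` at `a`, `κ₁ > 2`, and `lim_{x → ∞} |(log f)'(x)| < ∞`. -/
structure IsSemiRegularHalfLine (f : ℝ → ℝ) (a κ₁ A₁ : ℝ) : Prop where
  density : IsDensityOn f (Set.Ioi a)
  smooth : ContDiffOn ℝ 3 f (Set.Ioi a)
  two_lt_left : 2 < κ₁
  pos_left : 0 < A₁
  left : Asymptotics.IsEquivalent (𝓝[>] a) f (fun x => A₁ * (x - a) ^ (κ₁ - 1))
  tail : ∃ L : ℝ, Tendsto (fun x => |deriv (fun y => Real.log (f y)) x|) atTop (𝓝 L)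

/-- The semi-regular case. -/
def IsSemiRegular (f : ℝ → ℝ) : Prop :=
  (∃ a b κ₁ κ₂ A₁ A₂ : ℝ, IsSemiRegularInterval f a b κ₁ κ₂ A₁ A₂) ∨
    ∃ a κ₁ A₁ : ℝ, IsSemiRegularHalfLine f a κ₁ A₁

/-- The Fisher information `J_f = ∫ f'(x)² f(x)⁻¹ dx` over the support of `f`. -/
def fisherInfo (f : ℝ → ℝ) : ℝ≥0∞ :=
  ∫⁻ x in Function.support f, ENNReal.ofReal ((deriv f x) ^ 2 / f x)

end

/-! Of a semi-regular `f`, only what `IsShiftDensity` records is used: it is continuous on the whole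
line (this is where the exponents `κ₁, κ₂ > 2` enter), and `C¹` on its support, an interval with
countable frontier. The Fisher information `J` may be infinite.

Rényi limit. With `a = f (y + ε)` and `b = f y`, the defect `s a + (1 - s) b - aˢ b¹⁻ˢ` integrates
to one minus the affinity, and divided by `ε²` it tends pointwise to `s(1-s)/2 · f'²/f`. Fatou
bounds the limit from below. For finite `J` the defect is dominated by `(√a - √b)²`, whose integral
is at most `ε² J/4` by Cauchy-Schwarz applied to `(√f)'`. This bound is sharp in the limit, so Fatou
for the difference gives the matching upper bound (`tendsto_lintegral_amgmDefect`). At `κ = 2` the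
weight is `1/(s(1-s))`, and both barred bounds become `J/2`.

Converse. Every value of an estimator is at distance at least `ε` from `θ - ε` or from `θ + ε`, so
an estimator is a test between these two parameters. A change of measure from the law with density
proportional to `√(pq)` bounds the sum of the two error probabilities from below
(`chernoff_converse`, `localRate_le`). The exponent involves affinities of orders `1/2` and `1/2 ±
h` only; it is asymptotically at most `(J/2 + hJ) ε²`, and `h → 0` at the end.

Achievability. The supremum in `α₂(θ)` is taken at a fixed `θ`, so the estimator may depend on `θ`.
One Newton step from `θ`, with the score cut off to a compact interval `[a, b]` in the support, has
bounded summands; Chernoff's bound gives the rate `J_{[a,b]}/2`, uniformly over `|θ' - θ| ≤ ε`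
(`fisherOn_div_two_le_alphaTwoOf_oneStep`). Compact intervals exhaust `J`.

Maximum likelihood. For log-concave `f` the score is monotone, so an error of size `ε` fixes the
sign of the score sum at `θ' ± ε`, and Chernoff's bound applies again. On `[a, b]` the exponential
moment is expanded to second order; outside, the tangent line of `log f` shows that the integrand
does not exceed `f` (`exists_lintegral_exp_score_le`). -/

/-! ### Reduction to continuous densities supported on an interval -/

/-- A continuous probability density which is `C¹` on its support, an interval. -/
structure IsShiftDensity (f : ℝ → ℝ) : Prop where
  nonneg : ∀ x, 0 ≤ f x
  continuous : Continuous f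
  integral_eq_one : ∫ x, f x = 1
  ordConnected : (Function.support f).OrdConnected
  contDiffOn : ContDiffOn ℝ 1 f (Function.support f)
  countable_frontier : (frontier (Function.support f)).Countable

theorem IsDensityOn.support_eq {f : ℝ → ℝ} {S : Set ℝ} (h : IsDensityOn f S) :
    Function.support f = S := by
  ext x
  refine ⟨fun hx => by_contra fun hS => hx (h.zero x hS), fun hx => (h.pos x hx).ne'⟩

theorem IsDensityOn.nonneg {f : ℝ → ℝ} {S : Set ℝ} (h : IsDensityOn f S) (x : ℝ) : 0 ≤ f x := by
  by_cases hx : x ∈ S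
  · exact (h.pos x hx).le
  · exact (h.zero x hx).ge

theorem tendsto_zero_of_isEquivalent_rpow {f d : ℝ → ℝ} {l : Filter ℝ} {A κ : ℝ} (hκ : 2 < κ)
    (hd : Tendsto d l (𝓝 0)) (h : Asymptotics.IsEquivalent l f fun x => A * d x ^ (κ - 1)) :
    Tendsto f l (𝓝 0) := by
  refine h.symm.tendsto_nhds ?_
  have := (hd.rpow_const (p := κ - 1) (Or.inr (by linarith))).const_mul A
  rwa [Real.zero_rpow (by linarith), mul_zero] at this

theorem continuousAt_of_tendsto_zero_right {f : ℝ → ℝ} {a : ℝ} (hz : ∀ x ≤ a, f x = 0)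
    (h : Tendsto f (𝓝[>] a) (𝓝 0)) : ContinuousAt f a := by
  rw [continuousAt_iff_continuous_left'_right']
  constructor
  · refine ContinuousWithinAt.congr (f := fun _ => (0 : ℝ)) continuousWithinAt_const
      (fun x hx => hz x (le_of_lt hx)) (hz a le_rfl)
  · rw [ContinuousWithinAt, hz a le_rfl]
    exact h

theorem continuousAt_of_tendsto_zero_left {f : ℝ → ℝ} {b : ℝ} (hz : ∀ x, b ≤ x → f x = 0)
    (h : Tendsto f (𝓝[<] b) (𝓝 0)) : ContinuousAt f b := by
  rw [continuousAt_iff_continuous_left'_right']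
  constructor
  · rw [ContinuousWithinAt, hz b le_rfl]
    exact h
  · refine ContinuousWithinAt.congr (f := fun _ => (0 : ℝ)) continuousWithinAt_const
      (fun x hx => hz x (le_of_lt hx)) (hz b le_rfl)

theorem IsSemiRegularInterval.isShiftDensity {f : ℝ → ℝ} {a b κ₁ κ₂ A₁ A₂ : ℝ}
    (h : IsSemiRegularInterval f a b κ₁ κ₂ A₁ A₂) : IsShiftDensity f := by
  have hs := h.density.support_eq
  have hz := h.density.zero
  refine ⟨h.density.nonneg, ?_, h.density.integral_eq_one, hs ▸ Set.ordConnected_Ioo,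
    hs ▸ h.smooth, ?_⟩
  · rw [continuous_iff_continuousAt]
    intro x
    rcases lt_trichotomy x a with hx | rfl | hx
    · refine (continuousAt_const (y := (0 : ℝ))).congr ?_
      filter_upwards [eventually_lt_nhds hx] with y hy
      exact (hz y fun hy' => (hy.trans hy'.1).false).symm
    · refine continuousAt_of_tendsto_zero_right (fun y hy => hz y fun hy' => hy'.1.not_ge hy) ?_
      refine tendsto_zero_of_isEquivalent_rpow h.two_lt_left ?_ h.left
      exact tendsto_nhdsWithin_of_tendsto_nhds
        ((continuous_sub_right x).tendsto' x (0 : ℝ) (sub_self x))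
    · rcases lt_trichotomy x b with hx' | rfl | hx'
      · exact h.smooth.continuousOn.continuousAt (Ioo_mem_nhds hx hx')
      · refine continuousAt_of_tendsto_zero_left (fun y hy => hz y fun hy' => hy'.2.not_ge hy) ?_
        refine tendsto_zero_of_isEquivalent_rpow h.two_lt_right ?_ h.right
        exact tendsto_nhdsWithin_of_tendsto_nhds
          ((continuous_sub_left x).tendsto' x (0 : ℝ) (sub_self x))
      · refine (continuousAt_const (y := (0 : ℝ))).congr ?_
        filter_upwards [eventually_gt_nhds hx'] with y hy
        exact (hz y fun hy' => (hy.trans hy'.2).false).symm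
  · rw [hs, frontier_Ioo h.lt]
    exact (Set.toFinite _).countable

theorem IsSemiRegularHalfLine.isShiftDensity {f : ℝ → ℝ} {a κ₁ A₁ : ℝ}
    (h : IsSemiRegularHalfLine f a κ₁ A₁) : IsShiftDensity f := by
  have hs := h.density.support_eq
  have hz := h.density.zero
  refine ⟨h.density.nonneg, ?_, h.density.integral_eq_one, hs ▸ Set.ordConnected_Ioi,
    hs ▸ h.smooth.of_le (by norm_num), ?_⟩
  · rw [continuous_iff_continuousAt]
    intro x
    rcases lt_trichotomy x a with hx | rfl | hx
    · refine (continuousAt_const (y := (0 : ℝ))).congr ?_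
      filter_upwards [eventually_lt_nhds hx] with y hy
      exact (hz y fun hy' => (hy.trans hy').false).symm
    · refine continuousAt_of_tendsto_zero_right (fun y hy => hz y fun hy' => hy'.not_ge hy) ?_
      refine tendsto_zero_of_isEquivalent_rpow h.two_lt_left ?_ h.left
      exact tendsto_nhdsWithin_of_tendsto_nhds
        ((continuous_sub_right x).tendsto' x (0 : ℝ) (sub_self x))
    · exact h.smooth.continuousOn.continuousAt (Ioi_mem_nhds hx)
  · rw [hs, frontier_Ioi]
    exact (Set.toFinite _).countable

theorem IsSemiRegular.isShiftDensity {f : ℝ → ℝ} (h : IsSemiRegular f) : IsShiftDensity f := by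
  rcases h with ⟨a, b, κ₁, κ₂, A₁, A₂, h⟩ | ⟨a, κ₁, A₁, h⟩
  · exact h.isShiftDensity
  · exact h.isShiftDensity

/-! ### Regularity on the support and exhaustion of the Fisher information -/

namespace IsShiftDensity

variable {f : ℝ → ℝ}

theorem isOpen_support (hf : IsShiftDensity f) : IsOpen (Function.support f) :=
  hf.continuous.isOpen_support

theorem pos (hf : IsShiftDensity f) {x : ℝ} (hx : x ∈ Function.support f) : 0 < f x :=
  (hf.nonneg x).lt_of_ne' hx

theorem integrable (hf : IsShiftDensity f) : Integrable f := by
  by_contra h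
  have := hf.integral_eq_one
  rw [integral_undef h] at this
  norm_num at this

theorem lintegral_eq_one (hf : IsShiftDensity f) : ∫⁻ x, ENNReal.ofReal (f x) = 1 := by
  rw [← ofReal_integral_eq_lintegral_ofReal hf.integrable (ae_of_all _ hf.nonneg),
    hf.integral_eq_one, ENNReal.ofReal_one]

theorem hasDerivAt (hf : IsShiftDensity f) {x : ℝ} (hx : x ∈ Function.support f) :
    HasDerivAt f (deriv f x) x :=
  ((hf.contDiffOn.differentiableOn one_ne_zero).differentiableAt
    (hf.isOpen_support.mem_nhds hx)).hasDerivAt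

theorem continuousOn_deriv (hf : IsShiftDensity f) :
    ContinuousOn (deriv f) (Function.support f) :=
  hf.contDiffOn.continuousOn_deriv_of_isOpen hf.isOpen_support le_rfl

theorem continuousOn_fisher (hf : IsShiftDensity f) :
    ContinuousOn (fun x => deriv f x ^ 2 / f x) (Function.support f) :=
  (hf.continuousOn_deriv.pow 2).div hf.continuous.continuousOn fun _ hx => hx

theorem support_nonempty (hf : IsShiftDensity f) : (Function.support f).Nonempty := by
  rw [Function.support_nonempty_iff]
  rintro rfl
  simpa using hf.integral_eq_one

/-- First order expansion of the density, uniform on compact subsets of the support. -/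
theorem exists_uniform_expansion (hf : IsShiftDensity f) {K : Set ℝ} (hK : IsCompact K)
    (hKS : K ⊆ Function.support f) {δ : ℝ} (hδ : 0 < δ) :
    ∃ η₀ > 0, ∀ η, |η| ≤ η₀ → ∀ y ∈ K, y + η ∈ Function.support f ∧
      |f (y + η) - f y - η * deriv f y| ≤ δ * |η| := by
  obtain ⟨r, hr, hrS⟩ := hK.exists_cthickening_subset_open hf.isOpen_support hKS
  have hu := (hK.cthickening (r := r)).uniformContinuousOn_of_continuous
    (hf.continuousOn_deriv.mono hrS)
  rw [Metric.uniformContinuousOn_iff_le] at hu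
  obtain ⟨r', hr', hu⟩ := hu δ hδ
  refine ⟨min r r', lt_min hr hr', fun η hη y hy => ?_⟩
  have hmem : ∀ z ∈ Set.uIcc y (y + η), z ∈ Metric.cthickening r K ∧ dist z y ≤ r' := by
    intro z hz
    have hd : dist z y ≤ |η| := by
      have := Set.abs_sub_left_of_mem_uIcc hz
      simpa [Real.dist_eq] using this
    exact ⟨Metric.mem_cthickening_of_dist_le z y r K hy (hd.trans (hη.trans (min_le_left _ _))),
      hd.trans (hη.trans (min_le_right _ _))⟩
  refine ⟨hrS (hmem _ Set.right_mem_uIcc).1, ?_⟩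
  -- Mean value inequality for `z ↦ f z - z f'(y)`, whose derivative is at most `δ` in absolute
  -- value by uniform continuity of `f'` near `K`.
  have key := (convex_uIcc y (y + η)).norm_image_sub_le_of_norm_hasDerivWithin_le
    (f := fun z => f z - z * deriv f y) (f' := fun z => deriv f z - 1 * deriv f y) (C := δ)
    (fun z hz => ((hf.hasDerivAt (hrS (hmem z hz).1)).sub
      ((hasDerivAt_id z).mul_const _)).hasDerivWithinAt)
    (fun z hz => by
      have := hu z (hmem z hz).1 y (Metric.self_subset_cthickening _ hy) (hmem z hz).2
      simpa [Real.dist_eq] using this)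
    Set.left_mem_uIcc Set.right_mem_uIcc
  rw [Real.norm_eq_abs, Real.norm_eq_abs, add_sub_cancel_left] at key
  convert key using 2
  ring

theorem setLIntegral_fisher_Icc (hf : IsShiftDensity f) {a b : ℝ}
    (h : Set.Icc a b ⊆ Function.support f) :
    ∫⁻ x in Set.Icc a b, ENNReal.ofReal (deriv f x ^ 2 / f x) =
      ENNReal.ofReal (∫ x in Set.Icc a b, deriv f x ^ 2 / f x) := by
  rw [ofReal_integral_eq_lintegral_ofReal]
  · exact (hf.continuousOn_fisher.mono h).integrableOn_Icc
  · exact ae_of_all _ fun x => div_nonneg (sq_nonneg _) (hf.nonneg x)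

/-- An increasing union of compact sets fills the open support, and the integral over the union is
the supremum of the integrals. The hull of such a compact set together with `x₀` stays in the
support, which is an interval. The point `x₀` will be the mode in the maximum likelihood argument.
-/
theorem exists_Icc_lt_setIntegral_fisher (hf : IsShiftDensity f) {x₀ : ℝ}
    (hx₀ : x₀ ∈ Function.support f) {c : ℝ≥0∞} (hc : c < fisherInfo f) :
    ∃ a b, a ≤ x₀ ∧ x₀ ≤ b ∧ Set.Icc a b ⊆ Function.support f ∧
      c < ENNReal.ofReal (∫ x in Set.Icc a b, deriv f x ^ 2 / f x) := by
  obtain ⟨F, hFc, hFS, hFU, hFm⟩ := hf.isOpen_support.exists_iUnion_isClosed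
  let K : ℕ → Set ℝ := fun n => F n ∩ Set.Icc (-(n : ℝ)) n
  have hKU : ⋃ n, K n = Function.support f := by
    rw [← hFU]
    refine subset_antisymm (Set.iUnion_mono fun n => Set.inter_subset_left) fun x hx => ?_
    obtain ⟨n, hn⟩ := Set.mem_iUnion.1 hx
    obtain ⟨m, hm⟩ := exists_nat_ge |x|
    refine Set.mem_iUnion.2 ⟨max n m, hFm (le_max_left _ _) hn, ?_⟩
    rw [Set.mem_Icc, ← abs_le]
    exact hm.trans (by exact_mod_cast le_max_right _ _)
  have hKm : Monotone K := fun n m hnm => Set.inter_subset_inter (hFm hnm)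
    (Set.Icc_subset_Icc (neg_le_neg (by exact_mod_cast hnm)) (by exact_mod_cast hnm))
  rw [fisherInfo, ← hKU, setLIntegral_iUnion_of_directed _ hKm.directed_le, lt_iSup_iff] at hc
  obtain ⟨n, hn⟩ := hc
  have hcomp : IsCompact (insert x₀ (K n)) :=
    (isCompact_Icc.inter_left (hFc n)).insert x₀
  have hne : (insert x₀ (K n)).Nonempty := ⟨x₀, Set.mem_insert _ _⟩
  have hsub : insert x₀ (K n) ⊆ Function.support f :=
    Set.insert_subset hx₀ (Set.inter_subset_left.trans (hFS n))
  have hI : Set.Icc (sInf (insert x₀ (K n))) (sSup (insert x₀ (K n))) ⊆ Function.support f :=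
    hf.ordConnected.out (hsub (hcomp.sInf_mem hne)) (hsub (hcomp.sSup_mem hne))
  refine ⟨_, _, csInf_le hcomp.bddBelow (Set.mem_insert _ _),
    le_csSup hcomp.bddAbove (Set.mem_insert _ _), hI, ?_⟩
  rw [← hf.setLIntegral_fisher_Icc hI]
  refine hn.trans_le (lintegral_mono_set fun x hx => ?_)
  exact ⟨csInf_le hcomp.bddBelow (Set.mem_insert_of_mem _ hx),
    le_csSup hcomp.bddAbove (Set.mem_insert_of_mem _ hx)⟩

end IsShiftDensity

/-! ### Second order behaviour of the arithmetic-geometric defect under a shift -/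

/-- If the sum leaves no room beyond the two lower limits, neither summand can exceed its own:
`limsup A ≤ α + β - liminf B ≤ α`. Fatou's lemma will supply both lower limits. -/
theorem ENNReal.tendsto_of_add_le_of_le_liminf {ι : Type*} {l : Filter ι} [l.NeBot]
    {A B : ι → ℝ≥0∞} {α β : ℝ≥0∞} (hα : α ≠ ⊤) (hβ : β ≠ ⊤) (h : ∀ᶠ i in l, A i + B i ≤ α + β)
    (hA : α ≤ liminf A l) (hB : β ≤ liminf B l) : Tendsto A l (𝓝 α) := by
  have hq : α + β ≠ ⊤ := ENNReal.add_ne_top.2 ⟨hα, hβ⟩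
  refine tendsto_of_le_liminf_of_limsup_le hA ?_
  calc limsup A l ≤ limsup (fun i => α + β - B i) l := limsup_le_limsup (by
        filter_upwards [h] with i hi
        exact ENNReal.le_sub_of_add_le_right
          (ne_top_of_le_ne_top hq (le_add_self.trans hi)) hi)
    _ = α + β - liminf B l := ENNReal.limsup_const_sub l _ hq
    _ ≤ α + β - β := tsub_le_tsub_left hB _
    _ = α := ENNReal.add_sub_cancel_right hβ

/-- The defect `s a + (1 - s) b - aˢ b¹⁻ˢ` of the weighted arithmetic-geometric inequality. -/
noncomputable def amgmDefect (s a b : ℝ) : ℝ := s * a + (1 - s) * b - a ^ s * b ^ (1 - s)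

theorem amgmDefect_nonneg {s a b : ℝ} (hs : s ∈ Set.Ioo (0 : ℝ) 1) (ha : 0 ≤ a) (hb : 0 ≤ b) :
    0 ≤ amgmDefect s a b :=
  sub_nonneg.2 (Real.geom_mean_le_arith_mean2_weighted hs.1.le (sub_nonneg.2 hs.2.le) ha hb
    (by ring))

theorem amgmDefect_swap (s a b : ℝ) : amgmDefect (1 - s) b a = amgmDefect s a b := by
  simp only [amgmDefect, sub_sub_cancel]
  ring

/-- For `s ≤ 1/2`, `√a √b` is a weighted geometric mean of `aˢ b¹⁻ˢ` and `a`, with weight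
`1/(2(1-s))` on the former. The arithmetic-geometric inequality for this pair bounds the defect by
`(1 - s)(√a - √b)²`. -/
theorem amgmDefect_le_of_le_half {s a b : ℝ} (hs : 0 < s) (hs' : s ≤ 1 / 2) (ha : 0 ≤ a)
    (hb : 0 ≤ b) : amgmDefect s a b ≤ (√a - √b) ^ 2 := by
  have h1 : 0 < 1 - s := by linarith
  have key := Real.geom_mean_le_arith_mean2_weighted (w₁ := 1 / (2 * (1 - s)))
    (w₂ := 1 - 1 / (2 * (1 - s))) (p₁ := a ^ s * b ^ (1 - s)) (p₂ := a) (by positivity)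
    (by
      rw [sub_nonneg, div_le_one (by positivity)]
      linarith) (by positivity) ha (by ring)
  have e : (a ^ s * b ^ (1 - s)) ^ (1 / (2 * (1 - s))) * a ^ (1 - 1 / (2 * (1 - s))) =
      √a * √b := by
    rw [Real.mul_rpow (by positivity) (by positivity), ← Real.rpow_mul ha, ← Real.rpow_mul hb,
      mul_right_comm, ← Real.rpow_add_of_nonneg ha (by positivity) (by
        rw [sub_nonneg, div_le_one (by positivity)]
        linarith), Real.sqrt_eq_rpow, Real.sqrt_eq_rpow]
    congr 2
    · field_simp
      ring
    · field_simp
  rw [e] at key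
  have h2 : 2 * (1 - s) * (√a * √b) ≤ a ^ s * b ^ (1 - s) + (1 - 2 * s) * a := by
    have := mul_le_mul_of_nonneg_left key (by positivity : 0 ≤ 2 * (1 - s))
    refine this.trans_eq ?_
    field_simp
    ring
  have h3 : (√a - √b) ^ 2 = a + b - 2 * (√a * √b) := by
    rw [sub_sq, Real.sq_sqrt ha, Real.sq_sqrt hb]
    ring
  have h4 : 0 ≤ (√a - √b) ^ 2 := sq_nonneg _
  rw [amgmDefect]
  nlinarith

theorem amgmDefect_le {s a b : ℝ} (hs : s ∈ Set.Ioo (0 : ℝ) 1) (ha : 0 ≤ a) (hb : 0 ≤ b) :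
    amgmDefect s a b ≤ (√a - √b) ^ 2 := by
  rcases le_total s (1 / 2) with h | h
  · exact amgmDefect_le_of_le_half hs.1 h ha hb
  · rw [← amgmDefect_swap]
    refine (amgmDefect_le_of_le_half (by linarith [hs.2]) (by linarith) hb ha).trans_eq ?_
    ring

theorem hasDerivAt_amgmDefect {s b x : ℝ} (hx : 0 < x) :
    HasDerivAt (fun x => amgmDefect s x b) (s + -(s * x ^ (s - 1) * b ^ (1 - s))) x := by
  have h := (((hasDerivAt_id x).const_mul s).add_const ((1 - s) * b)).sub
    (((hasDerivAt_id x).rpow_const (p := s) (Or.inl hx.ne')).mul_const (b ^ (1 - s)))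
  refine h.congr_deriv ?_
  simp
  ring

/-- One application of L'Hôpital's rule suffices: the quotient of derivatives is half a difference
quotient of the first derivative, which vanishes at `b`, and so tends to half the second derivative.
-/
theorem tendsto_amgmDefect_div_sq {s b : ℝ} (hb : 0 < b) :
    Tendsto (fun x => amgmDefect s x b / (x - b) ^ 2) (𝓝[≠] b) (𝓝 (s * (1 - s) / 2 / b)) := by
  have hpos : ∀ᶠ x in 𝓝[≠] b, 0 < x := nhdsWithin_le_nhds (eventually_gt_nhds hb)
  have hbb : b ^ s * b ^ (1 - s) = b := by
    rw [← Real.rpow_add hb]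
    simp
  have hbb' : b ^ (s - 1) * b ^ (1 - s) = 1 := by
    rw [← Real.rpow_add hb]
    simp
  have hd : HasDerivAt (fun x => s + -(s * x ^ (s - 1) * b ^ (1 - s))) (s * (1 - s) / b) b := by
    have h := ((((hasDerivAt_id b).rpow_const (p := s - 1) (Or.inl hb.ne')).const_mul
      s).mul_const (b ^ (1 - s))).neg.const_add s
    refine h.congr_deriv ?_
    simp only [id, Real.rpow_sub_one hb.ne' (s - 1)]
    linear_combination (s * (1 - s) / b) * hbb'
  have h0 : amgmDefect s b b = 0 := by
    rw [amgmDefect, hbb]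
    ring
  refine HasDerivAt.lhopital_zero_nhdsNE (f' := fun x => s + -(s * x ^ (s - 1) * b ^ (1 - s)))
    (g' := fun x => 2 * (x - b)) ?_ ?_ ?_ ?_ ?_ ?_
  · filter_upwards [hpos] with x hx using hasDerivAt_amgmDefect hx
  · refine Eventually.of_forall fun x => ?_
    refine (((hasDerivAt_id x).sub_const b).pow 2).congr_deriv ?_
    simp
  · filter_upwards [self_mem_nhdsWithin] with x hx
    exact mul_ne_zero two_ne_zero (sub_ne_zero.2 hx)
  · rw [← h0]
    exact (hasDerivAt_amgmDefect hb).continuousAt.tendsto.mono_left nhdsWithin_le_nhds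
  · refine tendsto_nhdsWithin_of_tendsto_nhds ?_
    exact ((continuous_sub_right b).pow 2).tendsto' _ _ (by simp)
  · have h := (hasDerivAt_iff_tendsto_slope.1 hd).const_mul (1 / 2)
    have e : s * (1 - s) / 2 / b = 1 / 2 * (s * (1 - s) / b) := by ring
    rw [e]
    refine h.congr fun x => ?_
    have h1 : s + -(s * b ^ (s - 1) * b ^ (1 - s)) = 0 := by linear_combination -s * hbb'
    rw [slope_def_field, h1, sub_zero, div_mul_div_comm, one_mul]

theorem tendsto_amgmDefect_comp {s y c : ℝ} {f : ℝ → ℝ} (hy : 0 < f y) (hd : HasDerivAt f c y) :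
    Tendsto (fun ε => amgmDefect s (f (y + ε)) (f y) / ε ^ 2) (𝓝[>] 0)
      (𝓝 (s * (1 - s) / 2 * (c ^ 2 / f y))) := by
  -- The shift may satisfy `f (y + ε) = f y`, where the quotient is `0/0`. Giving it its limit there
  -- makes it continuous, and the squared slope that multiplies it is zero at such `ε`.
  have hρ := continuousAt_update_same.2 (tendsto_amgmDefect_div_sq (s := s) hy)
  have hc : Tendsto (fun ε => f (y + ε)) (𝓝[>] 0) (𝓝 (f y)) := by
    refine tendsto_nhdsWithin_of_tendsto_nhds (hd.continuousAt.tendsto.comp ?_)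
    exact (continuous_const_add y).tendsto' _ _ (add_zero y)
  have hs : Tendsto (fun ε => ε⁻¹ * (f (y + ε) - f y)) (𝓝[>] 0) (𝓝 c) := by
    simpa only [smul_eq_mul] using
      hd.tendsto_slope_zero.mono_left (nhdsGT_le_nhdsNE (0 : ℝ))
  have h := (hρ.tendsto.comp hc).mul (hs.pow 2)
  rw [Function.update_self] at h
  have e : s * (1 - s) / 2 * (c ^ 2 / f y) = s * (1 - s) / 2 / f y * c ^ 2 := by ring
  rw [e]
  refine h.congr fun ε => ?_
  simp only [Function.comp]
  by_cases he : f (y + ε) = f y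
  · rw [he, Function.update_self]
    have : amgmDefect s (f y) (f y) = 0 := by
      rw [amgmDefect, ← Real.rpow_add hy]
      simp
      ring
    rw [this]
    simp
  · rw [Function.update_of_ne he]
    have := sub_ne_zero.2 he
    field_simp

theorem tendsto_sqrt_sub_div_sq {y c : ℝ} {f : ℝ → ℝ} (hy : 0 < f y) (hd : HasDerivAt f c y) :
    Tendsto (fun ε => (√(f (y + ε)) - √(f y)) ^ 2 / ε ^ 2) (𝓝[>] 0) (𝓝 (1 / 4 * (c ^ 2 / f y))) := by
  have h := (hd.sqrt hy.ne').tendsto_slope_zero.mono_left (nhdsGT_le_nhdsNE (0 : ℝ))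
  have h2 := h.pow 2
  have e : 1 / 4 * (c ^ 2 / f y) = (c / (2 * √(f y))) ^ 2 := by
    rw [div_pow, mul_pow, Real.sq_sqrt hy.le]
    ring
  rw [e]
  refine h2.congr fun ε => ?_
  simp only [smul_eq_mul]
  rw [inv_mul_eq_div, div_pow]

theorem measurable_amgmDefect {s : ℝ} {p q : ℝ → ℝ} (hp : Measurable p) (hq : Measurable q) :
    Measurable fun x => amgmDefect s (p x) (q x) := by
  unfold amgmDefect
  fun_prop

namespace IsShiftDensity

variable {f : ℝ → ℝ}

theorem le_liminf_lintegral (hf : IsShiftDensity f) {G : ℝ → ℝ → ℝ} {c : ℝ} (hc : 0 ≤ c)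
    (hG : ∀ ε, Measurable (G ε))
    (h : ∀ y ∈ Function.support f, Tendsto (fun ε => G ε y) (𝓝[>] 0)
      (𝓝 (c * (deriv f y ^ 2 / f y)))) :
    ENNReal.ofReal c * fisherInfo f ≤
      liminf (fun ε => ∫⁻ y, ENNReal.ofReal (G ε y)) (𝓝[>] 0) := by
  refine le_trans ?_ (lintegral_liminf_le fun ε => (hG ε).ennreal_ofReal)
  rw [fisherInfo, ← lintegral_const_mul' _ _ ENNReal.ofReal_ne_top,
    ← lintegral_indicator hf.isOpen_support.measurableSet]
  refine lintegral_mono fun y => Set.indicator_apply_le' (fun hy => ?_) (fun _ => zero_le)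
  rw [← ENNReal.ofReal_mul hc, (ENNReal.tendsto_ofReal (h y hy)).liminf_eq]

/-- On the support `(√f)' = f'/(2√f)`; in the interior of the complement `√f` vanishes locally; the
frontier is countable, hence null. -/
theorem lintegral_deriv_sqrt_sq (hf : IsShiftDensity f) :
    ∫⁻ y, ENNReal.ofReal (deriv (fun x => √(f x)) y ^ 2) =
      ENNReal.ofReal (1 / 4) * fisherInfo f := by
  rw [fisherInfo, ← lintegral_const_mul' _ _ ENNReal.ofReal_ne_top,
    ← lintegral_indicator hf.isOpen_support.measurableSet]
  have hnull : ∀ᵐ y, y ∉ frontier (Function.support f) :=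
    hf.countable_frontier.ae_notMem _
  refine lintegral_congr_ae ?_
  filter_upwards [hnull] with y hy
  by_cases hyS : y ∈ Function.support f
  · rw [Set.indicator_of_mem hyS, ← ENNReal.ofReal_mul (by norm_num),
      ((hf.hasDerivAt hyS).sqrt hyS).deriv, div_pow, mul_pow, Real.sq_sqrt (hf.nonneg y)]
    congr 1
    ring
  · rw [Set.indicator_of_notMem hyS]
    have hint : y ∈ interior (Function.support f)ᶜ := by
      rw [interior_compl]
      intro hcl
      exact hy ⟨hcl, fun h => hyS (interior_subset h)⟩
    have : (fun x => √(f x)) =ᶠ[𝓝 y] fun _ => 0 := by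
      filter_upwards [mem_interior_iff_mem_nhds.1 hint] with x hx
      rw [Function.notMem_support.1 hx, Real.sqrt_zero]
    rw [this.deriv_eq]
    simp

theorem hasDerivAt_sqrt (hf : IsShiftDensity f) {y : ℝ}
    (hy : y ∉ frontier (Function.support f)) :
    HasDerivAt (fun x => √(f x)) (deriv (fun x => √(f x)) y) y := by
  refine DifferentiableAt.hasDerivAt ?_
  by_cases hyS : y ∈ Function.support f
  · exact ((hf.hasDerivAt hyS).sqrt hyS).differentiableAt
  · have hint : y ∈ interior (Function.support f)ᶜ := by
      rw [interior_compl]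
      intro hcl
      exact hy ⟨hcl, fun h => hyS (interior_subset h)⟩
    have : (fun x => √(f x)) =ᶠ[𝓝 y] fun _ => 0 := by
      filter_upwards [mem_interior_iff_mem_nhds.1 hint] with x hx
      rw [Function.notMem_support.1 hx, Real.sqrt_zero]
    exact (differentiableAt_const (0 : ℝ)).congr_of_eventuallyEq this

theorem integrable_deriv_sqrt_sq (hf : IsShiftDensity f) (hJ : fisherInfo f ≠ ⊤) :
    Integrable fun y => deriv (fun x => √(f x)) y ^ 2 := by
  refine ⟨((measurable_deriv _).pow_const 2).aestronglyMeasurable, ?_⟩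
  rw [hasFiniteIntegral_iff_ofReal (ae_of_all _ fun y => sq_nonneg _),
    hf.lintegral_deriv_sqrt_sq]
  exact ENNReal.mul_lt_top ENNReal.ofReal_lt_top hJ.lt_top

/-- Cauchy-Schwarz for the fundamental theorem of calculus, valid off the countable frontier. With
`m` the mean slope, it is the integral of `2 m u' - m² ≤ u'²`. Integrability of `u'` comes from
`|u'| ≤ u'² + 1`. -/
theorem sqrt_sub_sq_le (hf : IsShiftDensity f) (hJ : fisherInfo f ≠ ⊤) {ε : ℝ} (hε : 0 < ε)
    (y : ℝ) : (√(f (y + ε)) - √(f y)) ^ 2 / ε ≤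
      ∫ x in y..y + ε, deriv (fun x => √(f x)) x ^ 2 := by
  set u' := deriv (fun x => √(f x)) with hu'
  have h2 : IntervalIntegrable (fun x => u' x ^ 2) volume y (y + ε) :=
    (hf.integrable_deriv_sqrt_sq hJ).intervalIntegrable
  have h1 : IntervalIntegrable u' volume y (y + ε) := by
    refine (h2.add (intervalIntegrable_const (c := (1 : ℝ)))).mono_fun
      (measurable_deriv _).aestronglyMeasurable (ae_of_all _ fun x => ?_)
    simp only [Real.norm_eq_abs]
    rw [abs_of_nonneg (by positivity : 0 ≤ u' x ^ 2 + 1)]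
    nlinarith [sq_abs (u' x), sq_nonneg (|u' x| - 1)]
  have hftc : ∫ x in y..y + ε, u' x = √(f (y + ε)) - √(f y) :=
    integral_eq_of_hasDerivAt_off_countable _ _ hf.countable_frontier
      (hf.continuous.sqrt.continuousOn) (fun x hx => hf.hasDerivAt_sqrt hx.2) h1
  set m := (√(f (y + ε)) - √(f y)) / ε with hm
  have h3 : ∫ x in y..y + ε, (2 * m * u' x - m ^ 2) ≤ ∫ x in y..y + ε, u' x ^ 2 := by
    refine intervalIntegral.integral_mono_on (by linarith)
      ((h1.const_mul _).sub intervalIntegrable_const) h2 fun x _ => ?_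
    nlinarith [sq_nonneg (u' x - m)]
  rw [intervalIntegral.integral_sub (h1.const_mul _) intervalIntegrable_const,
    intervalIntegral.integral_const_mul, hftc, intervalIntegral.integral_const] at h3
  refine le_trans (le_of_eq ?_) h3
  simp only [hm, smul_eq_mul, add_sub_cancel_left]
  field_simp
  ring

/-- Tonelli after `sqrt_sub_sq_le`: each `x` lies in `(y, y + ε]` for a set of `y` of length `ε`,
which cancels one factor `ε⁻¹`. -/
theorem lintegral_sqrt_sub_sq_le (hf : IsShiftDensity f) (hJ : fisherInfo f ≠ ⊤) {ε : ℝ}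
    (hε : 0 < ε) : ∫⁻ y, ENNReal.ofReal ((√(f (y + ε)) - √(f y)) ^ 2 / ε ^ 2) ≤
      ENNReal.ofReal (1 / 4) * fisherInfo f := by
  rw [← hf.lintegral_deriv_sqrt_sq]
  set u' := deriv (fun x => √(f x)) with hu'
  have hm : Measurable fun x => ENNReal.ofReal (u' x ^ 2) :=
    ((measurable_deriv _).pow_const 2).ennreal_ofReal
  have hint := hf.integrable_deriv_sqrt_sq hJ
  have hpt : ∀ y, ENNReal.ofReal ((√(f (y + ε)) - √(f y)) ^ 2 / ε ^ 2) ≤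
      ENNReal.ofReal ε⁻¹ * ∫⁻ x, ({p : ℝ × ℝ | p.1 < p.2 ∧ p.2 ≤ p.1 + ε}).indicator
        (fun p => ENNReal.ofReal (u' p.2 ^ 2)) (y, x) := by
    intro y
    have e : ∫⁻ x, ({p : ℝ × ℝ | p.1 < p.2 ∧ p.2 ≤ p.1 + ε}).indicator
        (fun p => ENNReal.ofReal (u' p.2 ^ 2)) (y, x) =
        ∫⁻ x in Set.Ioc y (y + ε), ENNReal.ofReal (u' x ^ 2) := by
      rw [← lintegral_indicator measurableSet_Ioc]
      rfl
    rw [e, ← ofReal_integral_eq_lintegral_ofReal hint.integrableOn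
      (ae_of_all _ fun x => sq_nonneg _), ← ENNReal.ofReal_mul (by positivity)]
    refine ENNReal.ofReal_le_ofReal ?_
    have := hf.sqrt_sub_sq_le hJ hε y
    rw [intervalIntegral.integral_of_le (by linarith)] at this
    calc (√(f (y + ε)) - √(f y)) ^ 2 / ε ^ 2
        = ε⁻¹ * ((√(f (y + ε)) - √(f y)) ^ 2 / ε) := by field_simp
      _ ≤ _ := mul_le_mul_of_nonneg_left this (by positivity)
  have hset : MeasurableSet {p : ℝ × ℝ | p.1 < p.2 ∧ p.2 ≤ p.1 + ε} :=
    (measurableSet_lt measurable_fst measurable_snd).inter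
      (measurableSet_le measurable_snd (measurable_fst.add_const ε))
  calc ∫⁻ y, ENNReal.ofReal ((√(f (y + ε)) - √(f y)) ^ 2 / ε ^ 2)
      ≤ ∫⁻ y, ENNReal.ofReal ε⁻¹ * ∫⁻ x, ({p : ℝ × ℝ | p.1 < p.2 ∧ p.2 ≤ p.1 + ε}).indicator
        (fun p => ENNReal.ofReal (u' p.2 ^ 2)) (y, x) := lintegral_mono hpt
    _ = ENNReal.ofReal ε⁻¹ * ∫⁻ y, ∫⁻ x, ({p : ℝ × ℝ | p.1 < p.2 ∧ p.2 ≤ p.1 + ε}).indicator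
        (fun p => ENNReal.ofReal (u' p.2 ^ 2)) (y, x) :=
        lintegral_const_mul' _ _ ENNReal.ofReal_ne_top
    _ = ENNReal.ofReal ε⁻¹ * ∫⁻ x, ∫⁻ y, ({p : ℝ × ℝ | p.1 < p.2 ∧ p.2 ≤ p.1 + ε}).indicator
        (fun p => ENNReal.ofReal (u' p.2 ^ 2)) (y, x) := by
        rw [lintegral_lintegral_swap]
        exact ((hm.comp measurable_snd).indicator hset).aemeasurable
    _ = ENNReal.ofReal ε⁻¹ * ∫⁻ x, ENNReal.ofReal ε * ENNReal.ofReal (u' x ^ 2) := by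
        congr 1
        refine lintegral_congr fun x => ?_
        have e : ∀ y, ({p : ℝ × ℝ | p.1 < p.2 ∧ p.2 ≤ p.1 + ε}).indicator
            (fun p => ENNReal.ofReal (u' p.2 ^ 2)) (y, x) =
            (Set.Ico (x - ε) x).indicator (fun _ => ENNReal.ofReal (u' x ^ 2)) y := by
          intro y
          refine Set.indicator_eq_indicator (b := y) ?_ rfl
          simp only [Set.mem_ofPred_eq, Set.mem_Ico, sub_le_iff_le_add]
          exact and_comm
        simp_rw [e]
        rw [lintegral_indicator_const measurableSet_Ico, Real.volume_Ico, sub_sub_cancel,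
          mul_comm]
    _ = ∫⁻ x, ENNReal.ofReal (u' x ^ 2) := by
        rw [lintegral_const_mul' _ _ ENNReal.ofReal_ne_top, ← mul_assoc,
          ← ENNReal.ofReal_mul (by positivity), inv_mul_cancel₀ hε.ne', ENNReal.ofReal_one,
          one_mul]

/-- When `J = ∞`, Fatou for the defect is enough. Otherwise Fatou is applied both to the defect and
to its gap from `(√a - √b)²`; the two limiting constants add up to `1/4`, the constant in the upper
bound for the sum. -/
theorem tendsto_lintegral_amgmDefect (hf : IsShiftDensity f) {s : ℝ}
    (hs : s ∈ Set.Ioo (0 : ℝ) 1) :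
    Tendsto (fun ε => ∫⁻ y, ENNReal.ofReal (amgmDefect s (f (y + ε)) (f y) / ε ^ 2)) (𝓝[>] 0)
      (𝓝 (ENNReal.ofReal (s * (1 - s) / 2) * fisherInfo f)) := by
  have hs1 := hs.1
  have hs2 := hs.2
  have hs0 : 0 < s * (1 - s) / 2 := by nlinarith
  have hs4 : 0 ≤ 1 / 4 - s * (1 - s) / 2 := by nlinarith [sq_nonneg (s - 1 / 2)]
  have hfm : Measurable f := hf.continuous.measurable
  have hA := hf.le_liminf_lintegral hs0.le
    (G := fun ε y => amgmDefect s (f (y + ε)) (f y) / ε ^ 2)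
    (fun ε => (measurable_amgmDefect (hfm.comp (measurable_add_const ε)) hfm).div_const _)
    (fun y hy => tendsto_amgmDefect_comp (hf.pos hy) (hf.hasDerivAt hy))
  by_cases hJ : fisherInfo f = ⊤
  · rw [hJ, ENNReal.mul_top (by simpa using hs0)] at hA ⊢
    exact tendsto_of_le_liminf_of_limsup_le hA le_top
  have hB := hf.le_liminf_lintegral hs4
    (G := fun ε y => (√(f (y + ε)) - √(f y)) ^ 2 / ε ^ 2 -
      amgmDefect s (f (y + ε)) (f y) / ε ^ 2)
    (fun ε => Measurable.sub (by fun_prop)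
      ((measurable_amgmDefect (hfm.comp (measurable_add_const ε)) hfm).div_const _))
    (fun y hy => by
      rw [sub_mul]
      exact (tendsto_sqrt_sub_div_sq (hf.pos hy) (hf.hasDerivAt hy)).sub
        (tendsto_amgmDefect_comp (hf.pos hy) (hf.hasDerivAt hy)))
  refine ENNReal.tendsto_of_add_le_of_le_liminf (ENNReal.mul_ne_top ENNReal.ofReal_ne_top hJ)
    (ENNReal.mul_ne_top ENNReal.ofReal_ne_top hJ) ?_ hA hB
  filter_upwards [self_mem_nhdsWithin] with ε hε
  rw [← add_mul, ← ENNReal.ofReal_add hs0.le hs4, add_sub_cancel]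
  refine le_trans (le_of_eq ?_) (hf.lintegral_sqrt_sub_sq_le hJ hε)
  rw [← lintegral_add_left]
  · refine lintegral_congr fun y => ?_
    rw [← ENNReal.ofReal_add, add_sub_cancel]
    · exact div_nonneg (amgmDefect_nonneg hs (hf.nonneg _) (hf.nonneg _)) (sq_nonneg _)
    · rw [← sub_div]
      exact div_nonneg (sub_nonneg.2 (amgmDefect_le hs (hf.nonneg _) (hf.nonneg _)))
        (sq_nonneg _)
  · exact ((measurable_amgmDefect (hfm.comp (measurable_add_const ε)) hfm).div_const
      _).ennreal_ofReal

end IsShiftDensity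

/-! ### Affinities, the Rényi limit and the two barred bounds -/

/-- The Hellinger affinity `∫ f(y + ε)ˢ f(y)¹⁻ˢ dy` of order `s` of two translates of `f`. -/
noncomputable def shiftAffinity (f : ℝ → ℝ) (s ε : ℝ) : ℝ := ∫ y, f (y + ε) ^ s * f y ^ (1 - s)

namespace IsShiftDensity

variable {f : ℝ → ℝ} {s : ℝ}

theorem measurable_shiftAffinity (hf : IsShiftDensity f) (s ε : ℝ) :
    Measurable fun y => f (y + ε) ^ s * f y ^ (1 - s) := by
  have := hf.continuous.measurable
  fun_prop

theorem integrable_shiftAffinity (hf : IsShiftDensity f) (hs : s ∈ Set.Ioo (0 : ℝ) 1) (ε : ℝ) :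
    Integrable fun y => f (y + ε) ^ s * f y ^ (1 - s) := by
  refine (((hf.integrable.comp_add_right ε).const_mul s).add
    (hf.integrable.const_mul (1 - s))).mono'
    (hf.measurable_shiftAffinity s ε).aestronglyMeasurable (ae_of_all _ fun y => ?_)
  rw [Real.norm_of_nonneg (mul_nonneg (Real.rpow_nonneg (hf.nonneg _) _)
    (Real.rpow_nonneg (hf.nonneg _) _))]
  exact sub_nonneg.1 (amgmDefect_nonneg hs (hf.nonneg _) (hf.nonneg _))

theorem integrable_amgmDefect (hf : IsShiftDensity f) (hs : s ∈ Set.Ioo (0 : ℝ) 1) (ε : ℝ) :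
    Integrable fun y => amgmDefect s (f (y + ε)) (f y) :=
  (((hf.integrable.comp_add_right ε).const_mul s).add (hf.integrable.const_mul (1 - s))).sub
    (hf.integrable_shiftAffinity hs ε)

theorem integral_amgmDefect (hf : IsShiftDensity f) (hs : s ∈ Set.Ioo (0 : ℝ) 1) (ε : ℝ) :
    ∫ y, amgmDefect s (f (y + ε)) (f y) = 1 - shiftAffinity f s ε := by
  have h1 := (hf.integrable.comp_add_right ε).const_mul s
  have h2 := hf.integrable.const_mul (1 - s)
  calc ∫ y, amgmDefect s (f (y + ε)) (f y)
      = (∫ y, s * f (y + ε)) + (∫ y, (1 - s) * f y) - shiftAffinity f s ε := by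
        rw [← integral_add h1 h2, shiftAffinity]
        exact integral_sub (h1.add h2) (hf.integrable_shiftAffinity hs ε)
    _ = 1 - shiftAffinity f s ε := by
        rw [integral_const_mul, integral_const_mul, integral_add_right_eq_self f ε,
          hf.integral_eq_one]
        ring

theorem shiftAffinity_le_one (hf : IsShiftDensity f) (hs : s ∈ Set.Ioo (0 : ℝ) 1) (ε : ℝ) :
    shiftAffinity f s ε ≤ 1 := by
  rw [← sub_nonneg, ← hf.integral_amgmDefect hs]
  exact integral_nonneg fun y => amgmDefect_nonneg hs (hf.nonneg _) (hf.nonneg _)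

theorem tendsto_ofReal_one_sub_shiftAffinity (hf : IsShiftDensity f)
    (hs : s ∈ Set.Ioo (0 : ℝ) 1) :
    Tendsto (fun ε => ENNReal.ofReal ((1 - shiftAffinity f s ε) / ε ^ 2)) (𝓝[>] 0)
      (𝓝 (ENNReal.ofReal (s * (1 - s) / 2) * fisherInfo f)) := by
  refine (hf.tendsto_lintegral_amgmDefect hs).congr fun ε => ?_
  rw [← hf.integral_amgmDefect hs, ← integral_div, ofReal_integral_eq_lintegral_ofReal
    ((hf.integrable_amgmDefect hs ε).div_const _)]
  exact ae_of_all _ fun y =>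
    div_nonneg (amgmDefect_nonneg hs (hf.nonneg _) (hf.nonneg _)) (sq_nonneg _)

theorem tendsto_one_sub_shiftAffinity (hf : IsShiftDensity f) (hJ : fisherInfo f ≠ ⊤)
    (hs : s ∈ Set.Ioo (0 : ℝ) 1) :
    Tendsto (fun ε => (1 - shiftAffinity f s ε) / ε ^ 2) (𝓝[>] 0)
      (𝓝 (s * (1 - s) / 2 * (fisherInfo f).toReal)) := by
  have hs0 : 0 ≤ s * (1 - s) / 2 := by nlinarith [hs.1, hs.2]
  have h := (ENNReal.tendsto_toReal (ENNReal.mul_ne_top ENNReal.ofReal_ne_top hJ)).comp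
    (hf.tendsto_ofReal_one_sub_shiftAffinity hs)
  rw [ENNReal.toReal_mul, ENNReal.toReal_ofReal hs0] at h
  refine h.congr fun ε => ?_
  simp only [Function.comp]
  rw [ENNReal.toReal_ofReal]
  exact div_nonneg (sub_nonneg.2 (hf.shiftAffinity_le_one hs ε)) (sq_nonneg _)

theorem tendsto_shiftAffinity (hf : IsShiftDensity f) (hJ : fisherInfo f ≠ ⊤)
    (hs : s ∈ Set.Ioo (0 : ℝ) 1) :
    Tendsto (shiftAffinity f s) (𝓝[>] 0) (𝓝 1) := by
  have h2 : Tendsto (fun ε : ℝ => ε ^ 2) (𝓝[>] 0) (𝓝 0) :=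
    tendsto_nhdsWithin_of_tendsto_nhds ((continuous_pow 2).tendsto' _ _ (by simp))
  have h := ((hf.tendsto_one_sub_shiftAffinity hJ hs).mul h2).const_sub 1
  rw [mul_zero, sub_zero] at h
  refine h.congr' ?_
  filter_upwards [self_mem_nhdsWithin] with ε hε
  have : ε ≠ 0 := ne_of_gt hε
  field_simp
  ring

theorem relRenyi_shiftFamily (hf : IsShiftDensity f) (hs : s ∈ Set.Ioo (0 : ℝ) 1) (θ ε : ℝ) :
    relRenyi volume s (shiftFamily f (θ - ε / 2)) (shiftFamily f (θ + ε / 2)) =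
      -ENNReal.log (ENNReal.ofReal (shiftAffinity f s ε)) := by
  rw [relRenyi, shiftAffinity, ofReal_integral_eq_lintegral_ofReal
    (hf.integrable_shiftAffinity hs ε) (ae_of_all _ fun y =>
      mul_nonneg (Real.rpow_nonneg (hf.nonneg _) _) (Real.rpow_nonneg (hf.nonneg _) _)),
    ← lintegral_sub_right_eq_self
      (fun y => ENNReal.ofReal (f (y + ε) ^ s * f y ^ (1 - s))) (θ + ε / 2)]
  congr 3
  ext x
  simp only [shiftFamily]
  congr 4
  ring

/-- For an affinity `z > 0`, `-log z` lies between `1 - z` and `(1 - z)/z`, and `z → 1` when `J` is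
finite. When `J = ∞` the lower inequality alone drives the quotient to infinity, also where `z = 0`.
-/
theorem tendsto_renyiQuot (hf : IsShiftDensity f) {g : ℝ → ℝ} (hg : ∀ x, g x = x ^ 2)
    (hs : s ∈ Set.Ioo (0 : ℝ) 1) (θ : ℝ) :
    Tendsto (renyiQuot volume (shiftFamily f) g θ s) (𝓝[>] 0)
      (𝓝 (((s * (1 - s) / 2 : ℝ) : EReal) * ((fisherInfo f : ℝ≥0∞) : EReal))) := by
  have hs0 : 0 < s * (1 - s) / 2 := by nlinarith [hs.1, hs.2]
  have hq : ∀ ε, renyiQuot volume (shiftFamily f) g θ s ε =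
      -ENNReal.log (ENNReal.ofReal (shiftAffinity f s ε)) / ((ε ^ 2 : ℝ) : EReal) := by
    intro ε
    rw [renyiQuot, hf.relRenyi_shiftFamily hs, hg]
  by_cases hJ : fisherInfo f = ⊤
  · have h := hf.tendsto_ofReal_one_sub_shiftAffinity hs
    rw [hJ, ENNReal.mul_top (by simpa using hs0)] at h
    rw [hJ, EReal.coe_ennreal_top, EReal.coe_mul_top_of_pos hs0]
    have h' := (continuous_coe_ennreal_ereal.tendsto ⊤).comp h
    rw [EReal.coe_ennreal_top] at h'
    refine tendsto_nhds_top_mono h' (Eventually.of_forall fun ε => ?_)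
    have hnn : 0 ≤ (1 - shiftAffinity f s ε) / ε ^ 2 :=
      div_nonneg (sub_nonneg.2 (hf.shiftAffinity_le_one hs ε)) (sq_nonneg _)
    simp only [Function.comp]
    rw [hq, EReal.coe_ennreal_ofReal, max_eq_left hnn, EReal.coe_div]
    refine EReal.div_le_div_right_of_nonneg (by exact_mod_cast sq_nonneg ε) ?_
    rw [ENNReal.log_ofReal]
    split_ifs with hz
    · simp
    · rw [← EReal.coe_neg, EReal.coe_le_coe_iff]
      linarith [Real.log_le_sub_one_of_pos (not_le.1 hz)]
  · have hl : ((s * (1 - s) / 2 : ℝ) : EReal) * ((fisherInfo f : ℝ≥0∞) : EReal) =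
        ((s * (1 - s) / 2 * (fisherInfo f).toReal : ℝ) : EReal) := by
      rw [EReal.coe_mul, EReal.coe_ennreal_toReal hJ]
    rw [hl]
    have hz := hf.tendsto_shiftAffinity hJ hs
    have hw := hf.tendsto_one_sub_shiftAffinity hJ hs
    have hpos : ∀ᶠ ε in 𝓝[>] 0, 0 < shiftAffinity f s ε :=
      hz.eventually (eventually_gt_nhds one_pos)
    have hreal : Tendsto (fun ε => -Real.log (shiftAffinity f s ε) / ε ^ 2) (𝓝[>] 0)
        (𝓝 (s * (1 - s) / 2 * (fisherInfo f).toReal)) := by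
      have hu := hw.div hz one_ne_zero
      rw [div_one] at hu
      refine tendsto_of_tendsto_of_tendsto_of_le_of_le' hw hu ?_ ?_
      · filter_upwards [hpos] with ε hε
        refine div_le_div_of_nonneg_right ?_ (sq_nonneg _)
        linarith [Real.log_le_sub_one_of_pos hε]
      · filter_upwards [hpos] with ε hε
        rw [Pi.div_apply, div_right_comm]
        refine div_le_div_of_nonneg_right ?_ (sq_nonneg _)
        have := Real.one_sub_inv_le_log_of_pos hε
        rw [sub_div, div_self hε.ne', one_div]
        linarith
    refine (EReal.tendsto_coe.2 hreal).congr' ?_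
    filter_upwards [hpos] with ε hε
    rw [hq, ENNReal.log_ofReal, if_neg (not_le.2 hε), EReal.coe_div, EReal.coe_neg]

theorem renyiLim_eq (hf : IsShiftDensity f) {g : ℝ → ℝ} (hg : ∀ x, g x = x ^ 2)
    (hs : s ∈ Set.Ioo (0 : ℝ) 1) (θ : ℝ) :
    renyiLim volume (shiftFamily f) g θ s =
      ((ENNReal.ofReal (s * (1 - s) / 2) * fisherInfo f : ℝ≥0∞) : EReal) := by
  have hs0 : 0 ≤ s * (1 - s) / 2 := by nlinarith [hs.1, hs.2]
  rw [renyiLim, (hf.tendsto_renyiQuot hg hs θ).limUnder_eq, EReal.coe_ennreal_mul,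
    EReal.coe_ennreal_ofReal, max_eq_left hs0]

theorem alphaOneBar_eq (hf : IsShiftDensity f) {g : ℝ → ℝ} (hg : ∀ x, g x = x ^ 2) (θ : ℝ) :
    alphaOneBar volume (shiftFamily f) g 2 θ = ((fisherInfo f / 2 : ℝ≥0∞) : EReal) := by
  have hsup : ⨆ s ∈ Set.Ioo (0 : ℝ) 1, renyiLim volume (shiftFamily f) g θ s =
      ((ENNReal.ofReal (1 / 8) * fisherInfo f : ℝ≥0∞) : EReal) := by
    refine le_antisymm (iSup₂_le fun s hs => ?_) ?_
    · rw [hf.renyiLim_eq hg hs, EReal.coe_ennreal_le_coe_ennreal_iff]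
      refine mul_le_mul_left (ENNReal.ofReal_le_ofReal ?_) _
      nlinarith [sq_nonneg (s - 1 / 2)]
    · have hh : (1 / 2 : ℝ) ∈ Set.Ioo (0 : ℝ) 1 := by norm_num
      refine le_trans (le_of_eq ?_)
        (le_iSup₂ (f := fun s _ => renyiLim volume (shiftFamily f) g θ s) (1 / 2) hh)
      rw [hf.renyiLim_eq hg hh]
      norm_num
  rw [alphaOneBar, hsup]
  have h4 : (((2 : ℝ) ^ (2 : ℝ) : ℝ) : EReal) = ((ENNReal.ofReal 4 : ℝ≥0∞) : EReal) := by
    rw [EReal.coe_ennreal_ofReal]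
    norm_num
  rw [h4, ← EReal.coe_ennreal_mul, ← mul_assoc, ← ENNReal.ofReal_mul (by norm_num),
    ENNReal.div_eq_inv_mul]
  congr 2
  rw [show (4 : ℝ) * (1 / 8) = 2⁻¹ by norm_num, ENNReal.ofReal_inv_of_pos two_pos]
  norm_num

/-- At `κ = 2` the numerator of the weight is `s + (1 - s) = 1`, so the product does not depend on
`s` and the infimum is over a constant. -/
theorem alphaTwoBar_eq (hf : IsShiftDensity f) {g : ℝ → ℝ} (hg : ∀ x, g x = x ^ 2) (θ : ℝ) :
    alphaTwoBar volume (shiftFamily f) g 2 θ = ((fisherInfo f / 2 : ℝ≥0∞) : EReal) := by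
  rw [alphaTwoBar, if_neg (by norm_num), if_neg (by norm_num)]
  have h : ∀ s ∈ Set.Ioo (0 : ℝ) 1, ((barWeight 2 s : ℝ) : EReal) *
      renyiLim volume (shiftFamily f) g θ s = ((fisherInfo f / 2 : ℝ≥0∞) : EReal) := by
    intro s hs
    have hs0 : 0 < s * (1 - s) := by nlinarith [hs.1, hs.2]
    have hw : barWeight 2 s = 1 / (s * (1 - s)) := by
      rw [barWeight]
      norm_num
    have hc : ((1 / (s * (1 - s)) : ℝ) : EReal) =
        ((ENNReal.ofReal (1 / (s * (1 - s))) : ℝ≥0∞) : EReal) := by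
      rw [EReal.coe_ennreal_ofReal, max_eq_left (by positivity)]
    rw [hf.renyiLim_eq hg hs, hw, hc, ← EReal.coe_ennreal_mul, ← mul_assoc,
      ← ENNReal.ofReal_mul (by positivity), ENNReal.div_eq_inv_mul]
    congr 2
    rw [show 1 / (s * (1 - s)) * (s * (1 - s) / 2) = 2⁻¹ by
        have := hs0.ne'
        rw [one_div, ← mul_div_assoc, inv_mul_cancel₀ this, one_div], ENNReal.ofReal_inv_of_pos two_pos]
    norm_num
  refine le_antisymm ?_ (le_iInf₂ fun s hs => (h s hs).ge)
  have hh : (1 / 2 : ℝ) ∈ Set.Ioo (0 : ℝ) 1 := by norm_num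
  exact (iInf₂_le _ hh).trans (h _ hh).le

end IsShiftDensity

theorem isIndex_sq_iff {g : ℝ → ℝ} (hg : ∀ x, g x = x ^ 2) (κ : ℝ) : IsIndex g κ ↔ κ = 2 := by
  have hlim : ∀ x : ℝ, Tendsto (fun ε : ℝ => g (x * ε) / g ε) (𝓝[>] 0) (𝓝 (x ^ 2)) := by
    intro x
    refine tendsto_const_nhds.congr' ?_
    filter_upwards [self_mem_nhdsWithin] with ε hε
    have : ε ≠ 0 := ne_of_gt hε
    rw [hg, hg, mul_pow, mul_div_cancel_right₀ _ (pow_ne_zero 2 this)]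
  constructor
  · intro h
    have h2 := tendsto_nhds_unique (h 2 two_pos) (hlim 2)
    rw [← Real.rpow_natCast] at h2
    exact_mod_cast (Real.rpow_right_inj two_pos (by norm_num)).1 h2
  · rintro rfl x _
    exact_mod_cast hlim x

/-! ### Chernoff's bound and exponential rates -/

theorem lintegral_pi_prod {Ω : Type*} [MeasurableSpace Ω] (P : Measure Ω)
    [IsProbabilityMeasure P] (n : ℕ) {φ : Fin n → Ω → ℝ≥0∞} (hφ : ∀ i, Measurable (φ i)) :
    ∫⁻ x, ∏ i, φ i (x i) ∂(Measure.pi fun _ : Fin n => P) = ∏ i, ∫⁻ ω, φ i ω ∂P := by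
  have hind := ProbabilityTheory.iIndepFun_pi (μ := fun _ : Fin n => P) (X := φ)
    fun i => (hφ i).aemeasurable
  rw [ProbabilityTheory.lintegral_prod_eq_prod_lintegral_of_indepFun Finset.univ _ hind
    fun i => (hφ i).comp (measurable_pi_apply i)]
  refine Finset.prod_congr rfl fun i _ => ?_
  exact (measurePreserving_eval (fun _ : Fin n => P) i).lintegral_comp (hφ i)

/-- Chernoff's bound. -/
theorem pi_one_le_prod_le {Ω : Type*} [MeasurableSpace Ω] (P : Measure Ω)
    [IsProbabilityMeasure P] (n : ℕ) {φ : Ω → ℝ≥0∞} (hφ : Measurable φ) :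
    (Measure.pi fun _ : Fin n => P) {x | 1 ≤ ∏ i, φ (x i)} ≤ (∫⁻ ω, φ ω ∂P) ^ n := by
  have h := mul_meas_ge_le_lintegral₀ (μ := Measure.pi fun _ : Fin n => P)
    (f := fun x => ∏ i, φ (x i)) (Finset.univ.measurable_prod fun i _ =>
      hφ.comp (measurable_pi_apply i)).aemeasurable 1
  rw [one_mul, lintegral_pi_prod P n fun _ => hφ] at h
  simpa using h

/-- A two-sided error event splits into two one-sided ones. Inclusion is asked only almost
everywhere because, for maximum likelihood, it needs all observations in the support. -/
theorem pi_le_two_mul_of_chernoff {Ω : Type*} [MeasurableSpace Ω] (P : Measure Ω)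
    [IsProbabilityMeasure P] (n : ℕ) {φ₁ φ₂ : Ω → ℝ≥0∞} (hφ₁ : Measurable φ₁)
    (hφ₂ : Measurable φ₂) {c : ℝ} (h₁ : ∫⁻ ω, φ₁ ω ∂P ≤ ENNReal.ofReal (Real.exp (-c)))
    (h₂ : ∫⁻ ω, φ₂ ω ∂P ≤ ENNReal.ofReal (Real.exp (-c))) {E : Set (Fin n → Ω)}
    (hE : ∀ᵐ x ∂(Measure.pi fun _ : Fin n => P),
      x ∈ E → 1 ≤ ∏ i, φ₁ (x i) ∨ 1 ≤ ∏ i, φ₂ (x i)) :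
    (Measure.pi fun _ : Fin n => P) E ≤ 2 * ENNReal.ofReal (Real.exp (-(n * c))) := by
  have hpow : ENNReal.ofReal (Real.exp (-c)) ^ n = ENNReal.ofReal (Real.exp (-(n * c))) := by
    rw [← ENNReal.ofReal_pow (Real.exp_nonneg _), ← Real.exp_nat_mul, mul_neg]
  calc (Measure.pi fun _ : Fin n => P) E
      ≤ (Measure.pi fun _ : Fin n => P) ({x | 1 ≤ ∏ i, φ₁ (x i)} ∪ {x | 1 ≤ ∏ i, φ₂ (x i)}) :=
        measure_mono_ae hE
    _ ≤ _ := measure_union_le _ _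
    _ ≤ (∫⁻ ω, φ₁ ω ∂P) ^ n + (∫⁻ ω, φ₂ ω ∂P) ^ n :=
        add_le_add (pi_one_le_prod_le P n hφ₁) (pi_one_le_prod_le P n hφ₂)
    _ ≤ ENNReal.ofReal (Real.exp (-c)) ^ n + ENNReal.ofReal (Real.exp (-c)) ^ n :=
        add_le_add (pow_le_pow_left' h₁ n) (pow_le_pow_left' h₂ n)
    _ = _ := by rw [hpow, two_mul]

section Rates

variable {Ω : Type*} [MeasurableSpace Ω] {μ : Measure Ω} {p : ℝ → Ω → ℝ}

/-- The factor `2` costs `log 2 / n`, which disappears in the limit. -/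
theorem le_expRate {T : Estimator Ω} {θ ε c : ℝ}
    (h : ∀ n : ℕ, iidLaw μ p θ n {x | ε ≤ |T.toFun n x - θ|} ≤
      2 * ENNReal.ofReal (Real.exp (-(n * c)))) :
    (c : EReal) ≤ expRate μ p T θ ε := by
  have hlim : Tendsto (fun n : ℕ => ((c - Real.log 2 / n : ℝ) : EReal)) atTop (𝓝 (c : EReal)) := by
    have := (tendsto_const_div_atTop_nhds_zero_nat (Real.log 2)).const_sub c
    rw [sub_zero] at this
    exact EReal.tendsto_coe.2 this
  rw [← hlim.liminf_eq]
  refine liminf_le_liminf ?_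
  filter_upwards [eventually_gt_atTop 0] with n hn
  have hn' : (0 : ℝ) < n := by exact_mod_cast hn
  have hlog : ENNReal.log (2 * ENNReal.ofReal (Real.exp (-(n * c)))) =
      ((Real.log 2 - n * c : ℝ) : EReal) := by
    have h2 : (2 : ℝ≥0∞) = ENNReal.ofReal 2 := by simp
    rw [h2, ← ENNReal.ofReal_mul two_pos.le, ENNReal.log_ofReal_of_pos (by positivity),
      Real.log_mul two_ne_zero (Real.exp_pos _).ne', Real.log_exp]
    rfl
  have e : ((c - Real.log 2 / n : ℝ) : EReal) =
      -ENNReal.log (2 * ENNReal.ofReal (Real.exp (-(n * c)))) / ((n : ℝ) : EReal) := by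
    rw [hlog, ← EReal.coe_neg, ← EReal.coe_div]
    congr 1
    field_simp
    ring
  rw [e]
  refine EReal.div_le_div_right_of_nonneg (by exact_mod_cast hn'.le) ?_
  exact EReal.neg_le_neg_iff.2 (ENNReal.log_monotone (h n))

theorem le_alphaTwoOf {T : Estimator Ω} {θ c : ℝ} {g : ℝ → ℝ} (hg : ∀ x, g x = x ^ 2)
    (h : ∀ᶠ ε in 𝓝[>] (0 : ℝ), ∀ θ' ∈ Set.Icc (θ - ε) (θ + ε), ∀ n : ℕ,
      iidLaw μ p θ' n {x | ε ≤ |T.toFun n x - θ'|} ≤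
        2 * ENNReal.ofReal (Real.exp (-(n * (c * ε ^ 2))))) :
    (c : EReal) ≤ alphaTwoOf μ p g T θ := by
  refine le_liminf_of_le (by isBoundedDefault) ?_
  filter_upwards [h, self_mem_nhdsWithin] with ε hε hpos
  have hpos' : 0 < ε ^ 2 := pow_pos hpos 2
  rw [hg, EReal.le_div_iff_mul_le (by exact_mod_cast hpos') (EReal.coe_ne_top _), ← EReal.coe_mul]
  exact le_iInf₂ fun θ' hθ' => le_expRate (hε θ' hθ')

theorem expRate_nonneg [∀ θ n, IsProbabilityMeasure (iidLaw μ p θ n)] (T : Estimator Ω)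
    (θ ε : ℝ) : 0 ≤ expRate μ p T θ ε := by
  refine le_liminf_of_le (by isBoundedDefault) (Eventually.of_forall fun n => ?_)
  refine EReal.div_nonneg ?_ (by exact_mod_cast n.cast_nonneg)
  rw [EReal.le_neg, neg_zero, ← ENNReal.log_one]
  exact ENNReal.log_monotone prob_le_one

theorem alphaTwoOf_nonneg [∀ θ n, IsProbabilityMeasure (iidLaw μ p θ n)] (T : Estimator Ω)
    {g : ℝ → ℝ} (hg : ∀ x, g x = x ^ 2) (θ : ℝ) : 0 ≤ alphaTwoOf μ p g T θ := by
  refine le_liminf_of_le (by isBoundedDefault) (Eventually.of_forall fun ε => ?_)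
  refine EReal.div_nonneg (le_iInf₂ fun θ' _ => expRate_nonneg T θ' ε) ?_
  rw [hg]
  exact_mod_cast sq_nonneg ε

theorem alphaTwo_le_alphaOne {g : ℝ → ℝ} (hg : ∀ x, g x = x ^ 2) (θ : ℝ) :
    alphaTwo μ p g θ ≤ alphaOne μ p g θ := by
  refine iSup_le fun T => ?_
  refine (liminf_le_limsup).trans (limsup_le_limsup (Eventually.of_forall fun ε => ?_))
  refine EReal.div_le_div_right_of_nonneg ?_ (le_iSup (fun T => localRate μ p T θ ε) T)
  rw [hg]
  exact_mod_cast sq_nonneg ε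

end Rates

/-! ### Shifted laws and first order expansions of expectations -/

/-- The law with density `f(· - θ)`. -/
noncomputable def shiftLaw (f : ℝ → ℝ) (θ : ℝ) : Measure ℝ :=
  volume.withDensity fun x => ENNReal.ofReal (shiftFamily f θ x)

theorem iidLaw_shiftFamily (f : ℝ → ℝ) (θ : ℝ) (n : ℕ) :
    iidLaw volume (shiftFamily f) θ n = Measure.pi fun _ : Fin n => shiftLaw f θ := rfl

namespace IsShiftDensity

variable {f : ℝ → ℝ}

theorem measurable_shiftFamily (hf : IsShiftDensity f) (θ : ℝ) :
    Measurable (shiftFamily f θ) :=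
  hf.continuous.measurable.comp (measurable_id.sub_const θ)

theorem lintegral_shiftLaw (hf : IsShiftDensity f) (θ : ℝ) {φ : ℝ → ℝ≥0∞} (hφ : Measurable φ) :
    ∫⁻ x, φ x ∂shiftLaw f θ = ∫⁻ y, ENNReal.ofReal (f y) * φ (y + θ) := by
  rw [shiftLaw, lintegral_withDensity_eq_lintegral_mul _
    (hf.measurable_shiftFamily θ).ennreal_ofReal hφ, ← lintegral_add_right_eq_self _ θ]
  simp [shiftFamily]

theorem isProbabilityMeasure_shiftLaw (hf : IsShiftDensity f) (θ : ℝ) :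
    IsProbabilityMeasure (shiftLaw f θ) := by
  refine ⟨?_⟩
  rw [← lintegral_one, hf.lintegral_shiftLaw θ measurable_const]
  simpa using hf.lintegral_eq_one

theorem isProbabilityMeasure_iidLaw (hf : IsShiftDensity f) (θ : ℝ) (n : ℕ) :
    IsProbabilityMeasure (iidLaw volume (shiftFamily f) θ n) := by
  have := hf.isProbabilityMeasure_shiftLaw θ
  rw [iidLaw_shiftFamily]
  infer_instance

theorem ae_mem_support (hf : IsShiftDensity f) (θ : ℝ) (n : ℕ) :
    ∀ᵐ x ∂(Measure.pi fun _ : Fin n => shiftLaw f θ), ∀ i, x i - θ ∈ Function.support f := by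
  have := hf.isProbabilityMeasure_shiftLaw θ
  refine ae_all_iff.2 fun i => ?_
  have h : ∀ᵐ x ∂shiftLaw f θ, x - θ ∈ Function.support f := by
    rw [shiftLaw, ae_withDensity_iff (hf.measurable_shiftFamily θ).ennreal_ofReal]
    refine ae_of_all _ fun x hx h0 => hx ?_
    rw [shiftFamily, h0, ENNReal.ofReal_zero]
  exact (measurePreserving_eval (fun _ : Fin n => shiftLaw f θ) i).quasiMeasurePreserving.ae h

/-- First order expansion of `η ↦ ∫ w(y) f(y - η) dy`. -/
theorem exists_integral_expansion (hf : IsShiftDensity f) {K : Set ℝ} (hK : IsCompact K)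
    (hKS : K ⊆ Function.support f) {w : ℝ → ℝ} (hw : Measurable w) (hwK : ∀ y ∉ K, w y = 0)
    {W : ℝ} (hW : ∀ y, |w y| ≤ W) {δ : ℝ} (hδ : 0 < δ) :
    ∃ η₀ > 0, ∀ η, |η| ≤ η₀ →
      |(∫ y, w y * f (y - η)) - (∫ y, w y * f y) + η * ∫ y, w y * deriv f y| ≤ δ * |η| := by
  have hW0 : 0 ≤ W := (abs_nonneg _).trans (hW 0)
  set V := volume.real K with hV
  have hV0 : 0 ≤ V := measureReal_nonneg
  obtain ⟨η₀, hη₀, h⟩ := hf.exists_uniform_expansion hK hKS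
    (δ := δ / (W * V + 1)) (by positivity)
  refine ⟨η₀, hη₀, fun η hη => ?_⟩
  have hbd : ∀ {u : ℝ → ℝ}, Integrable u → Integrable fun y => w y * u y := fun hu =>
    hu.bdd_mul hw.aestronglyMeasurable (ae_of_all _ hW)
  have i1 : Integrable fun y => w y * f (y - η) := hbd (hf.integrable.comp_sub_right η)
  have i2 : Integrable fun y => w y * f y := hbd hf.integrable
  have i3 : Integrable fun y => w y * deriv f y := by
    have := (hf.continuousOn_deriv.mono hKS).integrableOn_compact hK (μ := volume)
    have h3 := hbd ((integrable_indicator_iff hK.measurableSet).2 this)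
    refine h3.congr (ae_of_all _ fun y => ?_)
    by_cases hy : y ∈ K
    · simp only [Set.indicator_of_mem hy]
    · simp only [hwK y hy, zero_mul]
  have e : (∫ y, w y * f (y - η)) - (∫ y, w y * f y) + η * ∫ y, w y * deriv f y =
      ∫ y in K, w y * (f (y + -η) - f y - -η * deriv f y) := by
    rw [setIntegral_eq_integral_of_forall_compl_eq_zero
      (fun y hy => by rw [hwK y hy, zero_mul]), ← integral_sub i1 i2, ← integral_const_mul]
    refine (integral_add (i1.sub i2) (i3.const_mul η)).symm.trans ?_
    refine integral_congr_ae (ae_of_all _ fun y => ?_)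
    simp only [Pi.sub_apply, ← sub_eq_add_neg]
    ring
  rw [e, ← Real.norm_eq_abs]
  refine (norm_setIntegral_le_of_norm_le_const hK.measure_lt_top
    (C := W * (δ / (W * V + 1) * |η|)) fun y hy => ?_).trans ?_
  · rw [norm_mul, Real.norm_eq_abs, Real.norm_eq_abs]
    refine mul_le_mul (hW y) ?_ (abs_nonneg _) hW0
    have := (h (-η) (by rwa [abs_neg]) y hy).2
    rwa [abs_neg] at this
  · have : W * (δ / (W * V + 1) * |η|) * V = δ * |η| * (W * V / (W * V + 1)) := by ring
    rw [← hV, this]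
    refine mul_le_of_le_one_right (by positivity) ?_
    rw [div_le_one (by positivity)]
    linarith

end IsShiftDensity

/-! ### Achievability: the one-step estimator with cut-off score -/

theorem Real.exp_le_quadratic_add_cube {x : ℝ} (hx : |x| ≤ 1) :
    Real.exp x ≤ 1 + x + x ^ 2 / 2 + |x| ^ 3 := by
  have h := (abs_le.1 (Real.exp_bound hx (n := 3) (by norm_num))).2
  have h3 : 0 ≤ |x| ^ 3 := by positivity
  norm_num [Finset.sum_range_succ, Nat.factorial] at h
  linarith

/-- The score `-f'/f` of the location family, cut off outside `[a, b]`. -/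
noncomputable def truncScore (f : ℝ → ℝ) (a b : ℝ) : ℝ → ℝ :=
  (Set.Icc a b).indicator fun y => -(deriv f y / f y)

/-- The Fisher information collected on `[a, b]`. -/
noncomputable def fisherOn (f : ℝ → ℝ) (a b : ℝ) : ℝ := ∫ x in Set.Icc a b, deriv f x ^ 2 / f x

/-- Taylor's formula of order two, with the square of the exponent replaced by `ε² ((t - m)² + R ε)`
and the remainder by `C³ ε³`. The bound is quadratic in the score value `t`, so only two moments
under the shifted law are needed. -/
theorem exp_score_le {M m J ε η σ t C R : ℝ} (hJ0 : 0 ≤ J) (hM : |t| ≤ M) (hε : 0 < ε)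
    (hη : |η| ≤ ε) (hσ : |σ| = 1) (hC : C = M + |m| + 2 * J)
    (hR : R = 4 * J * (M + |m|) + 4 * J ^ 2) (hεC : ε * (C + 1) ≤ 1) :
    Real.exp (ε * (σ * (t - m - J * η) - J * ε)) ≤
      (1 - ε * σ * m - ε * σ * J * η - J * ε ^ 2 + ε ^ 2 / 2 * (m ^ 2 + R * ε) + C ^ 3 * ε ^ 3) +
      (ε * σ - ε ^ 2 * m) * t + ε ^ 2 / 2 * t ^ 2 := by
  have hM0 : 0 ≤ M := (abs_nonneg _).trans hM
  have hC0 : 0 ≤ C := by rw [hC]; positivity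
  have hε1 : ε ≤ 1 := by
    have := mul_nonneg hε.le hC0
    linarith
  have hσ2 : σ ^ 2 = 1 := by rw [← sq_abs, hσ, one_pow]
  have hr : |J * (σ * η + ε)| ≤ 2 * J * ε := by
    rw [abs_mul, abs_of_nonneg hJ0, mul_comm 2 J, mul_assoc]
    refine mul_le_mul_of_nonneg_left ?_ hJ0
    refine (abs_add_le _ _).trans ?_
    rw [abs_mul, hσ, one_mul, abs_of_pos hε]
    linarith
  have htm : |t - m| ≤ M + |m| := (abs_sub _ _).trans (by linarith)
  have e : σ * (t - m - J * η) - J * ε = σ * (t - m) - J * (σ * η + ε) := by ring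
  have hv : |σ * (t - m - J * η) - J * ε| ≤ C := by
    rw [e, hC]
    refine (abs_sub _ _).trans ?_
    rw [abs_mul, hσ, one_mul]
    have : 2 * J * ε ≤ 2 * J := mul_le_of_le_one_right (by positivity) hε1
    linarith
  have hu : |ε * (σ * (t - m - J * η) - J * ε)| ≤ ε * C := by
    rw [abs_mul, abs_of_pos hε]
    exact mul_le_mul_of_nonneg_left hv hε.le
  have hexp := Real.exp_le_quadratic_add_cube (hu.trans (by linarith))
  have hcube : |ε * (σ * (t - m - J * η) - J * ε)| ^ 3 ≤ C ^ 3 * ε ^ 3 := by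
    refine (pow_le_pow_left₀ (abs_nonneg _) hu 3).trans_eq ?_
    ring
  have hsq : (σ * (t - m - J * η) - J * ε) ^ 2 ≤ (t - m) ^ 2 + R * ε := by
    rw [e]
    have h1 : -(2 * (σ * (t - m)) * (J * (σ * η + ε))) ≤ 2 * ((M + |m|) * (2 * J * ε)) := by
      have h2 : |σ * (t - m) * (J * (σ * η + ε))| ≤ (M + |m|) * (2 * J * ε) := by
        rw [abs_mul, abs_mul σ, hσ, one_mul]
        exact mul_le_mul htm hr (abs_nonneg _) (by positivity)
      have h3 := (abs_le.1 h2).1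
      linarith
    have h4 : (J * (σ * η + ε)) ^ 2 ≤ 4 * J ^ 2 * ε := by
      rw [← sq_abs]
      refine (pow_le_pow_left₀ (abs_nonneg _) hr 2).trans ?_
      have : ε * ε ≤ ε := mul_le_of_le_one_left hε.le hε1
      calc (2 * J * ε) ^ 2 = 4 * J ^ 2 * (ε * ε) := by ring
        _ ≤ 4 * J ^ 2 * ε := mul_le_mul_of_nonneg_left this (by positivity)
    calc (σ * (t - m) - J * (σ * η + ε)) ^ 2
        = σ ^ 2 * (t - m) ^ 2 + -(2 * (σ * (t - m)) * (J * (σ * η + ε))) +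
          (J * (σ * η + ε)) ^ 2 := by ring
      _ ≤ (t - m) ^ 2 + R * ε := by
          rw [hσ2, one_mul, hR]
          linarith
  have hsq' : (ε * (σ * (t - m - J * η) - J * ε)) ^ 2 ≤ ε ^ 2 * ((t - m) ^ 2 + R * ε) := by
    rw [mul_pow]
    exact mul_le_mul_of_nonneg_left hsq (sq_nonneg _)
  refine hexp.trans ?_
  linarith

/-- With `E1 ≈ m + η J` and `E2 ≈ J`, the terms linear in `σ` cancel and `-J ε² + J ε²/2` remains;
the term `-m² ε²/2` is dropped. The errors take `d/3`, `d/6` and, from the cubic terms collected in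
`D`, `d/2`. -/
theorem score_moments_le {m J ε η σ C R E1 E2 d D : ℝ} (hJ0 : 0 ≤ J) (hd : 0 < d) (hε : 0 < ε)
    (hη : |η| ≤ ε) (hσ : |σ| = 1) (hE1 : |E1 - m - η * J| ≤ d / 3 * |η|) (hE2 : E2 ≤ J + d / 3)
    (hD : D = |m| * (J + d / 3) + R / 2 + C ^ 3) (hεD : ε * (2 * (D + 1)) ≤ d) :
    (1 - ε * σ * m - ε * σ * J * η - J * ε ^ 2 + ε ^ 2 / 2 * (m ^ 2 + R * ε) + C ^ 3 * ε ^ 3) +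
      (ε * σ - ε ^ 2 * m) * E1 + ε ^ 2 / 2 * E2 ≤ 1 - (J / 2 - d) * ε ^ 2 := by
  have hη' : d / 3 * |η| ≤ d / 3 * ε := mul_le_mul_of_nonneg_left hη (by positivity)
  have hb1 : σ * (E1 - m - η * J) ≤ d / 3 * ε := by
    refine (le_abs_self _).trans ?_
    rw [abs_mul, hσ, one_mul]
    exact hE1.trans hη'
  have hE1m : |E1 - m| ≤ (J + d / 3) * ε := by
    have e : E1 - m = (E1 - m - η * J) + η * J := by ring
    rw [e]
    refine (abs_add_le _ _).trans ?_
    rw [abs_mul η, abs_of_nonneg hJ0]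
    have := mul_le_mul_of_nonneg_right hη hJ0
    linarith
  have hb2 : -(m * (E1 - m)) ≤ |m| * ((J + d / 3) * ε) := by
    refine (neg_le_abs _).trans ?_
    rw [abs_mul]
    exact mul_le_mul_of_nonneg_left hE1m (abs_nonneg _)
  have t1 : ε * (σ * (E1 - m - η * J)) ≤ ε * (d / 3 * ε) :=
    mul_le_mul_of_nonneg_left hb1 hε.le
  have t2 : ε ^ 2 / 2 * E2 ≤ ε ^ 2 / 2 * (J + d / 3) :=
    mul_le_mul_of_nonneg_left hE2 (by positivity)
  have t3 : ε ^ 2 * -(m * (E1 - m)) ≤ ε ^ 2 * (|m| * ((J + d / 3) * ε)) :=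
    mul_le_mul_of_nonneg_left hb2 (by positivity)
  have t4 : ε ^ 2 * (ε * (2 * (D + 1))) ≤ ε ^ 2 * d :=
    mul_le_mul_of_nonneg_left hεD (by positivity)
  have t5 : 0 ≤ ε ^ 3 := by positivity
  have t6 : 0 ≤ ε ^ 2 * m ^ 2 := by positivity
  rw [hD] at t4
  linarith

namespace IsShiftDensity

variable {f : ℝ → ℝ} {a b : ℝ}

theorem measurable_truncScore (hf : IsShiftDensity f) (a b : ℝ) :
    Measurable (truncScore f a b) :=
  ((measurable_deriv f).div hf.continuous.measurable).neg.indicator measurableSet_Icc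

theorem exists_abs_truncScore_le (hf : IsShiftDensity f)
    (hK : Set.Icc a b ⊆ Function.support f) : ∃ M, 0 ≤ M ∧ ∀ y, |truncScore f a b y| ≤ M := by
  have hc : ContinuousOn (fun y => -(deriv f y / f y)) (Set.Icc a b) :=
    (((hf.continuousOn_deriv).div hf.continuous.continuousOn fun _ hx => hx).neg).mono hK
  obtain ⟨M, hM⟩ := isCompact_Icc.exists_bound_of_continuousOn hc
  refine ⟨max M 0, le_max_right _ _, fun y => ?_⟩
  by_cases hy : y ∈ Set.Icc a b
  · rw [truncScore, Set.indicator_of_mem hy]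
    exact (hM y hy).trans (le_max_left _ _)
  · rw [truncScore, Set.indicator_of_notMem hy, abs_zero]
    exact le_max_right _ _

theorem fisherOn_nonneg (hf : IsShiftDensity f) (a b : ℝ) : 0 ≤ fisherOn f a b :=
  integral_nonneg fun x => div_nonneg (sq_nonneg _) (hf.nonneg x)

theorem integral_truncScore_mul_deriv (f : ℝ → ℝ) (a b : ℝ) :
    ∫ y, truncScore f a b y * deriv f y = -fisherOn f a b := by
  rw [fisherOn, ← integral_neg, ← integral_indicator measurableSet_Icc]
  refine integral_congr_ae (ae_of_all _ fun y => ?_)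
  by_cases hy : y ∈ Set.Icc a b
  · simp only [truncScore, Set.indicator_of_mem hy]
    ring
  · simp only [truncScore, Set.indicator_of_notMem hy, zero_mul]

theorem integral_truncScore_sq_mul (hK : Set.Icc a b ⊆ Function.support f) :
    ∫ y, truncScore f a b y ^ 2 * f y = fisherOn f a b := by
  rw [fisherOn, ← integral_indicator measurableSet_Icc]
  refine integral_congr_ae (ae_of_all _ fun y => ?_)
  by_cases hy : y ∈ Set.Icc a b
  · have : f y ≠ 0 := hK hy
    simp only [truncScore, Set.indicator_of_mem hy]
    field_simp
  · simp only [truncScore, Set.indicator_of_notMem hy]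
    simp

theorem integrable_pow_truncScore_mul (hf : IsShiftDensity f)
    (hK : Set.Icc a b ⊆ Function.support f) (k : ℕ) (η : ℝ) :
    Integrable fun y => truncScore f a b y ^ k * f (y - η) := by
  obtain ⟨M, hM0, hM⟩ := hf.exists_abs_truncScore_le hK
  refine (hf.integrable.comp_sub_right η).bdd_mul (c := M ^ k)
    ((hf.measurable_truncScore a b).pow_const k).aestronglyMeasurable (ae_of_all _ fun y => ?_)
  rw [Real.norm_eq_abs, abs_pow]
  exact pow_le_pow_left₀ (abs_nonneg _) (hM y) k

/-- The first two moments of the cut-off score under a small shift. -/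
theorem exists_truncScore_moments (hf : IsShiftDensity f)
    (hK : Set.Icc a b ⊆ Function.support f) {δ : ℝ} (hδ : 0 < δ) :
    ∃ η₀ > 0, ∀ η, |η| ≤ η₀ →
      |(∫ y, truncScore f a b y * f (y - η)) - (∫ y, truncScore f a b y * f y) -
        η * fisherOn f a b| ≤ δ * |η| ∧
      (∫ y, truncScore f a b y ^ 2 * f (y - η)) ≤ fisherOn f a b + δ := by
  obtain ⟨M, hM0, hM⟩ := hf.exists_abs_truncScore_le hK
  have hm := hf.measurable_truncScore a b
  have h0 : ∀ y ∉ Set.Icc a b, truncScore f a b y = 0 := fun y hy =>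
    Set.indicator_of_notMem hy _
  obtain ⟨η₁, hη₁, h₁⟩ := hf.exists_integral_expansion isCompact_Icc hK hm h0 hM hδ
  obtain ⟨η₂, hη₂, h₂⟩ := hf.exists_integral_expansion isCompact_Icc hK (hm.pow_const 2)
    (fun y hy => by rw [h0 y hy, zero_pow two_ne_zero]) (W := M ^ 2)
    (fun y => by
      rw [abs_pow]
      exact pow_le_pow_left₀ (abs_nonneg _) (hM y) 2) one_pos
  set D := ∫ y, truncScore f a b y ^ 2 * deriv f y with hD
  refine ⟨min (min η₁ η₂) (δ / (1 + |D|)), by positivity, fun η hη => ⟨?_, ?_⟩⟩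
  · have := h₁ η (hη.trans ((min_le_left _ _).trans (min_le_left _ _)))
    rw [integral_truncScore_mul_deriv] at this
    convert this using 2
    ring
  · have h := (abs_le.1 (h₂ η (hη.trans ((min_le_left _ _).trans (min_le_right _ _))))).2
    rw [integral_truncScore_sq_mul hK, one_mul] at h
    have h3 : |η| * (1 + |D|) ≤ δ := by
      rw [← le_div_iff₀ (by positivity)]
      exact hη.trans (min_le_right _ _)
    have h4 : -(η * D) ≤ |η| * |D| := by
      rw [← abs_mul]
      exact neg_le_abs _
    linarith

/-- The Laplace parameter is `ε` because `-t J ε + t² J / 2`, the leading exponent at parameter `t`,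
is smallest at `t = ε`, with value `-J ε²/2`. The sign `σ` selects the upper or the lower deviation.
-/
theorem exists_mgf_truncScore_le (hf : IsShiftDensity f)
    (hK : Set.Icc a b ⊆ Function.support f) {c : ℝ} (hc : c < fisherOn f a b / 2) :
    ∃ ε₀ > 0, ∀ ε, 0 < ε → ε ≤ ε₀ → ∀ η, |η| ≤ ε → ∀ σ : ℝ, |σ| = 1 →
      ∫⁻ y, ENNReal.ofReal (f (y - η)) * ENNReal.ofReal (Real.exp (ε * (σ * (truncScore f a b y -
        (∫ y, truncScore f a b y * f y) - fisherOn f a b * η) - fisherOn f a b * ε))) ≤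
        ENNReal.ofReal (Real.exp (-(c * ε ^ 2))) := by
  obtain ⟨M, hM0, hM⟩ := hf.exists_abs_truncScore_le hK
  obtain ⟨ψ, hψ⟩ : ∃ ψ, ψ = truncScore f a b := ⟨_, rfl⟩
  obtain ⟨J, hJ⟩ : ∃ J, J = fisherOn f a b := ⟨_, rfl⟩
  obtain ⟨m, hm⟩ : ∃ m, m = ∫ y, ψ y * f y := ⟨_, rfl⟩
  obtain ⟨d, hd⟩ : ∃ d, d = J / 2 - c := ⟨_, rfl⟩
  have hJ0 : 0 ≤ J := hJ ▸ hf.fisherOn_nonneg a b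
  have hd0 : 0 < d := by linarith
  obtain ⟨η₀, hη₀, hmom⟩ := hf.exists_truncScore_moments hK (δ := d / 3) (by positivity)
  have hi := hf.integrable_pow_truncScore_mul hK
  rw [← hψ] at hM hmom hi ⊢
  rw [← hJ] at hmom ⊢
  rw [← hm] at hmom ⊢
  obtain ⟨C, hC⟩ : ∃ C, C = M + |m| + 2 * J := ⟨_, rfl⟩
  obtain ⟨R, hR⟩ : ∃ R, R = 4 * J * (M + |m|) + 4 * J ^ 2 := ⟨_, rfl⟩
  obtain ⟨D, hD⟩ : ∃ D, D = |m| * (J + d / 3) + R / 2 + C ^ 3 := ⟨_, rfl⟩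
  have hC0 : 0 ≤ C := by rw [hC]; positivity
  have hR0 : 0 ≤ R := by rw [hR]; positivity
  have hD0 : 0 ≤ D := by rw [hD]; positivity
  -- The three radii serve the moment expansion, the condition that the exponent stays in `[-1, 1]`,
  -- and the absorption of the cubic errors.
  refine ⟨min (min η₀ (1 / (C + 1))) (d / (2 * (D + 1))), by positivity,
    fun ε hε hε₀ η hη σ hσ => ?_⟩
  have hεη : ε ≤ η₀ := hε₀.trans ((min_le_left _ _).trans (min_le_left _ _))
  have hεC : ε * (C + 1) ≤ 1 := by
    rw [← le_div_iff₀ (by positivity)]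
    exact hε₀.trans ((min_le_left _ _).trans (min_le_right _ _))
  have hεD : ε * (2 * (D + 1)) ≤ d := by
    rw [← le_div_iff₀ (by positivity)]
    exact hε₀.trans (min_le_right _ _)
  obtain ⟨hE1, hE2⟩ := hmom η (hη.trans hεη)
  have i0 : Integrable fun y => f (y - η) := hf.integrable.comp_sub_right η
  have i1 : Integrable fun y => ψ y * f (y - η) := by simpa using hi 1 η
  have i2 : Integrable fun y => ψ y ^ 2 * f (y - η) := hi 2 η
  have hnum := score_moments_le (C := C) (R := R) hJ0 hd0 hε hη hσ hE1 hE2 hD hεD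
  have hpt := fun y => exp_score_le hJ0 (hM y) hε hη hσ hC hR hεC
  generalize 1 - ε * σ * m - ε * σ * J * η - J * ε ^ 2 + ε ^ 2 / 2 * (m ^ 2 + R * ε) +
    C ^ 3 * ε ^ 3 = A0 at hnum hpt
  generalize ε * σ - ε ^ 2 * m = A1 at hnum hpt
  generalize ε ^ 2 / 2 = A2 at hnum hpt
  have iall : Integrable fun y => A0 * f (y - η) + A1 * (ψ y * f (y - η)) +
      A2 * (ψ y ^ 2 * f (y - η)) :=
    ((i0.const_mul _).add (i1.const_mul _)).add (i2.const_mul _)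
  have hle : ∀ y, f (y - η) * Real.exp (ε * (σ * (ψ y - m - J * η) - J * ε)) ≤
      A0 * f (y - η) + A1 * (ψ y * f (y - η)) + A2 * (ψ y ^ 2 * f (y - η)) := by
    intro y
    refine (mul_le_mul_of_nonneg_left (hpt y) (hf.nonneg _)).trans_eq ?_
    ring
  have hI : ∫ y, (A0 * f (y - η) + A1 * (ψ y * f (y - η)) + A2 * (ψ y ^ 2 * f (y - η))) =
      A0 + A1 * (∫ y, ψ y * f (y - η)) + A2 * ∫ y, ψ y ^ 2 * f (y - η) := by
    refine (integral_add ((i0.const_mul _).add (i1.const_mul _)) (i2.const_mul _)).trans ?_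
    rw [integral_const_mul]
    congr 1
    refine (integral_add (i0.const_mul _) (i1.const_mul _)).trans ?_
    rw [integral_const_mul, integral_const_mul, integral_sub_right_eq_self f η,
      hf.integral_eq_one, mul_one]
  calc ∫⁻ y, ENNReal.ofReal (f (y - η)) *
        ENNReal.ofReal (Real.exp (ε * (σ * (ψ y - m - J * η) - J * ε)))
      ≤ ∫⁻ y, ENNReal.ofReal (A0 * f (y - η) + A1 * (ψ y * f (y - η)) +
          A2 * (ψ y ^ 2 * f (y - η))) := by
        refine lintegral_mono fun y => ?_
        rw [← ENNReal.ofReal_mul (hf.nonneg _)]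
        exact ENNReal.ofReal_le_ofReal (hle y)
    _ = ENNReal.ofReal (∫ y, (A0 * f (y - η) + A1 * (ψ y * f (y - η)) +
          A2 * (ψ y ^ 2 * f (y - η)))) :=
        (ofReal_integral_eq_lintegral_ofReal iall (ae_of_all _ fun y =>
          (mul_nonneg (hf.nonneg _) (Real.exp_nonneg _)).trans (hle y))).symm
    _ ≤ _ := by
        refine ENNReal.ofReal_le_ofReal ?_
        rw [hI]
        refine le_trans ?_ (Real.add_one_le_exp (-(c * ε ^ 2)))
        have hc' : c = J / 2 - d := by rw [hd]; ring
        rw [hc']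
        linarith

/-- The one-step estimator at `θ` with the score cut off to `[a, b]`. -/
noncomputable def oneStep (hf : IsShiftDensity f) (a b θ : ℝ) : Estimator ℝ where
  toFun n x := θ + (∑ i, (truncScore f a b (x i - θ) - ∫ y, truncScore f a b y * f y)) /
    (n * fisherOn f a b)
  measurable_toFun n := by
    have := hf.measurable_truncScore a b
    fun_prop

/-- At `θ' = θ + η` the cut-off score has mean `m + η J` to first order, so an error of size `ε`
says that the centred sum deviates from `n J η` by at least `n J ε`. -/
theorem fisherOn_div_two_le_alphaTwoOf_oneStep (hf : IsShiftDensity f)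
    (hK : Set.Icc a b ⊆ Function.support f) (hpos : 0 < fisherOn f a b) {g : ℝ → ℝ}
    (hg : ∀ x, g x = x ^ 2) (θ : ℝ) :
    ((fisherOn f a b / 2 : ℝ) : EReal) ≤
      alphaTwoOf volume (shiftFamily f) g (hf.oneStep a b θ) θ := by
  refine EReal.ge_of_forall_gt_iff_ge.1 fun c hc => ?_
  have hc' : c < fisherOn f a b / 2 := by exact_mod_cast hc
  obtain ⟨ε₀, hε₀, h⟩ := hf.exists_mgf_truncScore_le hK hc'
  refine le_alphaTwoOf hg ?_
  filter_upwards [Ioc_mem_nhdsGT hε₀] with ε hε θ' hθ' n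
  have hP := hf.isProbabilityMeasure_shiftLaw θ'
  set m := ∫ y, truncScore f a b y * f y with hm
  set J := fisherOn f a b with hJ
  have hη : |θ' - θ| ≤ ε := by
    rw [abs_le]
    constructor <;> linarith [hθ'.1, hθ'.2]
  let φ : ℝ → ℝ → ℝ≥0∞ := fun σ x => ENNReal.ofReal (Real.exp
    (ε * (σ * (truncScore f a b (x - θ) - m - J * (θ' - θ)) - J * ε)))
  have hφm : ∀ σ, Measurable (φ σ) := by
    intro σ
    have := hf.measurable_truncScore a b
    fun_prop
  have hφ : ∀ σ : ℝ, |σ| = 1 → ∫⁻ x, φ σ x ∂shiftLaw f θ' ≤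
      ENNReal.ofReal (Real.exp (-(c * ε ^ 2))) := by
    intro σ hσ
    refine le_trans (le_of_eq ?_) (h ε hε.1 hε.2 (θ' - θ) hη σ hσ)
    rw [hf.lintegral_shiftLaw θ' (hφm σ), ← lintegral_sub_right_eq_self _ (θ' - θ)]
    refine lintegral_congr fun y => ?_
    simp only [φ]
    rw [show y - (θ' - θ) + θ' - θ = y by ring]
  have hprod : ∀ (σ : ℝ) (x : Fin n → ℝ), 0 ≤ σ * (∑ i, (truncScore f a b (x i - θ) - m) -
      n * J * (θ' - θ)) - n * J * ε → 1 ≤ ∏ i, φ σ (x i) := by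
    intro σ x hx
    simp only [φ]
    rw [← ENNReal.ofReal_prod_of_nonneg fun i _ => Real.exp_nonneg _, ← Real.exp_sum,
      ENNReal.one_le_ofReal, Real.one_le_exp_iff, ← Finset.mul_sum]
    refine mul_nonneg hε.1.le (hx.trans_eq ?_)
    simp only [Finset.sum_sub_distrib, ← Finset.mul_sum, Finset.sum_const, Finset.card_univ,
      Fintype.card_fin, nsmul_eq_mul]
    ring
  rw [iidLaw_shiftFamily]
  refine pi_le_two_mul_of_chernoff _ n (hφm 1) (hφm (-1)) (hφ 1 (by simp)) (hφ (-1) (by simp))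
    (ae_of_all _ fun x hx => ?_)
  -- For `n = 0` the estimator divides by zero, but the empty product is `1` and the event is
  -- covered anyway.
  rcases Nat.eq_zero_or_pos n with rfl | hn
  · left
    simp
  have hn' : (0 : ℝ) < n := by exact_mod_cast hn
  have hnJ : 0 < n * J := mul_pos hn' hpos
  have hx' : ε ≤ |θ + (∑ i, (truncScore f a b (x i - θ) - m)) / (n * J) - θ'| := hx
  set Sx := ∑ i, (truncScore f a b (x i - θ) - m) with hSx
  have e : θ + Sx / (n * J) - θ' = (Sx - n * J * (θ' - θ)) / (n * J) := by
    field_simp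
    ring
  rw [e, abs_div, abs_of_pos hnJ, le_div_iff₀ hnJ, le_abs'] at hx'
  rcases hx' with hx' | hx'
  · right
    refine hprod _ _ ?_
    linarith
  · left
    refine hprod _ _ ?_
    linarith

theorem fisherInfo_div_two_le_alphaTwo (hf : IsShiftDensity f) {g : ℝ → ℝ}
    (hg : ∀ x, g x = x ^ 2) (θ : ℝ) :
    ((fisherInfo f / 2 : ℝ≥0∞) : EReal) ≤ alphaTwo volume (shiftFamily f) g θ := by
  have hP := hf.isProbabilityMeasure_iidLaw
  obtain ⟨x₀, hx₀⟩ := hf.support_nonempty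
  refine le_of_forall_lt fun r hr => ?_
  have h0 : 0 ≤ alphaTwo volume (shiftFamily f) g θ :=
    (alphaTwoOf_nonneg (hf.oneStep 0 0 θ) hg θ).trans
      (le_iSup (fun T => alphaTwoOf volume (shiftFamily f) g T θ) _)
  -- For `r ≥ 0` the interval found below has strictly positive information, so `J = 0` needs no
  -- separate treatment.
  rcases lt_or_ge r 0 with hr0 | hr0
  · exact hr0.trans_le h0
  lift r to ℝ≥0∞ using hr0
  rw [EReal.coe_ennreal_lt_coe_ennreal_iff, ENNReal.lt_div_iff_mul_lt (by simp) (by simp)] at hr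
  obtain ⟨a, b, -, -, hK, hJ⟩ := hf.exists_Icc_lt_setIntegral_fisher hx₀ hr
  change r * 2 < ENNReal.ofReal (fisherOn f a b) at hJ
  have hpos : 0 < fisherOn f a b := ENNReal.ofReal_pos.1 (zero_le.trans_lt hJ)
  refine lt_of_lt_of_le ?_ ((hf.fisherOn_div_two_le_alphaTwoOf_oneStep hK hpos hg θ).trans
    (le_iSup (fun T => alphaTwoOf volume (shiftFamily f) g T θ) _))
  rw [← ENNReal.lt_div_iff_mul_lt (by simp) (by simp)] at hJ
  have e : ((fisherOn f a b / 2 : ℝ) : EReal) =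
      ((ENNReal.ofReal (fisherOn f a b) / 2 : ℝ≥0∞) : EReal) := by
    have h2 : (2 : ℝ≥0∞) = ENNReal.ofReal 2 := by simp
    rw [h2, ← ENNReal.ofReal_div_of_pos two_pos, EReal.coe_ennreal_ofReal,
      max_eq_left (by positivity)]
  rw [e, EReal.coe_ennreal_lt_coe_ennreal_iff]
  exact hJ

end IsShiftDensity

/-! ### Converse: testing between two parameters -/

theorem pi_withDensity_prod {Ω : Type*} [MeasurableSpace Ω] (P : Measure Ω)
    [IsProbabilityMeasure P] {h : Ω → ℝ≥0∞} (hh : Measurable h)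
    [IsProbabilityMeasure (P.withDensity h)] (n : ℕ) :
    (Measure.pi fun _ : Fin n => P.withDensity h) =
      (Measure.pi fun _ : Fin n => P).withDensity fun x => ∏ i, h (x i) := by
  refine Measure.pi_eq fun s hs => ?_
  rw [withDensity_apply _ (MeasurableSet.univ_pi hs),
    ← lintegral_indicator (MeasurableSet.univ_pi hs)]
  have e : ∀ x : Fin n → Ω, (Set.univ.pi s).indicator (fun x => ∏ i, h (x i)) x =
      ∏ i, (s i).indicator h (x i) := by
    intro x
    by_cases hx : x ∈ Set.univ.pi s
    · rw [Set.indicator_of_mem hx]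
      exact Finset.prod_congr rfl fun i _ => (Set.indicator_of_mem (hx i trivial) _).symm
    · rw [Set.indicator_of_notMem hx]
      rw [Set.mem_univ_pi, not_forall] at hx
      obtain ⟨i, hi⟩ := hx
      exact (Finset.prod_eq_zero (Finset.mem_univ i) (Set.indicator_of_notMem hi _)).symm
  simp_rw [e]
  rw [lintegral_pi_prod P n fun i => hh.indicator (hs i)]
  refine Finset.prod_congr rfl fun i _ => ?_
  rw [withDensity_apply _ (hs i), lintegral_indicator (hs i)]

/-- Change of measure on an event on which the likelihood ratio is bounded. -/
theorem pi_withDensity_le {Ω : Type*} [MeasurableSpace Ω] (P : Measure Ω)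
    [IsProbabilityMeasure P] {h : Ω → ℝ≥0∞} (hh : Measurable h)
    [IsProbabilityMeasure (P.withDensity h)] (n : ℕ) {E : Set (Fin n → Ω)} {K : ℝ≥0∞}
    (hE : MeasurableSet E) (hK : ∀ x ∈ E, ∏ i, h (x i) ≤ K) :
    (Measure.pi fun _ : Fin n => P.withDensity h) E ≤ K * (Measure.pi fun _ : Fin n => P) E := by
  rw [pi_withDensity_prod P hh n, withDensity_apply _ hE, ← setLIntegral_const]
  exact setLIntegral_mono measurable_const hK

/-- Chebyshev's inequality for the mean of an i.i.d. sample. -/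
theorem pi_abs_sum_sub_ge_le {Ω : Type*} [MeasurableSpace Ω] (ν : Measure Ω)
    [IsProbabilityMeasure ν] {L : Ω → ℝ} (hL : MemLp L 2 ν) {n : ℕ} (hn : 0 < n) {δ : ℝ}
    (hδ : 0 < δ) :
    (Measure.pi fun _ : Fin n => ν) {x | n * δ ≤ |∑ i, L (x i) - n * ∫ ω, L ω ∂ν|} ≤
      ENNReal.ofReal (ProbabilityTheory.variance L ν / δ ^ 2 / n) := by
  have hn' : (0 : ℝ) < n := by exact_mod_cast hn
  have hLi : ∀ i : Fin n, MemLp (fun x : Fin n → Ω => L (x i)) 2 (Measure.pi fun _ => ν) :=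
    fun i => hL.comp_measurePreserving (measurePreserving_eval (fun _ : Fin n => ν) i)
  have hsum : MemLp (∑ i : Fin n, fun x : Fin n → Ω => L (x i)) 2 (Measure.pi fun _ => ν) :=
    memLp_finsetSum' _ fun i _ => hLi i
  have hmean : ∫ x, (∑ i : Fin n, fun x : Fin n → Ω => L (x i)) x ∂(Measure.pi fun _ => ν) =
      n * ∫ ω, L ω ∂ν := by
    simp only [Finset.sum_apply]
    rw [integral_finsetSum _ fun i _ => (hLi i).integrable one_le_two]
    simp_rw [integral_comp_eval (μ := fun _ : Fin n => ν) hL.aestronglyMeasurable]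
    simp
  have hvar := ProbabilityTheory.variance_sum_pi (μ := fun _ : Fin n => ν) (X := fun _ => L)
    fun _ => hL
  have h := ProbabilityTheory.meas_ge_le_variance_div_sq hsum (mul_pos hn' hδ)
  rw [hmean, hvar] at h
  simp only [Finset.sum_apply, Finset.sum_const, Finset.card_univ, Fintype.card_fin,
    nsmul_eq_mul] at h
  refine h.trans_eq ?_
  congr 1
  field_simp

/-- Turns two-sided exponential moments into the second moment needed for Chebyshev's inequality. -/
theorem sq_le_exp_add_exp_neg (x : ℝ) : x ^ 2 ≤ 2 * (Real.exp x + Real.exp (-x)) := by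
  have h := Real.quadratic_le_exp_of_nonneg (abs_nonneg x)
  have h2 : Real.exp |x| ≤ Real.exp x + Real.exp (-x) := by
    rcases abs_cases x with ⟨e, -⟩ | ⟨e, -⟩ <;> rw [e]
    · linarith [Real.exp_pos (-x)]
    · linarith [Real.exp_pos x]
  rw [sq_abs] at h
  linarith [abs_nonneg x]

section Converse

variable {Ω : Type*} [MeasurableSpace Ω] {μ : Measure Ω}

/-- If both rates exceeded `B`, some `B' > B` would bound the sum of the errors by `2 exp(-n B')`,
eventually below `exp(-n B)/2`. -/
theorem expRate_le_or_of_eventually_ge {p : ℝ → Ω → ℝ} {T : Estimator Ω} {θ₁ θ₂ ε B : ℝ}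
    (h : ∀ᶠ n : ℕ in atTop, ENNReal.ofReal (1 / 2 * Real.exp (-(n * B))) ≤
      iidLaw μ p θ₁ n {x | ε ≤ |T.toFun n x - θ₁|} +
        iidLaw μ p θ₂ n {x | ε ≤ |T.toFun n x - θ₂|}) :
    expRate μ p T θ₁ ε ≤ B ∨ expRate μ p T θ₂ ε ≤ B := by
  by_contra! hcon
  obtain ⟨B', hB', hlt⟩ := EReal.lt_iff_exists_real_btwn.1 (lt_min hcon.1 hcon.2)
  have hB' : B < B' := by exact_mod_cast hB'
  have key : ∀ θ, (B' : EReal) < expRate μ p T θ ε → ∀ᶠ n : ℕ in atTop,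
      iidLaw μ p θ n {x | ε ≤ |T.toFun n x - θ|} ≤ ENNReal.ofReal (Real.exp (-(n * B'))) := by
    intro θ hθ
    filter_upwards [eventually_lt_of_lt_liminf hθ, eventually_gt_atTop 0] with n hn hn0
    have hn' : (0 : ℝ) < n := by exact_mod_cast hn0
    have h1 := (EReal.le_div_iff_mul_le (by exact_mod_cast hn') (EReal.coe_ne_top _)).1 hn.le
    rw [← EReal.coe_mul, EReal.le_neg] at h1
    rw [← ENNReal.log_le_log_iff, ENNReal.log_ofReal_of_pos (Real.exp_pos _), Real.log_exp,
      mul_comm]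
    exact_mod_cast h1
  have hlim : Tendsto (fun n : ℕ => Real.exp (n * (B - B'))) atTop (𝓝 0) := by
    refine Real.tendsto_exp_atBot.comp ?_
    exact tendsto_natCast_atTop_atTop.atTop_mul_const_of_neg (by linarith)
  obtain ⟨n, h0, h1, h2, h3⟩ := (h.and ((key θ₁ (hlt.trans_le (min_le_left _ _))).and
    ((key θ₂ (hlt.trans_le (min_le_right _ _))).and
      (hlim.eventually (eventually_lt_nhds (by norm_num : (0 : ℝ) < 1 / 4)))))).exists
  have h4 := h0.trans (add_le_add h1 h2)
  rw [← ENNReal.ofReal_add (Real.exp_nonneg _) (Real.exp_nonneg _),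
    ENNReal.ofReal_le_ofReal_iff (by positivity)] at h4
  have h5 : Real.exp (n * (B - B')) * Real.exp (-(n * B)) = Real.exp (-(n * B')) := by
    rw [← Real.exp_add]
    congr 1
    ring
  nlinarith [Real.exp_pos (-(n * B))]

variable {p q : Ω → ℝ} {Z : ℝ}

/-- The tilted law with density `√(pq) / Z`. -/
noncomputable def midLaw (μ : Measure Ω) (p q : Ω → ℝ) (Z : ℝ) : Measure Ω :=
  μ.withDensity fun ω => ENNReal.ofReal (√(p ω) * √(q ω) / Z)

theorem midLaw_comm : midLaw μ p q Z = midLaw μ q p Z := by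
  simp only [midLaw, mul_comm]

/-- Where `p = 0` the tilted density also vanishes, so the tilted law is absolutely continuous with
respect to the law of `p`, and by symmetry to that of `q`. -/
theorem midLaw_eq_withDensity (hp : Measurable p) (hq : Measurable q) (hp0 : ∀ ω, 0 ≤ p ω) :
    midLaw μ p q Z = (μ.withDensity fun ω => ENNReal.ofReal (p ω)).withDensity
      fun ω => ENNReal.ofReal (√(q ω) / √(p ω) / Z) := by
  rw [midLaw, ← withDensity_mul _ hp.ennreal_ofReal (by fun_prop)]
  congr 1
  ext ω
  rw [Pi.mul_apply, ← ENNReal.ofReal_mul (hp0 ω)]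
  congr 1
  rcases (hp0 ω).eq_or_lt with h | h
  · simp [← h]
  · have h1 : √(p ω) ≠ 0 := (Real.sqrt_pos.2 h).ne'
    nth_rewrite 2 [← Real.mul_self_sqrt (hp0 ω)]
    field_simp

theorem ae_midLaw_pos (hp : Measurable p) (hq : Measurable q) :
    ∀ᵐ ω ∂midLaw μ p q Z, 0 < p ω ∧ 0 < q ω := by
  rw [midLaw, ae_withDensity_iff (by fun_prop)]
  refine ae_of_all _ fun ω h => ?_
  by_contra hc
  apply h
  rw [not_and_or, not_lt, not_lt] at hc
  rcases hc with hc | hc <;> simp [Real.sqrt_eq_zero_of_nonpos hc]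

theorem isProbabilityMeasure_midLaw (hZ : 0 < Z)
    (hint : Integrable (fun ω => √(p ω) * √(q ω)) μ) (hZe : ∫ ω, √(p ω) * √(q ω) ∂μ = Z) :
    IsProbabilityMeasure (midLaw μ p q Z) := by
  refine ⟨?_⟩
  rw [midLaw, withDensity_apply _ MeasurableSet.univ, Measure.restrict_univ,
    ← ofReal_integral_eq_lintegral_ofReal (hint.div_const Z)
      (ae_of_all _ fun ω => by positivity), integral_div, hZe, div_self hZ.ne',
    ENNReal.ofReal_one]

/-- The converse half of Chernoff's theorem at exponent `1/2`, with an explicit remainder. -/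
theorem chernoff_converse [IsProbabilityMeasure (μ.withDensity fun ω => ENNReal.ofReal (p ω))]
    [IsProbabilityMeasure (μ.withDensity fun ω => ENNReal.ofReal (q ω))]
    (hp : Measurable p) (hq : Measurable q) (hp0 : ∀ ω, 0 ≤ p ω) (hq0 : ∀ ω, 0 ≤ q ω)
    (hZ : 0 < Z) (hR : IsProbabilityMeasure (midLaw μ p q Z))
    (hL : MemLp (fun ω => Real.log (q ω / p ω)) 2 (midLaw μ p q Z)) {B : ℝ}
    (hB : -Real.log Z + |∫ ω, Real.log (q ω / p ω) ∂midLaw μ p q Z| / 2 < B) :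
    ∀ᶠ n : ℕ in atTop, ∀ E₁ E₂ : Set (Fin n → Ω), MeasurableSet E₁ → MeasurableSet E₂ →
      E₁ ∪ E₂ = Set.univ → ENNReal.ofReal (1 / 2 * Real.exp (-(n * B))) ≤
        (Measure.pi fun _ : Fin n => μ.withDensity fun ω => ENNReal.ofReal (p ω)) E₁ +
        (Measure.pi fun _ : Fin n => μ.withDensity fun ω => ENNReal.ofReal (q ω)) E₂ := by
  set ν := midLaw μ p q Z with hRdef
  set κ := ∫ ω, Real.log (q ω / p ω) ∂ν with hκ
  set δ := B - (-Real.log Z + |κ| / 2) with hδ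
  have hδ0 : 0 < δ := sub_pos.2 hB
  set V := ProbabilityTheory.variance (fun ω => Real.log (q ω / p ω)) ν with hV
  have hlim : Tendsto (fun n : ℕ => V / δ ^ 2 / n) atTop (𝓝 0) :=
    tendsto_const_div_atTop_nhds_zero_nat _
  filter_upwards [hlim.eventually (eventually_lt_nhds (by norm_num : (0 : ℝ) < 1 / 2)),
    eventually_gt_atTop 0] with n hnV hn E₁ E₂ hE₁ hE₂ hE
  have hn' : (0 : ℝ) < n := by exact_mod_cast hn
  have hcheb := pi_abs_sum_sub_ge_le ν hL hn hδ0
  set L := fun ω => Real.log (q ω / p ω) with hLdef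
  have hLm : Measurable L := Real.measurable_log.comp (hq.div hp)
  let pos : Set Ω := {ω | 0 < p ω ∧ 0 < q ω}
  have hposm : MeasurableSet pos :=
    (measurableSet_lt measurable_const hp).inter (measurableSet_lt measurable_const hq)
  -- The typical set of the tilted law. On it the likelihood ratios of the tilted product law
  -- against both hypotheses are at most `exp (n B)`, and for the chosen `n` it has probability at
  -- least `1/2`.
  let G : Set (Fin n → Ω) := {x | |∑ i, L (x i) - n * κ| < n * δ} ∩ Set.univ.pi fun _ => pos
  have hGm : MeasurableSet G := by
    refine MeasurableSet.inter (measurableSet_lt ?_ measurable_const)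
      (MeasurableSet.univ_pi fun _ => hposm)
    fun_prop
  have hGc : (Measure.pi fun _ : Fin n => ν) Gᶜ ≤ ENNReal.ofReal (1 / 2) := by
    have hae : ∀ᵐ x ∂(Measure.pi fun _ : Fin n => ν), ∀ i, x i ∈ pos :=
      ae_all_iff.2 fun i => (measurePreserving_eval (fun _ : Fin n => ν)
        i).quasiMeasurePreserving.ae (ae_midLaw_pos hp hq)
    refine le_trans (measure_mono_ae ?_) (hcheb.trans (ENNReal.ofReal_le_ofReal hnV.le))
    filter_upwards [hae] with x hx hxG
    by_contra hlt
    exact hxG ⟨not_le.1 hlt, fun i _ => hx i⟩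
  have hG : ENNReal.ofReal (1 / 2) ≤ (Measure.pi fun _ : Fin n => ν) G := by
    have h1 : (1 : ℝ≥0∞) ≤ (Measure.pi fun _ : Fin n => ν) G + ENNReal.ofReal (1 / 2) := by
      refine le_trans ?_ (add_le_add_right hGc _)
      rw [measure_add_measure_compl hGm, measure_univ]
    have h2 : (1 : ℝ≥0∞) = ENNReal.ofReal (1 / 2) + ENNReal.ofReal (1 / 2) := by
      rw [← ENNReal.ofReal_add (by norm_num) (by norm_num)]
      norm_num
    rw [h2] at h1
    exact (ENNReal.add_le_add_iff_right ENNReal.ofReal_ne_top).1 h1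
  have hbound : ∀ x ∈ G, |∑ i, L (x i)| / 2 - n * Real.log Z ≤ n * B := by
    intro x hx
    have h1 : |∑ i, L (x i)| ≤ n * δ + n * |κ| := by
      have h2 : ∑ i, L (x i) = (∑ i, L (x i) - n * κ) + n * κ := by ring
      rw [h2]
      refine (abs_add_le _ _).trans (add_le_add hx.1.le ?_)
      rw [abs_mul, abs_of_pos hn']
    have h3 : n * B = n * δ - n * Real.log Z + n * |κ| / 2 := by
      rw [hδ]
      ring
    have h4 : 0 < n * δ := mul_pos hn' hδ0
    linarith
  -- Stated for a generic pair so that it applies to `(p, q)` and to `(q, p)`, the tilted law being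
  -- symmetric.
  have hstep : ∀ {p' q' : Ω → ℝ}, Measurable p' → Measurable q' → (∀ ω, 0 ≤ p' ω) →
      IsProbabilityMeasure (μ.withDensity fun ω => ENNReal.ofReal (p' ω)) →
      ν = midLaw μ p' q' Z → (∀ x ∈ G, ∏ i, (√(q' (x i)) / √(p' (x i)) / Z) ≤
        Real.exp (|∑ i, L (x i)| / 2 - n * Real.log Z)) →
      ∀ E : Set (Fin n → Ω), MeasurableSet E → (Measure.pi fun _ : Fin n => ν) (E ∩ G) ≤
        ENNReal.ofReal (Real.exp (n * B)) *
          (Measure.pi fun _ : Fin n => μ.withDensity fun ω => ENNReal.ofReal (p' ω)) E := by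
    intro p' q' hp' hq' hp0' hP hRe hpr E hE
    have hRw := hRe.trans (midLaw_eq_withDensity (Z := Z) (μ := μ) hp' hq' hp0')
    rw [hRw] at hR ⊢
    refine (pi_withDensity_le _ (by fun_prop) n (hE.inter hGm)
      (K := ENNReal.ofReal (Real.exp (n * B))) fun x hx => ?_).trans ?_
    · rw [← ENNReal.ofReal_prod_of_nonneg fun i _ => by positivity]
      exact ENNReal.ofReal_le_ofReal ((hpr x hx.2).trans (Real.exp_le_exp.2 (hbound x hx.2)))
    · gcongr
      exact Set.inter_subset_left
  have hprod : ∀ {p' q' : Ω → ℝ}, (∀ ω ∈ pos, 0 < p' ω ∧ 0 < q' ω) → ∀ x ∈ G,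
      ∏ i, (√(q' (x i)) / √(p' (x i)) / Z) =
        Real.exp ((∑ i, Real.log (q' (x i) / p' (x i))) / 2 - n * Real.log Z) := by
    intro p' q' hpos x hx
    have e : ∀ i, √(q' (x i)) / √(p' (x i)) / Z =
        Real.exp (Real.log (q' (x i) / p' (x i)) / 2 - Real.log Z) := by
      intro i
      obtain ⟨h1, h2⟩ := hpos (x i) (hx.2 i trivial)
      rw [Real.exp_sub, Real.exp_log hZ, Real.exp_half, Real.exp_log (div_pos h2 h1),
        Real.sqrt_div' _ h1.le]
    simp_rw [e]
    rw [← Real.exp_sum, Finset.sum_sub_distrib, Finset.sum_div]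
    simp
  have hA := hstep hp hq hp0 inferInstance rfl (fun x hx => by
    rw [hprod (fun ω hω => hω) x hx]
    refine Real.exp_le_exp.2 ?_
    linarith [le_abs_self (∑ i, L (x i))]) E₁ hE₁
  have hA' := hstep hq hp hq0 inferInstance midLaw_comm (fun x hx => by
    rw [hprod (fun ω hω => ⟨hω.2, hω.1⟩) x hx]
    refine Real.exp_le_exp.2 ?_
    have e : ∑ i, Real.log (p (x i) / q (x i)) = -∑ i, L (x i) := by
      rw [← Finset.sum_neg_distrib]
      refine Finset.sum_congr rfl fun i _ => ?_
      rw [hLdef, ← Real.log_inv, inv_div]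
    rw [e]
    linarith [neg_le_abs (∑ i, L (x i))]) E₂ hE₂
  have hsum : ENNReal.ofReal (1 / 2) ≤ ENNReal.ofReal (Real.exp (n * B)) *
      ((Measure.pi fun _ : Fin n => μ.withDensity fun ω => ENNReal.ofReal (p ω)) E₁ +
        (Measure.pi fun _ : Fin n => μ.withDensity fun ω => ENNReal.ofReal (q ω)) E₂) := by
    rw [mul_add]
    refine hG.trans (le_trans ?_ (add_le_add hA hA'))
    refine le_trans (measure_mono ?_) (measure_union_le _ _)
    rw [← Set.union_inter_distrib_right, hE, Set.univ_inter]
  rw [mul_comm (1 / 2), ENNReal.ofReal_mul (Real.exp_nonneg _)]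
  calc ENNReal.ofReal (Real.exp (-(n * B))) * ENNReal.ofReal (1 / 2)
      ≤ ENNReal.ofReal (Real.exp (-(n * B))) * (ENNReal.ofReal (Real.exp (n * B)) * _) :=
        mul_le_mul_right hsum _
    _ = _ := by
        rw [← mul_assoc, ← ENNReal.ofReal_mul (Real.exp_nonneg _), ← Real.exp_add,
          neg_add_cancel, Real.exp_zero, ENNReal.ofReal_one, one_mul]

/-- Tilting by the log-likelihood ratio changes the order of the affinity from `1/2` to `1/2 - h`.
The range of `h` keeps both exponents positive, so that both sides vanish where a density does. -/
theorem sqrt_mul_sqrt_mul_exp {a b h : ℝ} (ha : 0 ≤ a) (hb : 0 ≤ b) (h1 : -(1 / 2) < h)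
    (h2 : h < 1 / 2) : √a * √b * Real.exp (h * Real.log (b / a)) =
      a ^ (1 / 2 - h) * b ^ (1 - (1 / 2 - h)) := by
  rcases ha.eq_or_lt with rfl | ha
  · rw [Real.zero_rpow (by linarith)]
    simp
  rcases hb.eq_or_lt with rfl | hb
  · rw [Real.zero_rpow (by linarith)]
    simp
  rw [mul_comm h, ← Real.rpow_def_of_pos (div_pos hb ha), Real.div_rpow hb.le ha.le,
    Real.sqrt_eq_rpow, Real.sqrt_eq_rpow, Real.rpow_sub ha,
    show 1 - (1 / 2 - h) = 1 / 2 + h by ring, Real.rpow_add hb]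
  ring

theorem integrable_midLaw_iff (hp : Measurable p) (hq : Measurable q) (hZ : 0 < Z) {φ : Ω → ℝ} :
    Integrable φ (midLaw μ p q Z) ↔ Integrable (fun ω => √(p ω) * √(q ω) * φ ω) μ := by
  rw [midLaw, integrable_withDensity_iff_integrable_smul' (by fun_prop)
    (ae_of_all _ fun _ => ENNReal.ofReal_lt_top)]
  have e : (fun ω => (ENNReal.ofReal (√(p ω) * √(q ω) / Z)).toReal • φ ω) =
      fun ω => (√(p ω) * √(q ω) * φ ω) / Z := by
    ext ω
    rw [ENNReal.toReal_ofReal (by positivity), smul_eq_mul]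
    ring
  rw [e]
  refine ⟨fun h => ?_, fun h => h.div_const Z⟩
  have := h.mul_const Z
  simpa [div_mul_cancel₀ _ hZ.ne'] using this

theorem integral_midLaw (hp : Measurable p) (hq : Measurable q) (hZ : 0 < Z) (φ : Ω → ℝ) :
    ∫ ω, φ ω ∂midLaw μ p q Z = (∫ ω, √(p ω) * √(q ω) * φ ω ∂μ) / Z := by
  rw [midLaw, integral_withDensity_eq_integral_toReal_smul (by fun_prop)
    (ae_of_all _ fun _ => ENNReal.ofReal_lt_top), ← integral_div]
  refine integral_congr_ae (ae_of_all _ fun ω => ?_)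
  simp only
  rw [ENNReal.toReal_ofReal (by positivity), smul_eq_mul]
  ring

/-- The mean of the log-likelihood ratio is, up to sign, the derivative at `1/2` of the log affinity
in its order. The inequality `x ≤ eˣ - 1` bounds it by difference quotients with step `h`, avoiding
differentiation under the integral. The same exponential moments give square integrability. -/
theorem memLp_log_midLaw_and_abs_integral_le (hp : Measurable p) (hq : Measurable q)
    (hp0 : ∀ ω, 0 ≤ p ω) (hq0 : ∀ ω, 0 ≤ q ω) (hZ : 0 < Z)
    (hR : IsProbabilityMeasure (midLaw μ p q Z)) {h : ℝ} (h0 : 0 < h) (h1 : h < 1 / 2)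
    (hi₁ : Integrable (fun ω => p ω ^ (1 / 2 - h) * q ω ^ (1 - (1 / 2 - h))) μ)
    (hi₂ : Integrable (fun ω => p ω ^ (1 / 2 + h) * q ω ^ (1 - (1 / 2 + h))) μ) :
    MemLp (fun ω => Real.log (q ω / p ω)) 2 (midLaw μ p q Z) ∧
    |∫ ω, Real.log (q ω / p ω) ∂midLaw μ p q Z| ≤
      max (((∫ ω, p ω ^ (1 / 2 - h) * q ω ^ (1 - (1 / 2 - h)) ∂μ) - Z) / (h * Z))
        (((∫ ω, p ω ^ (1 / 2 + h) * q ω ^ (1 - (1 / 2 + h)) ∂μ) - Z) / (h * Z)) := by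
  set L := fun ω => Real.log (q ω / p ω) with hL
  have hLm : Measurable L := Real.measurable_log.comp (hq.div hp)
  have e₁ : ∀ ω, √(p ω) * √(q ω) * Real.exp (h * L ω) =
      p ω ^ (1 / 2 - h) * q ω ^ (1 - (1 / 2 - h)) := fun ω =>
    sqrt_mul_sqrt_mul_exp (hp0 ω) (hq0 ω) (by linarith) h1
  have e₂ : ∀ ω, √(p ω) * √(q ω) * Real.exp (-(h * L ω)) =
      p ω ^ (1 / 2 + h) * q ω ^ (1 - (1 / 2 + h)) := fun ω => by
    have := sqrt_mul_sqrt_mul_exp (h := -h) (hp0 ω) (hq0 ω) (by linarith) (by linarith)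
    rwa [neg_mul, sub_neg_eq_add] at this
  have j₁ : Integrable (fun ω => Real.exp (h * L ω)) (midLaw μ p q Z) := by
    rw [integrable_midLaw_iff hp hq hZ]
    simpa only [e₁] using hi₁
  have j₂ : Integrable (fun ω => Real.exp (-(h * L ω))) (midLaw μ p q Z) := by
    rw [integrable_midLaw_iff hp hq hZ]
    simpa only [e₂] using hi₂
  have hmem : MemLp L 2 (midLaw μ p q Z) := by
    rw [memLp_two_iff_integrable_sq hLm.aestronglyMeasurable]
    refine (((j₁.add j₂).const_mul 2).div_const (h ^ 2)).mono'
      (hLm.pow_const 2).aestronglyMeasurable (ae_of_all _ fun ω => ?_)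
    rw [Real.norm_of_nonneg (sq_nonneg _), le_div_iff₀ (by positivity)]
    refine le_trans (le_of_eq ?_) (sq_le_exp_add_exp_neg (h * L ω))
    ring
  refine ⟨hmem, ?_⟩
  have hLi := hmem.integrable one_le_two
  have key : ∀ {σ : ℝ} {ψ : Ω → ℝ}, (∀ ω, √(p ω) * √(q ω) * Real.exp (σ * (h * L ω)) = ψ ω) →
      Integrable (fun ω => Real.exp (σ * (h * L ω))) (midLaw μ p q Z) →
      σ * ∫ ω, L ω ∂midLaw μ p q Z ≤ ((∫ ω, ψ ω ∂μ) - Z) / (h * Z) := by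
    intro σ ψ e j
    have hm : ∫ ω, σ * (h * L ω) ∂midLaw μ p q Z ≤
        ∫ ω, (Real.exp (σ * (h * L ω)) - 1) ∂midLaw μ p q Z :=
      integral_mono ((hLi.const_mul h).const_mul σ) (j.sub (integrable_const 1))
        fun ω => by linarith [Real.add_one_le_exp (σ * (h * L ω))]
    rw [integral_sub j (integrable_const 1), integral_const_mul, integral_const_mul,
      integral_midLaw hp hq hZ (fun ω => Real.exp (σ * (h * L ω)))] at hm
    simp only [e, integral_const, probReal_univ, smul_eq_mul, mul_one] at hm
    rw [le_div_iff₀ (by positivity)]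
    have h3 := mul_le_mul_of_nonneg_right hm hZ.le
    rw [sub_mul, div_mul_cancel₀ _ hZ.ne', one_mul] at h3
    linarith
  rw [abs_le']
  constructor
  · have := key (σ := 1) (ψ := fun ω => p ω ^ (1 / 2 - h) * q ω ^ (1 - (1 / 2 - h)))
      (fun ω => by rw [one_mul]; exact e₁ ω) (by simpa using j₁)
    rw [one_mul] at this
    exact this.trans (le_max_left _ _)
  · have := key (σ := -1) (ψ := fun ω => p ω ^ (1 / 2 + h) * q ω ^ (1 - (1 / 2 + h)))
      (fun ω => by rw [neg_one_mul]; exact e₂ ω) (by simpa using j₂)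
    rw [neg_one_mul] at this
    exact this.trans (le_max_right _ _)

end Converse

namespace IsShiftDensity

variable {f : ℝ → ℝ}

theorem shiftFamily_rpow_mul_rpow (f : ℝ → ℝ) (s θ ε : ℝ) :
    (fun x => shiftFamily f (θ - ε) x ^ s * shiftFamily f (θ + ε) x ^ (1 - s)) =
      fun x => (fun y => f (y + 2 * ε) ^ s * f y ^ (1 - s)) (x - (θ + ε)) := by
  ext x
  simp only [shiftFamily]
  congr 3
  ring

theorem integral_shiftFamily_rpow (f : ℝ → ℝ) (s θ ε : ℝ) :
    ∫ x, shiftFamily f (θ - ε) x ^ s * shiftFamily f (θ + ε) x ^ (1 - s) =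
      shiftAffinity f s (2 * ε) := by
  rw [shiftFamily_rpow_mul_rpow]
  exact integral_sub_right_eq_self (fun y => f (y + 2 * ε) ^ s * f y ^ (1 - s)) (θ + ε)

theorem integrable_shiftFamily_rpow (hf : IsShiftDensity f) {s : ℝ}
    (hs : s ∈ Set.Ioo (0 : ℝ) 1) (θ ε : ℝ) :
    Integrable fun x => shiftFamily f (θ - ε) x ^ s * shiftFamily f (θ + ε) x ^ (1 - s) := by
  rw [shiftFamily_rpow_mul_rpow]
  exact (hf.integrable_shiftAffinity hs (2 * ε)).comp_sub_right (θ + ε)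

theorem localRate_le (hf : IsShiftDensity f) (T : Estimator ℝ) (θ : ℝ) {ε h : ℝ} (hε : 0 < ε)
    (h0 : 0 < h) (h1 : h < 1 / 2) (hZ : 0 < shiftAffinity f (1 / 2) (2 * ε)) :
    localRate volume (shiftFamily f) T θ ε ≤
      ((-Real.log (shiftAffinity f (1 / 2) (2 * ε)) +
        max ((shiftAffinity f (1 / 2 - h) (2 * ε) - shiftAffinity f (1 / 2) (2 * ε)) /
          (h * shiftAffinity f (1 / 2) (2 * ε)))
          ((shiftAffinity f (1 / 2 + h) (2 * ε) - shiftAffinity f (1 / 2) (2 * ε)) /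
          (h * shiftAffinity f (1 / 2) (2 * ε))) / 2 : ℝ) : EReal) := by
  have hh : (1 / 2 : ℝ) ∈ Set.Ioo (0 : ℝ) 1 := by norm_num
  have hm : 1 / 2 - h ∈ Set.Ioo (0 : ℝ) 1 := ⟨by linarith, by linarith⟩
  have hp' : 1 / 2 + h ∈ Set.Ioo (0 : ℝ) 1 := ⟨by linarith, by linarith⟩
  set Z := shiftAffinity f (1 / 2) (2 * ε) with hZdef
  set p := shiftFamily f (θ - ε) with hp
  set q := shiftFamily f (θ + ε) with hq
  have hpm : Measurable p := hf.measurable_shiftFamily _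
  have hqm : Measurable q := hf.measurable_shiftFamily _
  have hp0 : ∀ x, 0 ≤ p x := fun x => hf.nonneg _
  have hq0 : ∀ x, 0 ≤ q x := fun x => hf.nonneg _
  have hP : IsProbabilityMeasure (volume.withDensity fun x => ENNReal.ofReal (p x)) :=
    hf.isProbabilityMeasure_shiftLaw _
  have hQ : IsProbabilityMeasure (volume.withDensity fun x => ENNReal.ofReal (q x)) :=
    hf.isProbabilityMeasure_shiftLaw _
  have hsqrt : (fun x => √(p x) * √(q x)) =
      fun x => p x ^ (1 / 2 : ℝ) * q x ^ (1 - 1 / 2 : ℝ) := by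
    ext x
    rw [Real.sqrt_eq_rpow, Real.sqrt_eq_rpow]
    norm_num
  have hprob : IsProbabilityMeasure (midLaw volume p q Z) := by
    refine isProbabilityMeasure_midLaw hZ ?_ ?_
    · rw [hsqrt]
      exact hf.integrable_shiftFamily_rpow hh θ ε
    · rw [hsqrt]
      exact integral_shiftFamily_rpow f _ θ ε
  obtain ⟨hL, hκ⟩ := memLp_log_midLaw_and_abs_integral_le hpm hqm hp0 hq0 hZ hprob h0 h1
    (hf.integrable_shiftFamily_rpow hm θ ε) (hf.integrable_shiftFamily_rpow hp' θ ε)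
  rw [integral_shiftFamily_rpow, integral_shiftFamily_rpow] at hκ
  refine EReal.le_of_forall_lt_iff_le.1 fun B hB => ?_
  have hB' := EReal.coe_lt_coe_iff.1 hB
  have hev := chernoff_converse hpm hqm hp0 hq0 hZ hprob hL (B := B) (by linarith)
  have hor := expRate_le_or_of_eventually_ge (p := shiftFamily f) (μ := volume) (T := T)
    (θ₁ := θ - ε) (θ₂ := θ + ε) (ε := ε) (B := B) (by
      filter_upwards [hev] with n hn
      refine hn _ _ ?_ ?_ ?_
      · exact measurableSet_le measurable_const ((T.measurable_toFun n).sub_const _).abs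
      · exact measurableSet_le measurable_const ((T.measurable_toFun n).sub_const _).abs
      · refine Set.eq_univ_of_forall fun x => ?_
        rcases le_total θ (T.toFun n x) with hx | hx
        · exact Or.inl (show ε ≤ |T.toFun n x - (θ - ε)| from le_abs.2 (Or.inl (by linarith)))
        · exact Or.inr (show ε ≤ |T.toFun n x - (θ + ε)| from le_abs.2 (Or.inr (by linarith))))
  rcases hor with h | h
  · exact (iInf₂_le (θ - ε) ⟨le_rfl, by linarith⟩).trans h
  · exact (iInf₂_le (θ + ε) ⟨by linarith, le_rfl⟩).trans h

/-- The parameters differ by `2ε`, so the affinity of order `s` is `1 - 2 s(1-s) J ε²` to second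
order. Order `1/2` contributes `J/2`; the difference quotients tend to `2hJ` since `s(1-s)` drops by
`h²` at `1/2 ± h`, and half of that remains. -/
theorem alphaOne_le_of_ne_top (hf : IsShiftDensity f) (hJ : fisherInfo f ≠ ⊤) {g : ℝ → ℝ}
    (hg : ∀ x, g x = x ^ 2) (θ : ℝ) {h : ℝ} (h0 : 0 < h) (h1 : h < 1 / 2) :
    alphaOne volume (shiftFamily f) g θ ≤
      (((fisherInfo f).toReal / 2 + h * (fisherInfo f).toReal : ℝ) : EReal) := by
  have hh : (1 / 2 : ℝ) ∈ Set.Ioo (0 : ℝ) 1 := by norm_num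
  have hm : 1 / 2 - h ∈ Set.Ioo (0 : ℝ) 1 := ⟨by linarith, by linarith⟩
  have hp : 1 / 2 + h ∈ Set.Ioo (0 : ℝ) 1 := ⟨by linarith, by linarith⟩
  set J := (fisherInfo f).toReal with hJdef
  have h2 : Tendsto (fun ε : ℝ => 2 * ε) (𝓝[>] 0) (𝓝[>] 0) := by
    refine tendsto_nhdsWithin_of_tendsto_nhds_of_eventually_within _ ?_ ?_
    · exact tendsto_nhdsWithin_of_tendsto_nhds
        ((continuous_const_mul 2).tendsto' _ _ (mul_zero 2))
    · filter_upwards [self_mem_nhdsWithin] with ε hε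
      exact mul_pos two_pos (Set.mem_Ioi.1 hε)
  have hZ := (hf.tendsto_shiftAffinity hJ hh).comp h2
  have hw := fun {s : ℝ} (hs : s ∈ Set.Ioo (0 : ℝ) 1) =>
    (hf.tendsto_one_sub_shiftAffinity hJ hs).comp h2
  have hdiff : ∀ {s : ℝ}, s ∈ Set.Ioo (0 : ℝ) 1 → s * (1 - s) = 1 / 4 - h ^ 2 →
      Tendsto (fun ε => (shiftAffinity f s (2 * ε) - shiftAffinity f (1 / 2) (2 * ε)) /
        (h * shiftAffinity f (1 / 2) (2 * ε)) / ε ^ 2) (𝓝[>] 0) (𝓝 (2 * h * J)) := by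
    intro s hs hs'
    -- The factor `4` is `(2ε)²/ε²`.
    have h3 := (((hw hh).sub (hw hs)).const_mul 4).div (hZ.const_mul h) (by simpa using h0.ne')
    have e : 4 * (1 / 2 * (1 - 1 / 2) / 2 * J - s * (1 - s) / 2 * J) / (h * 1) = 2 * h * J := by
      rw [hs']
      field_simp
      ring
    rw [e] at h3
    refine h3.congr' ?_
    filter_upwards [self_mem_nhdsWithin] with ε hε
    have hε0 : ε ≠ 0 := ne_of_gt hε
    simp only [Pi.div_apply, Function.comp]
    rw [div_right_comm]
    congr 1
    field_simp
    ring
  have hlog : Tendsto (fun ε => (1 - shiftAffinity f (1 / 2) (2 * ε)) /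
      shiftAffinity f (1 / 2) (2 * ε) / ε ^ 2) (𝓝[>] 0) (𝓝 (J / 2)) := by
    have h3 := ((hw hh).const_mul 4).div hZ one_ne_zero
    have e : 4 * (1 / 2 * (1 - 1 / 2) / 2 * J) / 1 = J / 2 := by ring
    rw [e] at h3
    refine h3.congr' ?_
    filter_upwards [self_mem_nhdsWithin] with ε hε
    have hε0 : ε ≠ 0 := ne_of_gt hε
    simp only [Pi.div_apply, Function.comp]
    rw [div_right_comm]
    congr 1
    field_simp
    ring
  have hlim := hlog.add (((hdiff hm (by ring)).max (hdiff hp (by ring))).div_const 2)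
  have e : J / 2 + max (2 * h * J) (2 * h * J) / 2 = J / 2 + h * J := by
    rw [max_self]
    ring
  rw [e] at hlim
  rw [← (EReal.tendsto_coe.2 hlim).limsup_eq]
  refine limsup_le_limsup ?_
  filter_upwards [hZ.eventually (eventually_gt_nhds one_pos), self_mem_nhdsWithin] with ε hZε hε
  have hε2 : (0 : ℝ) < ε ^ 2 := pow_pos hε 2
  rw [max_div_div_right hε2.le, div_right_comm _ (ε ^ 2) (2 : ℝ), ← add_div, EReal.coe_div, hg]
  refine EReal.div_le_div_right_of_nonneg (by exact_mod_cast hε2.le) (iSup_le fun T => ?_)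
  refine (hf.localRate_le T θ hε h0 h1 hZε).trans ?_
  rw [EReal.coe_le_coe_iff]
  refine add_le_add_left ?_ _
  have := Real.one_sub_inv_le_log_of_pos hZε
  simp only [Function.comp] at this hZε
  rw [← one_div] at this
  rw [sub_div, div_self hZε.ne']
  linarith

theorem alphaOne_le (hf : IsShiftDensity f) {g : ℝ → ℝ} (hg : ∀ x, g x = x ^ 2) (θ : ℝ) :
    alphaOne volume (shiftFamily f) g θ ≤ ((fisherInfo f / 2 : ℝ≥0∞) : EReal) := by
  by_cases hJ : fisherInfo f = ⊤
  · rw [hJ, ENNReal.top_div_of_ne_top (by simp), EReal.coe_ennreal_top]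
    exact le_top
  have e : ((fisherInfo f / 2 : ℝ≥0∞) : EReal) = (((fisherInfo f).toReal / 2 : ℝ) : EReal) := by
    rw [← EReal.coe_ennreal_toReal (ENNReal.div_ne_top hJ (by simp)), ENNReal.toReal_div]
    rfl
  rw [e]
  have hlim : Tendsto (fun h : ℝ => (((fisherInfo f).toReal / 2 + h * (fisherInfo f).toReal : ℝ) :
      EReal)) (𝓝[>] 0) (𝓝 (((fisherInfo f).toReal / 2 : ℝ) : EReal)) := by
    refine EReal.tendsto_coe.2 (tendsto_nhdsWithin_of_tendsto_nhds ?_)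
    have hc : Continuous fun h : ℝ => (fisherInfo f).toReal / 2 + h * (fisherInfo f).toReal := by
      fun_prop
    exact hc.tendsto' _ _ (by ring)
  refine ge_of_tendsto hlim ?_
  filter_upwards [Ioo_mem_nhdsGT (by norm_num : (0 : ℝ) < 1 / 2)] with h hh
  exact hf.alphaOne_le_of_ne_top hJ hg θ hh.1 hh.2

theorem alphaTwo_eq (hf : IsShiftDensity f) {g : ℝ → ℝ} (hg : ∀ x, g x = x ^ 2) (θ : ℝ) :
    alphaTwo volume (shiftFamily f) g θ = ((fisherInfo f / 2 : ℝ≥0∞) : EReal) :=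
  le_antisymm ((alphaTwo_le_alphaOne hg θ).trans (hf.alphaOne_le hg θ))
    (hf.fisherInfo_div_two_le_alphaTwo hg θ)

theorem alphaOne_eq (hf : IsShiftDensity f) {g : ℝ → ℝ} (hg : ∀ x, g x = x ^ 2) (θ : ℝ) :
    alphaOne volume (shiftFamily f) g θ = ((fisherInfo f / 2 : ℝ≥0∞) : EReal) :=
  le_antisymm (hf.alphaOne_le hg θ)
    ((hf.fisherInfo_div_two_le_alphaTwo hg θ).trans (alphaTwo_le_alphaOne hg θ))

end IsShiftDensity

/-! ### Maximum likelihood for log-concave densities -/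

namespace IsShiftDensity

variable {f : ℝ → ℝ} {a b : ℝ}

theorem hasDerivAt_log (hf : IsShiftDensity f) {x : ℝ} (hx : x ∈ Function.support f) :
    HasDerivAt (fun y => Real.log (f y)) (deriv f x / f x) x :=
  (hf.hasDerivAt hx).log hx

theorem antitoneOn_logDeriv (hf : IsShiftDensity f)
    (hc : ConcaveOn ℝ (Function.support f) fun x => Real.log (f x)) :
    AntitoneOn (fun x => deriv f x / f x) (Function.support f) :=
  (hc.antitoneOn_deriv fun _ hx => (hf.hasDerivAt_log hx).differentiableAt).congr
    fun _ hx => (hf.hasDerivAt_log hx).deriv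

/-- A concave `log f` lies below its tangent line at `y`; off the support the left side is zero. -/
theorem mul_exp_le_of_concaveOn (hf : IsShiftDensity f)
    (hc : ConcaveOn ℝ (Function.support f) fun x => Real.log (f x)) {y : ℝ}
    (hy : y ∈ Function.support f) (τ : ℝ) :
    f (y + τ) * Real.exp (τ * -(deriv f y / f y)) ≤ f y := by
  by_cases hyτ : y + τ ∈ Function.support f
  swap
  · rw [Function.notMem_support.1 hyτ, zero_mul]
    exact hf.nonneg y
  have hlog : Real.log (f (y + τ)) ≤ Real.log (f y) + τ * (deriv f y / f y) := by
    rcases lt_trichotomy τ 0 with h | rfl | h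
    · have := hc.le_slope_of_hasDerivAt hyτ hy (by linarith) (hf.hasDerivAt_log hy)
      rw [slope_def_field, le_div_iff₀ (by linarith)] at this
      linarith
    · simp
    · have := hc.slope_le_of_hasDerivAt hy hyτ (by linarith) (hf.hasDerivAt_log hy)
      rw [slope_def_field, div_le_iff₀ (by linarith)] at this
      linarith
  have h1 := hf.pos hyτ
  have h2 := hf.pos hy
  calc f (y + τ) * Real.exp (τ * -(deriv f y / f y))
      = Real.exp (Real.log (f (y + τ)) + τ * -(deriv f y / f y)) := by
        rw [Real.exp_add, Real.exp_log h1]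
    _ ≤ Real.exp (Real.log (f y)) := Real.exp_le_exp.2 (by linarith)
    _ = f y := Real.exp_log h2

/-- For `c > 0` the superlevel set of `f` at `c` is an interval by concavity, and unit mass bounds
its length by `1/c`. -/
theorem tendsto_cocompact_of_concaveOn (hf : IsShiftDensity f)
    (hc : ConcaveOn ℝ (Function.support f) fun x => Real.log (f x)) :
    Tendsto f (cocompact ℝ) (𝓝 0) := by
  rw [Metric.tendsto_nhds]
  intro c hc0
  have hconv : ∀ x z, c ≤ f x → c ≤ f z → ∀ y ∈ Set.Icc x z, c ≤ f y := by
    intro x z hx hz y hy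
    have hxS : x ∈ Function.support f := (hc0.trans_le hx).ne'
    have hzS : z ∈ Function.support f := (hc0.trans_le hz).ne'
    have h := hc.min_le_of_mem_Icc hxS hzS hy
    have hyS := hf.ordConnected.out hxS hzS hy
    refine (Real.log_le_log_iff hc0 (hf.pos hyS)).1 (le_trans (le_min ?_ ?_) h)
    · exact Real.log_le_log hc0 hx
    · exact Real.log_le_log hc0 hz
  have hlen : ∀ x z, x ≤ z → c ≤ f x → c ≤ f z → z - x ≤ 1 / c := by
    intro x z hxz hx hz
    rw [le_div_iff₀ hc0]
    calc (z - x) * c = ∫ _ in x..z, c := by rw [intervalIntegral.integral_const, smul_eq_mul]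
      _ ≤ ∫ y in x..z, f y := intervalIntegral.integral_mono_on hxz intervalIntegrable_const
          (hf.continuous.intervalIntegrable _ _) (hconv x z hx hz)
      _ ≤ ∫ y, f y := by
          rw [intervalIntegral.integral_of_le hxz]
          exact setIntegral_le_integral hf.integrable (ae_of_all _ hf.nonneg)
      _ = 1 := hf.integral_eq_one
  by_cases hex : ∃ x₀, c ≤ f x₀
  · obtain ⟨x₀, hx₀⟩ := hex
    filter_upwards [(isCompact_closedBall x₀ (1 / c)).compl_mem_cocompact] with x hx
    rw [Real.dist_0_eq_abs, abs_of_nonneg (hf.nonneg x)]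
    by_contra hcx
    refine hx ?_
    rw [Metric.mem_closedBall, Real.dist_eq, abs_le']
    rcases le_total x₀ x with h | h
    · have := hlen x₀ x h hx₀ (not_lt.1 hcx)
      exact ⟨this, by linarith [one_div_pos.2 hc0]⟩
    · have := hlen x x₀ h (not_lt.1 hcx) hx₀
      exact ⟨by linarith [one_div_pos.2 hc0], by linarith⟩
  · push Not at hex
    refine Eventually.of_forall fun x => ?_
    rw [Real.dist_0_eq_abs, abs_of_nonneg (hf.nonneg x)]
    exact hex x

theorem exists_mode (hf : IsShiftDensity f)
    (hc : ConcaveOn ℝ (Function.support f) fun x => Real.log (f x)) :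
    ∃ x₀ ∈ Function.support f, deriv f x₀ = 0 := by
  obtain ⟨y, hy⟩ := hf.support_nonempty
  obtain ⟨x₀, hx₀⟩ := hf.continuous.exists_forall_ge' y
    (((hf.tendsto_cocompact_of_concaveOn hc).eventually
      (eventually_lt_nhds (hf.pos hy))).mono fun _ h => h.le)
  exact ⟨x₀, ((hf.pos hy).trans_le (hx₀ y)).ne',
    IsLocalMax.deriv_eq_zero (Eventually.of_forall hx₀)⟩

/-- Controls the boundary terms that appear when the window `[a, b]` is shifted by `τ`. -/
theorem exists_integral_shift_expansion (hf : IsShiftDensity f) {x : ℝ}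
    (hx : x ∈ Function.support f) {δ : ℝ} (hδ : 0 < δ) :
    ∃ τ₀ > 0, ∀ τ, |τ| ≤ τ₀ →
      |(∫ t in x..x + τ, f t) - τ * f x - τ ^ 2 / 2 * deriv f x| ≤ δ * τ ^ 2 := by
  obtain ⟨τ₀, hτ₀, h⟩ := hf.exists_uniform_expansion (isCompact_singleton (x := x))
    (Set.singleton_subset_iff.2 hx) hδ
  refine ⟨τ₀, hτ₀, fun τ hτ => ?_⟩
  have hc : Continuous fun r => f (x + r) := hf.continuous.comp (continuous_const_add x)
  have e : (∫ t in x..x + τ, f t) - τ * f x - τ ^ 2 / 2 * deriv f x =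
      ∫ r in (0 : ℝ)..τ, (f (x + r) - f x - r * deriv f x) := by
    rw [intervalIntegral.integral_sub (f := fun r => f (x + r) - f x)
      (g := fun r => r * deriv f x) ((hc.sub continuous_const).intervalIntegrable _ _)
      ((continuous_id.mul continuous_const).intervalIntegrable _ _),
      intervalIntegral.integral_sub (hc.intervalIntegrable _ _) intervalIntegrable_const,
      intervalIntegral.integral_const, intervalIntegral.integral_mul_const, integral_id,
      intervalIntegral.integral_comp_add_left (fun t => f t), add_zero]
    simp
  rw [e, ← Real.norm_eq_abs]
  refine (intervalIntegral.norm_integral_le_of_norm_le_const (C := δ * |τ|)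
    fun r hr => ?_).trans_eq ?_
  · have hr' : |r| ≤ |τ| := by
      have := Set.abs_sub_left_of_mem_uIcc (Set.uIoc_subset_uIcc hr)
      simpa using this
    exact ((h r (hr'.trans hτ) x rfl).2).trans (mul_le_mul_of_nonneg_left hr' hδ.le)
  · rw [sub_zero, mul_assoc, abs_mul_abs_self, sq]

theorem integral_truncScore_mul (hf : IsShiftDensity f) (hab : a ≤ b)
    (hK : Set.Icc a b ⊆ Function.support f) :
    ∫ y, truncScore f a b y * f y = f a - f b := by
  have h1 : ∫ y in a..b, deriv f y = f b - f a := by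
    refine intervalIntegral.integral_eq_sub_of_hasDerivAt (fun x hx => hf.hasDerivAt (hK ?_)) ?_
    · rwa [Set.uIcc_of_le hab] at hx
    · refine ContinuousOn.intervalIntegrable ?_
      rw [Set.uIcc_of_le hab]
      exact hf.continuousOn_deriv.mono hK
  rw [intervalIntegral.integral_of_le hab, ← integral_Icc_eq_integral_Ioc] at h1
  rw [← neg_sub (f b), ← h1, ← integral_neg, ← integral_indicator measurableSet_Icc]
  refine integral_congr_ae (ae_of_all _ fun y => ?_)
  by_cases hy : y ∈ Set.Icc a b
  · have : f y ≠ 0 := hK hy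
    simp only [truncScore, Set.indicator_of_mem hy]
    field_simp
  · simp only [truncScore, Set.indicator_of_notMem hy, zero_mul]

/-- Shifting the window contributes `τ (f b - f a)`, which the mean `f a - f b` of the cut-off score
cancels. At second order the score gives `-J + J/2` and the boundary gives `(f' b - f' a)/2 ≤ 0` by
the sign conditions, which hold when `[a, b]` contains the mode. -/
theorem exists_setIntegral_exp_score_le (hf : IsShiftDensity f) (hab : a ≤ b)
    (hK : Set.Icc a b ⊆ Function.support f) (ha : 0 ≤ deriv f a) (hb : deriv f b ≤ 0) {c : ℝ}
    (hc : c < fisherOn f a b / 2) :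
    ∃ τ₀ > 0, ∀ τ, |τ| ≤ τ₀ →
      ∫ y in Set.Icc a b, f (y + τ) * Real.exp (τ * truncScore f a b y) ≤
        (∫ y in Set.Icc a b, f y) - c * τ ^ 2 := by
  obtain ⟨M, hM0, hM⟩ := hf.exists_abs_truncScore_le hK
  obtain ⟨d, hd⟩ : ∃ d, d = fisherOn f a b / 2 - c := ⟨_, rfl⟩
  have hd0 : 0 < d := by linarith
  obtain ⟨δ, hδ⟩ : ∃ δ, δ = d / 5 := ⟨_, rfl⟩
  have hδ0 : 0 < δ := by linarith
  obtain ⟨η₀, hη₀, hmom⟩ := hf.exists_truncScore_moments hK hδ0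
  obtain ⟨τ₁, hτ₁, h₁⟩ := hf.exists_integral_shift_expansion (hK ⟨le_rfl, hab⟩) hδ0
  obtain ⟨τ₂, hτ₂, h₂⟩ := hf.exists_integral_shift_expansion (hK ⟨hab, le_rfl⟩) hδ0
  refine ⟨min (min η₀ (min τ₁ τ₂)) (min (1 / (M + 1)) (δ / (2 * (M ^ 3 + 1)))), by positivity,
    fun τ hτ => ?_⟩
  have hτη : |τ| ≤ η₀ := hτ.trans ((min_le_left _ _).trans (min_le_left _ _))
  have hτ1 : |τ| ≤ τ₁ :=
    hτ.trans ((min_le_left _ _).trans ((min_le_right _ _).trans (min_le_left _ _)))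
  have hτ2 : |τ| ≤ τ₂ :=
    hτ.trans ((min_le_left _ _).trans ((min_le_right _ _).trans (min_le_right _ _)))
  have hτM : |τ| * (M + 1) ≤ 1 := by
    rw [← le_div_iff₀ (by positivity)]
    exact hτ.trans ((min_le_right _ _).trans (min_le_left _ _))
  have hτδ : |τ| * (2 * (M ^ 3 + 1)) ≤ δ := by
    rw [← le_div_iff₀ (by positivity)]
    exact hτ.trans ((min_le_right _ _).trans (min_le_right _ _))
  obtain ⟨hE1, hE2⟩ := hmom (-τ) (by rwa [abs_neg])
  rw [abs_neg] at hE1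
  simp only [sub_neg_eq_add] at hE1 hE2
  rw [hf.integral_truncScore_mul hab hK] at hE1
  have hi := fun k => hf.integrable_pow_truncScore_mul hK k (-τ)
  simp only [sub_neg_eq_add] at hi
  have i0 : Integrable fun y => f (y + τ) := hf.integrable.comp_add_right τ
  have i1 : Integrable fun y => truncScore f a b y * f (y + τ) := by simpa using hi 1
  have i2 := hi 2
  have hzero : ∀ y ∉ Set.Icc a b, truncScore f a b y = 0 := fun y hy =>
    Set.indicator_of_notMem hy _
  have hset1 : ∫ y in Set.Icc a b, truncScore f a b y * f (y + τ) =
      ∫ y, truncScore f a b y * f (y + τ) :=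
    setIntegral_eq_integral_of_forall_compl_eq_zero fun y hy => by rw [hzero y hy, zero_mul]
  have hset2 : ∫ y in Set.Icc a b, truncScore f a b y ^ 2 * f (y + τ) =
      ∫ y, truncScore f a b y ^ 2 * f (y + τ) :=
    setIntegral_eq_integral_of_forall_compl_eq_zero fun y hy => by
      rw [hzero y hy, zero_pow two_ne_zero, zero_mul]
  have hshift : ∫ y in Set.Icc a b, f (y + τ) = (∫ y in Set.Icc a b, f y) +
      ((∫ t in b..b + τ, f t) - ∫ t in a..a + τ, f t) := by
    rw [integral_Icc_eq_integral_Ioc, integral_Icc_eq_integral_Ioc,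
      ← intervalIntegral.integral_of_le hab, ← intervalIntegral.integral_of_le hab,
      intervalIntegral.integral_comp_add_right (fun t => f t)]
    have hI := fun u v => hf.continuous.intervalIntegrable (μ := volume) u v
    have e1 := intervalIntegral.integral_add_adjacent_intervals (hI a (a + τ)) (hI (a + τ) (b + τ))
    have e2 := intervalIntegral.integral_add_adjacent_intervals (hI a b) (hI b (b + τ))
    linarith
  have hmass : ∫ y in Set.Icc a b, f (y + τ) ≤ 1 := by
    refine (setIntegral_le_integral i0 (ae_of_all _ fun y => hf.nonneg _)).trans_eq ?_
    rw [integral_add_right_eq_self f τ, hf.integral_eq_one]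
  have hpt : ∀ y, f (y + τ) * Real.exp (τ * truncScore f a b y) ≤
      (1 + M ^ 3 * |τ| ^ 3) * f (y + τ) + τ * (truncScore f a b y * f (y + τ)) +
        τ ^ 2 / 2 * (truncScore f a b y ^ 2 * f (y + τ)) := by
    intro y
    have hu : |τ * truncScore f a b y| ≤ |τ| * M := by
      rw [abs_mul]
      exact mul_le_mul_of_nonneg_left (hM y) (abs_nonneg _)
    have hexp := Real.exp_le_quadratic_add_cube (hu.trans (by linarith [abs_nonneg τ]))
    have hcube := pow_le_pow_left₀ (abs_nonneg _) hu 3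
    rw [mul_pow |τ|] at hcube
    have := mul_le_mul_of_nonneg_left (hexp.trans (add_le_add_right hcube _)) (hf.nonneg (y + τ))
    refine this.trans_eq ?_
    ring
  have iall : IntegrableOn (fun y => (1 + M ^ 3 * |τ| ^ 3) * f (y + τ) +
      τ * (truncScore f a b y * f (y + τ)) +
        τ ^ 2 / 2 * (truncScore f a b y ^ 2 * f (y + τ))) (Set.Icc a b) :=
    (((i0.const_mul _).add (i1.const_mul _)).add (i2.const_mul _)).integrableOn
  have hI : ∫ y in Set.Icc a b, ((1 + M ^ 3 * |τ| ^ 3) * f (y + τ) +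
      τ * (truncScore f a b y * f (y + τ)) +
        τ ^ 2 / 2 * (truncScore f a b y ^ 2 * f (y + τ))) =
      (1 + M ^ 3 * |τ| ^ 3) * (∫ y in Set.Icc a b, f (y + τ)) +
        τ * (∫ y, truncScore f a b y * f (y + τ)) +
        τ ^ 2 / 2 * ∫ y, truncScore f a b y ^ 2 * f (y + τ) := by
    refine (integral_add ((i0.const_mul _).add (i1.const_mul _)).integrableOn
      (i2.const_mul _).integrableOn).trans ?_
    rw [integral_const_mul, hset2]
    congr 1
    refine (integral_add (i0.const_mul _).integrableOn (i1.const_mul _).integrableOn).trans ?_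
    rw [integral_const_mul, integral_const_mul, hset1]
  have hmain : ∫ y in Set.Icc a b, f (y + τ) * Real.exp (τ * truncScore f a b y) ≤
      (1 + M ^ 3 * |τ| ^ 3) * (∫ y in Set.Icc a b, f (y + τ)) +
        τ * (∫ y, truncScore f a b y * f (y + τ)) +
        τ ^ 2 / 2 * ∫ y, truncScore f a b y ^ 2 * f (y + τ) := by
    rw [← hI]
    exact integral_mono_of_nonneg (ae_of_all _ fun y =>
      mul_nonneg (hf.nonneg _) (Real.exp_nonneg _)) iall (ae_of_all _ hpt)
  refine hmain.trans ?_
  have hA := (abs_le.1 (h₁ τ hτ1)).1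
  have hB := (abs_le.1 (h₂ τ hτ2)).2
  have hτsq : |τ| ^ 2 = τ ^ 2 := sq_abs τ
  have ta : 0 ≤ τ ^ 2 / 2 * deriv f a := mul_nonneg (by positivity) ha
  have tb : τ ^ 2 / 2 * deriv f b ≤ 0 := mul_nonpos_of_nonneg_of_nonpos (by positivity) hb
  have t1 : M ^ 3 * |τ| ^ 3 * (∫ y in Set.Icc a b, f (y + τ)) ≤ M ^ 3 * |τ| ^ 3 :=
    mul_le_of_le_one_right (by positivity) hmass
  have t2 : τ ^ 2 * (|τ| * (2 * (M ^ 3 + 1))) ≤ τ ^ 2 * δ :=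
    mul_le_mul_of_nonneg_left hτδ (sq_nonneg _)
  have t2' : |τ| ^ 3 = τ ^ 2 * |τ| := by rw [← hτsq]; ring
  have t3 : τ ^ 2 / 2 * (∫ y, truncScore f a b y ^ 2 * f (y + τ)) ≤
      τ ^ 2 / 2 * (fisherOn f a b + δ) := mul_le_mul_of_nonneg_left hE2 (by positivity)
  have t4 : τ * ((∫ y, truncScore f a b y * f (y + τ)) - (f a - f b) - -τ * fisherOn f a b) ≤
      δ * τ ^ 2 := by
    refine (le_abs_self _).trans ?_
    rw [abs_mul]
    refine (mul_le_mul_of_nonneg_left hE1 (abs_nonneg _)).trans_eq ?_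
    rw [← hτsq]
    ring
  have t5 : 0 ≤ τ ^ 2 * |τ| := by positivity
  have t6 : 0 ≤ τ ^ 2 * δ := by positivity
  rw [t2'] at t1 ⊢
  rw [hshift] at t1 ⊢
  -- The errors from both boundary expansions, the two moments and the cubic remainder fit within `5
  -- δ τ²`.
  have hc' : c = fisherOn f a b / 2 - 5 * δ := by linarith
  rw [hc']
  linarith

/-- The exponential moment of the score governing maximum likelihood estimation. -/
theorem exists_lintegral_exp_score_le (hf : IsShiftDensity f)
    (hc : ConcaveOn ℝ (Function.support f) fun x => Real.log (f x)) (hab : a ≤ b)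
    (hK : Set.Icc a b ⊆ Function.support f) (ha : 0 ≤ deriv f a) (hb : deriv f b ≤ 0) {c : ℝ}
    (hcJ : c < fisherOn f a b / 2) :
    ∃ τ₀ > 0, ∀ τ, |τ| ≤ τ₀ → ∫⁻ y in Function.support f, ENNReal.ofReal (f (y + τ)) *
      ENNReal.ofReal (Real.exp (τ * -(deriv f y / f y))) ≤
        ENNReal.ofReal (Real.exp (-(c * τ ^ 2))) := by
  obtain ⟨τ₀, hτ₀, h⟩ := hf.exists_setIntegral_exp_score_le hab hK ha hb hcJ
  refine ⟨τ₀, hτ₀, fun τ hτ => ?_⟩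
  have hm := hf.measurable_truncScore a b
  obtain ⟨M, hM0, hM⟩ := hf.exists_abs_truncScore_le hK
  have i0 : Integrable fun y => f (y + τ) := hf.integrable.comp_add_right τ
  have i1 : Integrable fun y => f (y + τ) * Real.exp (τ * truncScore f a b y) := by
    refine i0.mul_bdd (c := Real.exp (|τ| * M)) (by fun_prop) (ae_of_all _ fun y => ?_)
    rw [Real.norm_of_nonneg (Real.exp_nonneg _)]
    refine Real.exp_le_exp.2 ((le_abs_self _).trans ?_)
    rw [abs_mul]
    exact mul_le_mul_of_nonneg_left (hM y) (abs_nonneg _)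
  -- The integrand on the support is at most `f + G`: equality on `[a, b]`, the tangent line bound
  -- outside. The whole gain is thus produced on `[a, b]`.
  set G : ℝ → ℝ := (Set.Icc a b).indicator
    (fun y => f (y + τ) * Real.exp (τ * truncScore f a b y) - f y) with hG
  have iG : Integrable G := (i1.sub hf.integrable).indicator measurableSet_Icc
  have hle : ∀ y ∈ Function.support f, ENNReal.ofReal (f (y + τ)) *
      ENNReal.ofReal (Real.exp (τ * -(deriv f y / f y))) ≤ ENNReal.ofReal (f y + G y) := by
    intro y hy
    rw [← ENNReal.ofReal_mul (hf.nonneg _)]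
    refine ENNReal.ofReal_le_ofReal ?_
    by_cases hyK : y ∈ Set.Icc a b
    · rw [hG, Set.indicator_of_mem hyK, truncScore, Set.indicator_of_mem hyK, add_sub_cancel]
    · rw [hG, Set.indicator_of_notMem hyK, add_zero]
      exact hf.mul_exp_le_of_concaveOn hc hy τ
  have hnn : ∀ y, 0 ≤ f y + G y := by
    intro y
    by_cases hyK : y ∈ Set.Icc a b
    · rw [hG, Set.indicator_of_mem hyK, add_sub_cancel]
      exact mul_nonneg (hf.nonneg _) (Real.exp_nonneg _)
    · rw [hG, Set.indicator_of_notMem hyK, add_zero]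
      exact hf.nonneg y
  calc ∫⁻ y in Function.support f, ENNReal.ofReal (f (y + τ)) *
        ENNReal.ofReal (Real.exp (τ * -(deriv f y / f y)))
      ≤ ∫⁻ y in Function.support f, ENNReal.ofReal (f y + G y) :=
        setLIntegral_mono' hf.isOpen_support.measurableSet hle
    _ ≤ ∫⁻ y, ENNReal.ofReal (f y + G y) := setLIntegral_le_lintegral _ _
    _ = ENNReal.ofReal (∫ y, (f y + G y)) :=
        (ofReal_integral_eq_lintegral_ofReal (hf.integrable.add iG) (ae_of_all _ hnn)).symm
    _ ≤ _ := by
        refine ENNReal.ofReal_le_ofReal ?_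
        rw [integral_add hf.integrable iG, hf.integral_eq_one, hG,
          integral_indicator measurableSet_Icc,
          integral_sub i1.integrableOn hf.integrable.integrableOn]
        have := h τ hτ
        have h2 := Real.add_one_le_exp (-(c * τ ^ 2))
        linarith

/-- The likelihood is positive at `θ`, hence at the maximizer `t`, so all residuals at `t` lie in
the open support and `t` is an interior critical point of the log-likelihood. -/
theorem mle_score_eq_zero (hf : IsShiftDensity f) {n : ℕ} {x : Fin n → ℝ} {t θ : ℝ}
    (ht : ∀ θ, ∏ i, shiftFamily f θ (x i) ≤ ∏ i, shiftFamily f t (x i))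
    (hx : ∀ i, x i - θ ∈ Function.support f) :
    (∀ i, x i - t ∈ Function.support f) ∧ ∑ i, deriv f (x i - t) / f (x i - t) = 0 := by
  have hpos : 0 < ∏ i, shiftFamily f t (x i) :=
    (Finset.prod_pos fun i _ => hf.pos (hx i)).trans_le (ht θ)
  have hS : ∀ i, x i - t ∈ Function.support f := fun i h0 =>
    hpos.ne' (Finset.prod_eq_zero (Finset.mem_univ i) h0)
  refine ⟨hS, ?_⟩
  have hd : HasDerivAt (fun s => ∑ i, Real.log (f (x i - s)))
      (∑ i, -(deriv f (x i - t) / f (x i - t))) t := by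
    refine HasDerivAt.fun_sum fun i _ => ?_
    have := (hf.hasDerivAt_log (hS i)).comp t ((hasDerivAt_id t).const_sub (x i))
    exact this.congr_deriv (by ring)
  have hmax : IsLocalMax (fun s => ∑ i, Real.log (f (x i - s))) t := by
    have hev : ∀ᶠ s in 𝓝 t, ∀ i, x i - s ∈ Function.support f := by
      refine eventually_all.2 fun i => ?_
      exact (continuous_sub_left (x i)).continuousAt.eventually
        (hf.isOpen_support.eventually_mem (hS i))
    filter_upwards [hev] with s hs
    rw [← Real.log_prod fun i _ => hs i, ← Real.log_prod fun i _ => hS i]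
    exact Real.log_le_log (Finset.prod_pos fun i _ => hf.pos (hs i)) (ht s)
  have := hmax.hasDerivAt_eq_zero hd
  rwa [Finset.sum_neg_distrib, neg_eq_zero] at this

theorem fisherOn_div_two_le_alphaTwoOf_mle (hf : IsShiftDensity f)
    (hc : ConcaveOn ℝ (Function.support f) fun x => Real.log (f x)) (hab : a ≤ b)
    (hK : Set.Icc a b ⊆ Function.support f) (ha : 0 ≤ deriv f a) (hb : deriv f b ≤ 0)
    {g : ℝ → ℝ} (hg : ∀ x, g x = x ^ 2) {T : Estimator ℝ} (hT : IsMLE (shiftFamily f) T)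
    (θ : ℝ) :
    ((fisherOn f a b / 2 : ℝ) : EReal) ≤ alphaTwoOf volume (shiftFamily f) g T θ := by
  refine EReal.ge_of_forall_gt_iff_ge.1 fun c hcJ => ?_
  have hcJ' : c < fisherOn f a b / 2 := by exact_mod_cast hcJ
  obtain ⟨τ₀, hτ₀, h⟩ := hf.exists_lintegral_exp_score_le hc hab hK ha hb hcJ'
  refine le_alphaTwoOf hg ?_
  filter_upwards [Ioc_mem_nhdsGT hτ₀] with ε hε θ' hθ' n
  have hP := hf.isProbabilityMeasure_shiftLaw θ'
  have hanti := hf.antitoneOn_logDeriv hc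
  -- The score is evaluated at parameter `θ' + τ` and tilted by `τ` itself, with `τ = ±ε`.
  let φ : ℝ → ℝ → ℝ≥0∞ := fun τ x => (Function.support f).indicator
    (fun y => ENNReal.ofReal (Real.exp (τ * -(deriv f y / f y)))) (x - θ' - τ)
  have hfm := hf.continuous.measurable
  have hdm := measurable_deriv f
  have hφm : ∀ τ, Measurable (φ τ) := by
    intro τ
    have h1 : Measurable ((Function.support f).indicator
        (fun y => ENNReal.ofReal (Real.exp (τ * -(deriv f y / f y))))) :=
      Measurable.indicator (by fun_prop) hf.isOpen_support.measurableSet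
    exact h1.comp ((measurable_id.sub_const θ').sub_const τ)
  have hφ : ∀ τ, |τ| = ε → ∫⁻ x, φ τ x ∂shiftLaw f θ' ≤
      ENNReal.ofReal (Real.exp (-(c * ε ^ 2))) := by
    intro τ hτ
    have h1 := h τ (hτ.trans_le hε.2)
    rw [← sq_abs, hτ] at h1
    refine le_trans (le_of_eq ?_) h1
    rw [hf.lintegral_shiftLaw θ' (hφm τ), ← lintegral_add_right_eq_self _ τ,
      ← lintegral_indicator hf.isOpen_support.measurableSet]
    refine lintegral_congr fun y => ?_
    simp only [φ]
    rw [show y + τ + θ' - θ' - τ = y by ring]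
    by_cases hy : y ∈ Function.support f
    · rw [Set.indicator_of_mem hy, Set.indicator_of_mem hy]
    · rw [Set.indicator_of_notMem hy, Set.indicator_of_notMem hy, mul_zero]
  have hprod : ∀ (τ : ℝ) (x : Fin n → ℝ), (∀ i, x i - θ' - τ ∈ Function.support f) →
      0 ≤ τ * -∑ i, deriv f (x i - θ' - τ) / f (x i - θ' - τ) → 1 ≤ ∏ i, φ τ (x i) := by
    intro τ x hx hs
    have e : ∀ i, φ τ (x i) = ENNReal.ofReal (Real.exp
        (τ * -(deriv f (x i - θ' - τ) / f (x i - θ' - τ)))) := fun i =>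
      Set.indicator_of_mem (hx i) _
    simp_rw [e]
    rw [← ENNReal.ofReal_prod_of_nonneg fun i _ => Real.exp_nonneg _, ← Real.exp_sum,
      ENNReal.one_le_ofReal, Real.one_le_exp_iff, ← Finset.mul_sum, Finset.sum_neg_distrib]
    exact hs
  have hε0 := hε.1
  rw [iidLaw_shiftFamily]
  refine pi_le_two_mul_of_chernoff _ n (hφm ε) (hφm (-ε)) (hφ ε (abs_of_pos hε0))
    (hφ (-ε) (by rw [abs_neg, abs_of_pos hε0])) ?_
  filter_upwards [hf.ae_mem_support θ' n] with x hxS hxE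
  obtain ⟨hTS, hT0⟩ := hf.mle_score_eq_zero (hT n x) hxS
  have hxE' : ε ≤ |T.toFun n x - θ'| := hxE
  rw [le_abs] at hxE'
  rcases hxE' with hx' | hx'
  · left
    -- These residuals lie between those at the estimate and those at `θ'`, both in the support. The
    -- score sum vanishes at the estimate, so monotonicity fixes its sign here.
    have hmem : ∀ i, x i - θ' - ε ∈ Function.support f := fun i =>
      hf.ordConnected.out (hTS i) (hxS i) ⟨by linarith, by linarith⟩
    refine hprod ε x hmem (mul_nonneg hε0.le (neg_nonneg.2 ?_))
    rw [← hT0]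
    exact Finset.sum_le_sum fun i _ => hanti (hTS i) (hmem i) (by linarith)
  · right
    have hmem : ∀ i, x i - θ' - -ε ∈ Function.support f := fun i =>
      hf.ordConnected.out (hxS i) (hTS i) ⟨by linarith, by linarith⟩
    refine hprod (-ε) x hmem ?_
    rw [neg_mul_neg]
    refine mul_nonneg hε0.le ?_
    rw [← hT0]
    exact Finset.sum_le_sum fun i _ => hanti (hmem i) (hTS i) (by linarith)

theorem fisherInfo_div_two_le_alphaTwoOf_mle (hf : IsShiftDensity f)
    (hc : ConcaveOn ℝ (Function.support f) fun x => Real.log (f x)) {g : ℝ → ℝ}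
    (hg : ∀ x, g x = x ^ 2) {T : Estimator ℝ} (hT : IsMLE (shiftFamily f) T) (θ : ℝ) :
    ((fisherInfo f / 2 : ℝ≥0∞) : EReal) ≤ alphaTwoOf volume (shiftFamily f) g T θ := by
  have hP := hf.isProbabilityMeasure_iidLaw
  obtain ⟨x₀, hx₀, hmode⟩ := hf.exists_mode hc
  refine le_of_forall_lt fun r hr => ?_
  rcases lt_or_ge r 0 with hr0 | hr0
  · exact hr0.trans_le (alphaTwoOf_nonneg T hg θ)
  lift r to ℝ≥0∞ using hr0
  rw [EReal.coe_ennreal_lt_coe_ennreal_iff, ENNReal.lt_div_iff_mul_lt (by simp) (by simp)] at hr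
  obtain ⟨a, b, hax, hxb, hK, hJ⟩ := hf.exists_Icc_lt_setIntegral_fisher hx₀ hr
  change r * 2 < ENNReal.ofReal (fisherOn f a b) at hJ
  have hpos : 0 < fisherOn f a b := ENNReal.ofReal_pos.1 (zero_le.trans_lt hJ)
  have hab := hax.trans hxb
  have haS := hK ⟨le_rfl, hab⟩
  have hbS := hK ⟨hab, le_rfl⟩
  have hanti := hf.antitoneOn_logDeriv hc
  have ha : 0 ≤ deriv f a := by
    have := hanti haS hx₀ hax
    simp only [hmode, zero_div] at this
    rwa [le_div_iff₀ (hf.pos haS), zero_mul] at this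
  have hb : deriv f b ≤ 0 := by
    have := hanti hx₀ hbS hxb
    simp only [hmode, zero_div] at this
    rwa [div_le_iff₀ (hf.pos hbS), zero_mul] at this
  refine lt_of_lt_of_le ?_ (hf.fisherOn_div_two_le_alphaTwoOf_mle hc hab hK ha hb hg hT θ)
  rw [← ENNReal.lt_div_iff_mul_lt (by simp) (by simp)] at hJ
  have e : ((fisherOn f a b / 2 : ℝ) : EReal) =
      ((ENNReal.ofReal (fisherOn f a b) / 2 : ℝ≥0∞) : EReal) := by
    have h2 : (2 : ℝ≥0∞) = ENNReal.ofReal 2 := by simp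
    rw [h2, ← ENNReal.ofReal_div_of_pos two_pos, EReal.coe_ennreal_ofReal,
      max_eq_left (by positivity)]
  rw [e, EReal.coe_ennreal_lt_coe_ennreal_iff]
  exact hJ

/-- The limsup of any one estimator is at most `α₁`, which equals the lower bound for its liminf, so
the limit exists. -/
theorem mle_attains (hf : IsShiftDensity f)
    (hc : ConcaveOn ℝ (Function.support f) fun x => Real.log (f x)) {g : ℝ → ℝ}
    (hg : ∀ x, g x = x ^ 2) {T : Estimator ℝ} (hT : IsMLE (shiftFamily f) T) (θ : ℝ) :
    alphaTwoOf volume (shiftFamily f) g T θ = ((fisherInfo f / 2 : ℝ≥0∞) : EReal) ∧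
    Tendsto (fun ε : ℝ => localRate volume (shiftFamily f) T θ ε / ((g ε : ℝ) : EReal))
      (𝓝[>] 0) (𝓝 ((fisherInfo f / 2 : ℝ≥0∞) : EReal)) := by
  have hlow := hf.fisherInfo_div_two_le_alphaTwoOf_mle hc hg hT θ
  refine ⟨le_antisymm ?_ hlow, tendsto_of_le_liminf_of_limsup_le hlow ?_⟩
  · rw [← hf.alphaTwo_eq hg θ]
    exact le_iSup (fun T => alphaTwoOf volume (shiftFamily f) g T θ) T
  · rw [← hf.alphaOne_eq hg θ]
    refine limsup_le_limsup (Eventually.of_forall fun ε => ?_)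
    refine EReal.div_le_div_right_of_nonneg ?_
      (le_iSup (fun T => localRate volume (shiftFamily f) T θ ε) T)
    rw [hg]
    exact_mod_cast sq_nonneg ε

end IsShiftDensity

/-! ### Existence of a measurable maximum likelihood estimator -/

/-- For a continuous family of functions vanishing at infinity, `c ≤ t` separates the least
maximizer `c` through countably many inequalities. -/
theorem exists_isMaxOn_le_iff {L : ℝ → ℝ} (hL : Continuous L) (h0 : Tendsto L (cocompact ℝ) (𝓝 0))
    (hpos : ∃ θ, 0 < L θ) (t : ℝ) :
    (∃ θ ≤ t, ∀ θ', L θ' ≤ L θ) ↔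
      ∀ (q : ℚ) (m : ℕ), ∃ r : ℚ, (r : ℝ) < t ∧ L q < L r + 1 / (m + 1) := by
  constructor
  · rintro ⟨θ, hθt, hθ⟩ q m
    have hm : (0 : ℝ) < 1 / (m + 1) := by positivity
    have hev : ∀ᶠ s in 𝓝 θ, L θ < L s + 1 / (m + 1) := by
      have := hL.continuousAt.eventually (eventually_gt_nhds (sub_lt_self (L θ) hm))
      filter_upwards [this] with s hs
      linarith
    -- The rational is taken to the left of `θ`, since `θ = t` is allowed while `r < t` is strict.
    obtain ⟨u, hu, hev⟩ := exists_Ioc_subset_of_mem_nhds hev ⟨θ - 1, by linarith⟩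
    obtain ⟨r, hr1, hr2⟩ := exists_rat_btwn hu
    exact ⟨r, hr2.trans_le hθt, (hθ q).trans_lt (hev ⟨hr1, hr2.le⟩)⟩
  · intro h
    have hdense : ∀ {C : ℝ}, (∀ q : ℚ, L q ≤ C) → ∀ θ, L θ ≤ C := fun {C} hC θ =>
      (Rat.denseRange_cast (𝕜 := ℝ)).induction_on θ (isClosed_le hL continuous_const) hC
    obtain ⟨θ₀, hθ₀⟩ := hpos
    obtain ⟨q₀, hq₀⟩ : ∃ q : ℚ, 0 < L q := by
      by_contra! hcon
      exact hθ₀.not_ge (hdense hcon θ₀)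
    obtain ⟨m, hm⟩ := exists_nat_one_div_lt hq₀
    obtain ⟨r₀, hr₀, hlt⟩ := h q₀ m
    have hr₀pos : 0 < L r₀ := by linarith
    -- `L` has a positive value left of `t` and vanishes at infinity, so it attains its maximum over
    -- the half line; the criterion makes that maximum global.
    obtain ⟨θ, hθt, hθ⟩ := hL.continuousOn.exists_isMaxOn' (s := Set.Iic t) isClosed_Iic
      (x₀ := (r₀ : ℝ)) hr₀.le (((h0.eventually (eventually_lt_nhds hr₀pos)).mono
        fun _ h => h.le).filter_mono inf_le_left)
    refine ⟨θ, hθt, hdense fun q => ?_⟩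
    refine le_of_forall_pos_lt_add fun δ hδ => ?_
    obtain ⟨m, hm⟩ := exists_nat_one_div_lt hδ
    obtain ⟨r, hr, hlt⟩ := h q m
    have := hθ (show (r : ℝ) ∈ Set.Iic t from hr.le)
    simp only [Set.mem_ofPred_eq] at this
    linarith

open Classical in
/-- The least maximizer of a function on the line, and `0` for a nonpositive function. -/
noncomputable def leastMaximizer (L : ℝ → ℝ) : ℝ :=
  if ∃ θ, 0 < L θ then sInf {θ | ∀ θ', L θ' ≤ L θ} else 0

theorem isLeast_leastMaximizer {L : ℝ → ℝ} (hL : Continuous L)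
    (h0 : Tendsto L (cocompact ℝ) (𝓝 0)) (hpos : ∃ θ, 0 < L θ) :
    IsLeast {θ | ∀ θ', L θ' ≤ L θ} (leastMaximizer L) := by
  rw [leastMaximizer, if_pos hpos]
  obtain ⟨θ₀, hθ₀⟩ := hpos
  have hev := h0.eventually (eventually_lt_nhds hθ₀)
  obtain ⟨θ₁, hθ₁⟩ := hL.exists_forall_ge' θ₀ (hev.mono fun _ h => h.le)
  obtain ⟨K, hK, hKsub⟩ := mem_cocompact.1 hev
  have hclosed : IsClosed {θ | ∀ θ', L θ' ≤ L θ} := by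
    simp only [Set.ofPred_forall]
    exact isClosed_iInter fun θ' => isClosed_le continuous_const hL
  have hsub : {θ | ∀ θ', L θ' ≤ L θ} ⊆ K := fun θ hθ => by
    by_contra hn
    exact (hθ θ₀).not_gt (hKsub hn)
  have hcomp := hK.of_isClosed_subset hclosed hsub
  exact hcomp.isLeast_sInf ⟨θ₁, hθ₁⟩

/-- Where `L x` takes a positive value, `exists_isMaxOn_le_iff` describes the sublevel sets through
rational parameters, hence by countable operations. -/
theorem measurable_leastMaximizer {α : Type*} [MeasurableSpace α] {L : α → ℝ → ℝ}
    (hm : ∀ θ, Measurable fun x => L x θ) (hL : ∀ x, Continuous (L x))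
    (h0 : ∀ x, Tendsto (L x) (cocompact ℝ) (𝓝 0)) :
    Measurable fun x => leastMaximizer (L x) := by
  have hP : {x | ∃ θ, 0 < L x θ} = ⋃ q : ℚ, {x | 0 < L x q} := by
    ext x
    simp only [Set.mem_ofPred_eq, Set.mem_iUnion]
    refine ⟨fun ⟨θ, hθ⟩ => ?_, fun ⟨q, hq⟩ => ⟨q, hq⟩⟩
    exact Rat.denseRange_cast.exists_mem_open (isOpen_lt continuous_const (hL x)) ⟨θ, hθ⟩
  have hPm : MeasurableSet {x | ∃ θ, 0 < L x θ} := by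
    rw [hP]
    exact MeasurableSet.iUnion fun q => measurableSet_lt measurable_const (hm q)
  refine measurable_of_Iic fun t => ?_
  have e : (fun x => leastMaximizer (L x)) ⁻¹' Set.Iic t =
      ({x | ∃ θ, 0 < L x θ} ∩ {x | ∀ (q : ℚ) (m : ℕ), ∃ r : ℚ, (r : ℝ) < t ∧
        L x q < L x r + 1 / (m + 1)}) ∪ ({x | ∃ θ, 0 < L x θ}ᶜ ∩ {_x | 0 ≤ t}) := by
    ext x
    by_cases hx : ∃ θ, 0 < L x θ
    · have hl := isLeast_leastMaximizer (hL x) (h0 x) hx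
      have : leastMaximizer (L x) ≤ t ↔ ∃ θ ≤ t, ∀ θ', L x θ' ≤ L x θ :=
        ⟨fun h => ⟨_, h, hl.1⟩, fun ⟨θ, hθt, hθ⟩ => (hl.2 hθ).trans hθt⟩
      simp only [Set.mem_preimage, Set.mem_Iic, Set.mem_union, Set.mem_inter_iff,
        Set.mem_ofPred_eq, Set.mem_compl_iff, hx, true_and, not_true, false_and, or_false]
      rw [this, exists_isMaxOn_le_iff (hL x) (h0 x) hx]
    · simp only [Set.mem_preimage, Set.mem_Iic, Set.mem_union, Set.mem_inter_iff,
        Set.mem_ofPred_eq, Set.mem_compl_iff, hx, not_false_eq_true, true_and, false_and, false_or]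
      rw [leastMaximizer, if_neg hx]
  rw [e]
  refine (hPm.inter ?_).union (hPm.compl.inter (MeasurableSet.const _))
  simp only [Set.ofPred_forall, Set.ofPred_exists]
  refine MeasurableSet.iInter fun q => MeasurableSet.iInter fun m => MeasurableSet.iUnion fun r => ?_
  exact (MeasurableSet.const _).inter (measurableSet_lt (hm q) ((hm r).add_const _))

namespace IsShiftDensity

variable {f : ℝ → ℝ}

theorem exists_mle (hf : IsShiftDensity f)
    (hc : ConcaveOn ℝ (Function.support f) fun x => Real.log (f x)) :
    ∃ T : Estimator ℝ, IsMLE (shiftFamily f) T := by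
  have h0 := hf.tendsto_cocompact_of_concaveOn hc
  have hcont : ∀ (n : ℕ) (x : Fin n → ℝ), Continuous fun θ => ∏ i, shiftFamily f θ (x i) :=
    fun n x => continuous_finsetProd _ fun i _ =>
      hf.continuous.comp (continuous_sub_left (x i))
  have hlim : ∀ (n : ℕ) (x : Fin (n + 1) → ℝ),
      Tendsto (fun θ => ∏ i, shiftFamily f θ (x i)) (cocompact ℝ) (𝓝 0) := by
    intro n x
    have h1 : ∀ i, Tendsto (fun θ => shiftFamily f θ (x i)) (cocompact ℝ) (𝓝 0) := fun i =>
      h0.comp (Homeomorph.subLeft (x i)).isClosedEmbedding.tendsto_cocompact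
    have := tendsto_finsetProd (Finset.univ : Finset (Fin (n + 1))) fun i _ => h1 i
    simpa using this
  have hmeas : ∀ (n : ℕ) (θ : ℝ), Measurable fun x : Fin n → ℝ => ∏ i, shiftFamily f θ (x i) :=
    fun n θ => Finset.univ.measurable_prod fun i _ =>
      (hf.measurable_shiftFamily θ).comp (measurable_pi_apply i)
  -- The case `n = 0` is separate because the empty product is `1` and does not vanish at infinity.
  -- When the likelihood vanishes identically, any value is a maximizer.
  let T : Estimator ℝ :=
    { toFun := fun n x => match n with
        | 0 => 0
        | n + 1 => leastMaximizer fun θ => ∏ i : Fin (n + 1), shiftFamily f θ (x i)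
      measurable_toFun := fun n => match n with
        | 0 => measurable_const
        | n + 1 => measurable_leastMaximizer (hmeas (n + 1)) (hcont (n + 1)) (hlim n) }
  refine ⟨T, fun n x θ => ?_⟩
  match n with
  | 0 => simp
  | n + 1 =>
    by_cases hx : ∃ θ, 0 < ∏ i, shiftFamily f θ (x i)
    · exact (isLeast_leastMaximizer (hcont _ x) (hlim n x) hx).1 θ
    · push Not at hx
      exact (hx θ).trans (Finset.prod_nonneg fun i _ => hf.nonneg _)

end IsShiftDensity

theorem mainTheorem5 (f : ℝ → ℝ) (hf : IsSemiRegular f) (g : ℝ → ℝ) (hg : ∀ x, g x = x ^ 2)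
    (θ : ℝ) :
    (∀ κ : ℝ, IsIndex g κ ↔ κ = 2) ∧
    (∀ s ∈ Set.Ioo (0 : ℝ) 1,
      Tendsto (renyiQuot volume (shiftFamily f) g θ s) (𝓝[>] 0)
        (𝓝 (((s * (1 - s) / 2 : ℝ) : EReal) * ((fisherInfo f : ℝ≥0∞) : EReal)))) ∧
    alphaOneBar volume (shiftFamily f) g 2 θ = ((fisherInfo f / 2 : ℝ≥0∞) : EReal) ∧
    alphaOne volume (shiftFamily f) g θ = ((fisherInfo f / 2 : ℝ≥0∞) : EReal) ∧
    alphaTwoBar volume (shiftFamily f) g 2 θ = ((fisherInfo f / 2 : ℝ≥0∞) : EReal) ∧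
    alphaTwo volume (shiftFamily f) g θ = ((fisherInfo f / 2 : ℝ≥0∞) : EReal) ∧
    (ConcaveOn ℝ (Function.support f) (fun x => Real.log (f x)) →
      (∃ T : Estimator ℝ, IsMLE (shiftFamily f) T) ∧
      ∀ T : Estimator ℝ, IsMLE (shiftFamily f) T →
        alphaTwoOf volume (shiftFamily f) g T θ = ((fisherInfo f / 2 : ℝ≥0∞) : EReal) ∧
        Tendsto (fun ε : ℝ => localRate volume (shiftFamily f) T θ ε / ((g ε : ℝ) : EReal))
          (𝓝[>] 0) (𝓝 ((fisherInfo f / 2 : ℝ≥0∞) : EReal))) := by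
  have h := hf.isShiftDensity
  exact ⟨isIndex_sq_iff hg, fun s hs => h.tendsto_renyiQuot hg hs θ, h.alphaOneBar_eq hg θ,
    h.alphaOne_eq hg θ, h.alphaTwoBar_eq hg θ, h.alphaTwo_eq hg θ,
    fun hc => ⟨h.exists_mle hc, fun T hT => h.mle_attains hc hg hT θ⟩⟩
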